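/- **Setting.** Let $(\Omega,d,\mu)$ be an RD-space with indices $(k,n)$: a metric space with a Borel measure $\mu$ such that balls have positive finite measure, $\mu(\{x\})=0$ for all $x$, $0<k\le n$, and there are $0<C_1\le 1\le C_2$ with $$C_1\lambda^{k}\mu(B(x,r))\le\mu(B(x,\lambda r))\le C_2\lambda^{n}\mu(B(x,r))\qquad(x\in\Omega,\ r>0,\ \lambda\ge 1).$$ Assume that it is non-collapsing: $\inf_{x}\mu(B(x,1))>0$. Let $X$ be a rearrangement invariant (r.i.) Banach function space on $\Omega$ with the Fatou property. Its fundamental function is $\phi_X(t)=\|\chi_F\|_X$, where $\mu(F)=t$, and its upper fundamental index is $\bar\beta_X=\lim_{t\to\infty}\frac{\log M(t)}{\log t}$, where $M(t)=\sup_{s>0}\frac{\phi_X(st)}{\phi_X(s)}$. For $q\ge1$ let $X^{(q)}$ be the $q$-convexification, $\|f\|_{X^{(q)}}=\||f|^q\|_X^{1/q}$. Let $E$ be an r.i. space on $(0,\infty)$ with Lebesgue measure, and let $\tilde E$ be the corresponding r.i. space for the measure $dt/t$: $\|g\|_{\tilde E}=\|g^{*}\|_E$, where $g^*$ is the decreasing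 rearrangement of $g$ with respect to $dt/t$; $\|g\|_{\tilde E(0,1)}=\|g\chi_{(0,1)}\|_{\tilde E}$. A function is called almost increasing (resp. almost decreasing, or quasi-decreasing) if, up to multiplicative constants from above and below, it is equal to an increasing (resp. decreasing) function. Let $b$ be slowly varying: a positive measurable function on $(0,\infty)$ such that for every $\varepsilon>0$ the function $t^{\varepsilon}b(t)$ is almost increasing and $t^{-\varepsilon}b(t)$ is almost decreasing. For an r.i. space $Y$ on $\Omega$, $s>0$ and $f\in L^1+L^\infty$, with $E_Y(f,t)=\bigl\|\frac{1}{\mu(B(x,t))}\int_{B(x,t)}|f(x)-f(y)|\,d\mu(y)\bigr\|_{Y}$, put $$\|f\|_{\mathring B^{s,b}_{Y,E}}=\|t^{-s}b(t)E_Y(f,t)\|_{\tilde E},\qquad \|f\|_{B^{s,b}_{Y,E}}=\|t^{-s}b(t)E_Y(f,t)\|_{\tilde E(0,1)}+\|f\|_Y .$$ Let $\mathring B^{s,b}_{Y,E}$ be the set of $f\in L^1+L^\infty$ for which the first of these is finite, and let $B^{s,b}_{Y,E}=\mathring B^{s,b}_{Y,E}\cap Y$. **Theorem.** Let $0<\theta<\infty$,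 $1\le p<\infty$, $1<\sigma<\infty$, let $\bar\beta_X\le\gamma\le1$ be such that $\phi_X(t)/t^\gamma$ is quasi-decreasing, and put $\alpha=\theta+\frac{n\gamma}{p}\left(1-\frac1\sigma\right)$. Then $B^{\alpha,b}_{X^{(p)},E}\subset\mathring B^{\theta,b}_{X^{(\sigma p)},E}$ and $B^{\alpha,b}_{X^{(p)},E}\subset B^{\theta,b}_{X^{(\sigma p)},E}$, and there is a constant $C<\infty$, independent of $f$, such that: 1. $\|f\|_{\mathring B^{\theta,b}_{X^{(\sigma p)},E}}\le C\,\|f\|_{B^{\alpha,b}_{X^{(p)},E}}$ for all $f\in L^1+L^\infty$; 2. $\|f\|_{B^{\theta,b}_{X^{(\sigma p)},E}}\le C\,\|f\|_{B^{\alpha,b}_{X^{(p)},E}}$ for all $f\in L^1+L^\infty$; 3. for all $f\in B^{\alpha,b}_{X^{(p)},E}$, $$\|f\|_{X^{(p\sigma)}}\le C\,\|f\|_{X^{(p)}}^{\frac{\theta}{\alpha}}\,\|f\|_{B^{\alpha,b}_{X^{(p)},E}}^{1-\frac{\theta}{\alpha}}\left(1+\frac{1}{b\left(\left(\|f\|_{X^{(p)}}/\|f\|_{B^{\alpha,b}_{X^{(p)},E}}\right)^{\frac1\alpha}\right)}\right),$$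 where the right-hand side is read as $0$ if $\|f\|_{X^{(p)}}=0$. -/

import Mathlib

open MeasureTheory Set Filter Topology
open scoped NNReal ENNReal

noncomputable section

namespace HajlaszBesov

/-! ### Metric measure spaces -/

/-- `(Ω, d, μ)` is an RD-space with indices `(k, n)`: every ball has positive finite measure, points
are null sets, and the measure of balls satisfies two-sided power bounds under dilation. -/
structure IsRDSpace {Ω : Type*} [MetricSpace Ω] [MeasurableSpace Ω] (μ : Measure Ω)
    (k n : ℝ) : Prop where
  ball_pos : ∀ (x : Ω) (r : ℝ), 0 < r → 0 < μ (Metric.ball x r)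
  ball_lt_top : ∀ (x : Ω) (r : ℝ), 0 < r → μ (Metric.ball x r) < ∞
  atom_free : ∀ x : Ω, μ {x} = 0
  k_pos : 0 < k
  k_le_n : k ≤ n
  growth : ∃ C₁ C₂ : ℝ, 0 < C₁ ∧ C₁ ≤ 1 ∧ 1 ≤ C₂ ∧
    ∀ (x : Ω) (r : ℝ), 0 < r → ∀ l : ℝ, 1 ≤ l →
      ENNReal.ofReal (C₁ * l ^ k) * μ (Metric.ball x r) ≤ μ (Metric.ball x (l * r)) ∧
      μ (Metric.ball x (l * r)) ≤ ENNReal.ofReal (C₂ * l ^ n) * μ (Metric.ball x r)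

/-- The non-collapsing property: `inf_x μ(B(x,1)) > 0`. -/
def NonCollapsing {Ω : Type*} [MetricSpace Ω] [MeasurableSpace Ω] (μ : Measure Ω) : Prop :=
  0 < ⨅ x : Ω, μ (Metric.ball x 1)

/-! ### Rearrangements and rearrangement invariant norms

A function space is represented by its function norm `ρ`, a functional on `[0,∞]`-valued functions;
the norm of a real-valued `f` is `ρ |f|`, and `f` belongs to the space iff this is finite. -/

/-- The decreasing rearrangement `g*(s) = inf {t ≥ 0 : μ {g > t} ≤ s}`. -/
def decRearr {Ω : Type*} [MeasurableSpace Ω] (μ : Measure Ω) (g : Ω → ℝ≥0∞) (s : ℝ) : ℝ≥0∞ :=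
  sInf {t : ℝ≥0∞ | μ {x | t < g x} ≤ ENNReal.ofReal s}

/-- `ρ` is the norm of a rearrangement invariant Banach function space with the Fatou property
on `(Ω, μ)`. -/
structure IsRINorm {Ω : Type*} [MeasurableSpace Ω] (μ : Measure Ω)
    (ρ : (Ω → ℝ≥0∞) → ℝ≥0∞) : Prop where
  eq_zero_iff : ∀ f : Ω → ℝ≥0∞, AEMeasurable f μ → (ρ f = 0 ↔ f =ᵐ[μ] 0)
  smul : ∀ (c : ℝ≥0) (f : Ω → ℝ≥0∞), AEMeasurable f μ → ρ (fun x => c * f x) = c * ρ f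
  add_le : ∀ f g : Ω → ℝ≥0∞, AEMeasurable f μ → AEMeasurable g μ →
    ρ (fun x => f x + g x) ≤ ρ f + ρ g
  mono : ∀ f g : Ω → ℝ≥0∞, AEMeasurable f μ → AEMeasurable g μ → f ≤ᵐ[μ] g → ρ f ≤ ρ g
  fatou : ∀ f : ℕ → Ω → ℝ≥0∞, (∀ i, AEMeasurable (f i) μ) → Monotone f →
    ρ (fun x => ⨆ i, f i x) = ⨆ i, ρ (f i)
  indicator_lt_top : ∀ S : Set Ω, MeasurableSet S → μ S < ∞ → ρ (S.indicator fun _ => 1) < ∞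
  setLIntegral_le : ∀ S : Set Ω, MeasurableSet S → μ S < ∞ →
    ∃ C : ℝ≥0, ∀ f : Ω → ℝ≥0∞, AEMeasurable f μ → ∫⁻ x in S, f x ∂μ ≤ C * ρ f
  rearrangement_invariant : ∀ f g : Ω → ℝ≥0∞, AEMeasurable f μ → AEMeasurable g μ →
    (∀ᵐ s ∂(volume.restrict (Ioi (0 : ℝ))), decRearr μ f s ≤ decRearr μ g s) → ρ f ≤ ρ g

/-- The norm of a real-valued function. -/
def normOf {Ω : Type*} (ρ : (Ω → ℝ≥0∞) → ℝ≥0∞) (f : Ω → ℝ) : ℝ≥0∞ := ρ fun x => ‖f x‖ₑ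

/-- The norm of the `q`-convexification `X^(q)`: `‖f‖ = ‖ |f|^q ‖_X ^ (1/q)`. -/
def convexification {Ω : Type*} (q : ℝ) (ρ : (Ω → ℝ≥0∞) → ℝ≥0∞) :
    (Ω → ℝ≥0∞) → ℝ≥0∞ :=
  fun f => (ρ fun x => f x ^ q) ^ (1 / q)

/-- The fundamental function `φ(t) = ‖χ_F‖`, `μ(F) = t`. For a rearrangement invariant norm all the
sets `F` of measure `t` give the same value, so the supremum is that common value. -/
def fundamentalFunction {Ω : Type*} [MeasurableSpace Ω] (μ : Measure Ω)
    (ρ : (Ω → ℝ≥0∞) → ℝ≥0∞) (t : ℝ) : ℝ :=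
  (⨆ (F : Set Ω) (_ : MeasurableSet F ∧ μ F = ENNReal.ofReal t),
    ρ (F.indicator fun _ => 1)).toReal

/-- Membership in `L¹ + L^∞`. -/
def MemL1AddLinfty {Ω : Type*} [MeasurableSpace Ω] (μ : Measure Ω) (f : Ω → ℝ) : Prop :=
  ∃ g h : Ω → ℝ, MemLp g 1 μ ∧ MemLp h ∞ μ ∧ f =ᵐ[μ] g + h

/-! ### Extension indices, slowly varying functions -/

/-- The dilation function `M_φ(t) = sup_{s>0} φ(st)/φ(s)`. -/
def dilationFunction (φ : ℝ → ℝ) (t : ℝ) : ℝ≥0∞ :=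
  ⨆ (s : ℝ) (_ : 0 < s), ENNReal.ofReal (φ (s * t) / φ s)

/-- The upper extension index `lim_{t → ∞} log M_φ(t) / log t`. -/
def upperExtensionIndex (φ : ℝ → ℝ) : ℝ :=
  limUnder atTop fun t : ℝ => Real.log (dilationFunction φ t).toReal / Real.log t

/-- On `(0,∞)`, `f` is equivalent (up to multiplicative constants) to an increasing function. -/
def AlmostIncreasing (f : ℝ → ℝ) : Prop :=
  ∃ g : ℝ → ℝ, MonotoneOn g (Ioi 0) ∧ ∃ c C : ℝ, 0 < c ∧ 0 < C ∧
    ∀ t : ℝ, 0 < t → c * g t ≤ f t ∧ f t ≤ C * g t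

/-- On `(0,∞)`, `f` is equivalent (up to multiplicative constants) to a decreasing function. -/
def AlmostDecreasing (f : ℝ → ℝ) : Prop :=
  ∃ g : ℝ → ℝ, AntitoneOn g (Ioi 0) ∧ ∃ c C : ℝ, 0 < c ∧ 0 < C ∧
    ∀ t : ℝ, 0 < t → c * g t ≤ f t ∧ f t ≤ C * g t

/-- Slowly varying functions on `(0,∞)`. -/
structure SlowlyVarying (b : ℝ → ℝ) : Prop where
  pos : ∀ t : ℝ, 0 < t → 0 < b t
  aemeasurable : AEMeasurable b (volume.restrict (Ioi (0 : ℝ)))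
  almostIncreasing : ∀ ε : ℝ, 0 < ε → AlmostIncreasing fun t => t ^ ε * b t
  almostDecreasing : ∀ ε : ℝ, 0 < ε → AlmostDecreasing fun t => t ^ (-ε) * b t

/-! ### Parameters -/

/-- A parameter: a rearrangement invariant space on `(0,∞)` with Lebesgue measure. -/
def IsParameter (E : (ℝ → ℝ≥0∞) → ℝ≥0∞) : Prop := IsRINorm (volume.restrict (Ioi (0 : ℝ))) E

/-- The measure `dt/t` on `(0,∞)`. -/
def homMeasure : Measure ℝ :=
  (volume.restrict (Ioi (0 : ℝ))).withDensity fun t => ENNReal.ofReal t⁻¹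

/-- The norm of `Ẽ`, the rearrangement invariant space with respect to `dt/t` which corresponds
to `E`: the `E`-norm of the decreasing rearrangement with respect to `dt/t`. -/
def tildeNorm (E : (ℝ → ℝ≥0∞) → ℝ≥0∞) (g : ℝ → ℝ≥0∞) : ℝ≥0∞ := E (decRearr homMeasure g)

/-! ### Hajłasz–Besov spaces -/

section Besov

variable {Ω : Type*} [MetricSpace Ω] [MeasurableSpace Ω]

/-- The `X`-modulus of continuity: the `X`-norm of `x ↦ ⨍_{B(x,t)} |f(x) - f(y)| dμ(y)`. -/
def modulus (μ : Measure Ω) (X : (Ω → ℝ≥0∞) → ℝ≥0∞) (f : Ω → ℝ) (t : ℝ) : ℝ≥0∞ :=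
  X fun x => ⨍⁻ y in Metric.ball x t, ‖f x - f y‖ₑ ∂μ

/-- The function `t ↦ t^{-θ} b(t) E_X(f,t)`. -/
def besovWeight (μ : Measure Ω) (X : (Ω → ℝ≥0∞) → ℝ≥0∞) (θ : ℝ) (b : ℝ → ℝ) (f : Ω → ℝ) :
    ℝ → ℝ≥0∞ :=
  fun t => ENNReal.ofReal (t ^ (-θ) * b t) * modulus μ X f t

/-- The homogeneous norm `‖t^{-θ} b(t) E_X(f,t)‖_Ẽ`. -/
def homBesovNorm (μ : Measure Ω) (X : (Ω → ℝ≥0∞) → ℝ≥0∞) (E : (ℝ → ℝ≥0∞) → ℝ≥0∞)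
    (θ : ℝ) (b : ℝ → ℝ) (f : Ω → ℝ) : ℝ≥0∞ :=
  tildeNorm E (besovWeight μ X θ b f)

/-- The inhomogeneous norm `‖t^{-θ} b(t) E_X(f,t)‖_{Ẽ(0,1)} + ‖f‖_X`. -/
def besovNorm (μ : Measure Ω) (X : (Ω → ℝ≥0∞) → ℝ≥0∞) (E : (ℝ → ℝ≥0∞) → ℝ≥0∞)
    (θ : ℝ) (b : ℝ → ℝ) (f : Ω → ℝ) : ℝ≥0∞ :=
  tildeNorm E ((Ioo (0 : ℝ) 1).indicator (besovWeight μ X θ b f)) + normOf X f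

/-- The generalised homogeneous Hajłasz–Besov space. -/
def homBesovSpace (μ : Measure Ω) (X : (Ω → ℝ≥0∞) → ℝ≥0∞) (E : (ℝ → ℝ≥0∞) → ℝ≥0∞)
    (θ : ℝ) (b : ℝ → ℝ) : Set (Ω → ℝ) :=
  {f | MemL1AddLinfty μ f ∧ homBesovNorm μ X E θ b f < ∞}

/-- The generalised Hajłasz–Besov space: the intersection of the homogeneous one with `X`. -/
def besovSpace (μ : Measure Ω) (X : (Ω → ℝ≥0∞) → ℝ≥0∞) (E : (ℝ → ℝ≥0∞) → ℝ≥0∞)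
    (θ : ℝ) (b : ℝ → ℝ) : Set (Ω → ℝ) :=
  {f | f ∈ homBesovSpace μ X E θ b ∧ normOf X f < ∞}

end Besov

end HajlaszBesov

end

/-! The theorem is a Sobolev embedding obtained one dyadic scale at a time. Let `osc μ f t x` be the
mean of |f(x) - f| over B(x,t) and put δ = (nγ/p)(1 - 1/σ), so that α = θ + δ.

The increment of the oscillation between the scales t/2 and t has two bounds. Trivially it is at
most the sum of the two oscillations, which has X^(p)-norm of order E(f,2t) in X^(p). By the
triangle inequality and doubling it is also at most a constant times the mean of `osc μ f (2 * t)`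
over B(x,t/2). In an r.i. space the mean of g over S times ‖χ_S‖ is at most ‖g‖
(`IsRINorm.setLIntegral_mul_le`), and non-collapsing together with the quasi-decrease of φ(t)/t^γ
gives ‖χ_B(x,r)‖ ≥ c r^(nγ) for r ≤ 1 (`IsRDSpace.exists_norm_ball_lower`). The increment is thus
bounded by a constant of order t^(-nγ/p) E(f,2t). Interpolating the two bounds puts it in X^(σp)
with norm of order t^(-δ) E(f,2t), and telescoping gives `exists_modulus_le_tsum`.

After multiplication by t^(-θ) b(t), half of θ pays for the variation of b and the other half leaves
a geometric convolution of the dyadic sequence for (α, X^(p)). On dyadic step functions Ẽ is a shift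
invariant sequence norm (`seqNorm_eq`), so the convolution is bounded. At large scales the modulus
is controlled by norms of f, and t^(-θ) b(t) decays. This is `exists_homBesovNorm_le`.

The X^(σp)-norm of f is at most its modulus at scale t plus the norm of its averages over balls of
radius t. A weak type estimate interpolated with a sup bound (`exists_norm_laverage_rpow_le`) shows
that averaging maps X^(p) to X^(σp) with norm of order t^(-δ). The result, `exists_normOf_le`, has a
free scale: a fixed scale bounds the norm by the Besov norm, and the scale balancing the two terms
yields the third estimate (`SlowlyVarying.exists_optimal_scale`). -/

namespace HajlaszBesov

/-! ### Distribution functions and decreasing rearrangements -/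

section Rearrangement

variable {Ω : Type*} [MeasurableSpace Ω] {μ : Measure Ω}

/-- The infimum is attained: as levels decrease to t the superlevel sets increase to {t < g}, and μ
is continuous along increasing unions even of nonmeasurable sets. No measurability of g is therefore
needed. -/
lemma decRearr_le_iff {g : Ω → ℝ≥0∞} {s : ℝ} {t : ℝ≥0∞} :
    decRearr μ g s ≤ t ↔ μ {x | t < g x} ≤ ENNReal.ofReal s := by
  constructor
  · intro h
    rcases eq_or_ne t ∞ with rfl | ht
    · simp
    obtain ⟨u, hu, hut, hlim⟩ := exists_seq_strictAnti_tendsto' (lt_top_iff_ne_top.2 ht)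
    have hset : {x | t < g x} = ⋃ n, {x | u n < g x} := by
      ext x
      simp only [mem_ofPred_eq, mem_iUnion]
      constructor
      · intro hx
        exact ((tendsto_order.1 hlim).2 _ hx).exists
      · rintro ⟨n, hn⟩
        exact (hut n).1.trans hn
    rw [hset, Monotone.measure_iUnion]
    · refine iSup_le fun n => ?_
      obtain ⟨a, ha, hau⟩ := sInf_lt_iff.1 (h.trans_lt (hut n).1)
      exact (measure_mono fun x (hx : u n < g x) => hau.trans hx).trans ha
    · intro m n hmn x (hx : u m < g x)
      exact (hu.antitone hmn).trans_lt hx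
  · intro h
    exact sInf_le h

lemma lt_decRearr_iff {g : Ω → ℝ≥0∞} {s : ℝ} {t : ℝ≥0∞} :
    t < decRearr μ g s ↔ ENNReal.ofReal s < μ {x | t < g x} := by
  rw [← not_le, decRearr_le_iff, not_le]

lemma decRearr_antitone (g : Ω → ℝ≥0∞) : Antitone (decRearr μ g) := by
  intro s s' h
  rw [decRearr_le_iff]
  exact (decRearr_le_iff.1 le_rfl).trans (ENNReal.ofReal_le_ofReal h)

lemma measurable_decRearr (g : Ω → ℝ≥0∞) : Measurable (decRearr μ g) :=
  (decRearr_antitone g).measurable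

/-- Equimeasurability of g and g*: by `lt_decRearr_iff` the level set of g* in (0,∞) is an interval
starting at 0 whose length is μ {t < g}. -/
lemma distribution_decRearr (g : Ω → ℝ≥0∞) (t : ℝ≥0∞) :
    (volume.restrict (Ioi (0 : ℝ))) {s | t < decRearr μ g s} = μ {x | t < g x} := by
  rw [Measure.restrict_apply (measurableSet_lt measurable_const (measurable_decRearr g))]
  simp only [lt_decRearr_iff]
  rcases eq_or_ne (μ {x | t < g x}) ∞ with h | h
  · rw [h]
    simp
  · have : {s | ENNReal.ofReal s < μ {x | t < g x}} ∩ Ioi 0 = Ioo 0 (μ {x | t < g x}).toReal := by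
      ext s
      simp only [mem_inter_iff, mem_ofPred_eq, mem_Ioi, mem_Ioo]
      constructor
      · rintro ⟨h1, h2⟩
        exact ⟨h2, (ENNReal.ofReal_lt_iff_lt_toReal h2.le h).1 h1⟩
      · rintro ⟨h1, h2⟩
        exact ⟨(ENNReal.ofReal_lt_iff_lt_toReal h1.le h).2 h2, h1⟩
    rw [this, Real.volume_Ioo, sub_zero, ENNReal.ofReal_toReal h]

end Rearrangement

/-! ### Basic properties of rearrangement invariant norms -/

namespace IsRINorm

variable {Ω : Type*} [MeasurableSpace Ω] {μ : Measure Ω} {ρ : (Ω → ℝ≥0∞) → ℝ≥0∞}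

/-- Rearrangement invariance enters the proof through this comparison of distribution functions. -/
lemma le_of_distribution_le (h : IsRINorm μ ρ) {f g : Ω → ℝ≥0∞} (hf : AEMeasurable f μ)
    (hg : AEMeasurable g μ) (hfg : ∀ t, μ {x | t < f x} ≤ μ {x | t < g x}) : ρ f ≤ ρ g := by
  refine h.rearrangement_invariant f g hf hg (Eventually.of_forall fun s => ?_)
  rw [decRearr_le_iff]
  exact (hfg _).trans (decRearr_le_iff.1 le_rfl)

lemma congr_ae (h : IsRINorm μ ρ) {f g : Ω → ℝ≥0∞} (hf : AEMeasurable f μ) (hfg : f =ᵐ[μ] g) :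
    ρ f = ρ g :=
  le_antisymm (h.mono f g hf (hf.congr hfg) hfg.le) (h.mono g f (hf.congr hfg) hf hfg.symm.le)

lemma mono' (h : IsRINorm μ ρ) {f g : Ω → ℝ≥0∞} (hf : AEMeasurable f μ) (hg : AEMeasurable g μ)
    (hfg : ∀ x, f x ≤ g x) : ρ f ≤ ρ g :=
  h.mono f g hf hg (Eventually.of_forall hfg)

lemma zero (h : IsRINorm μ ρ) : ρ (fun _ => 0) = 0 :=
  (h.eq_zero_iff _ aemeasurable_const).2 (Eventually.of_forall fun _ => rfl)

lemma sum_le (h : IsRINorm μ ρ) {ι : Type*} (s : Finset ι) {f : ι → Ω → ℝ≥0∞}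
    (hf : ∀ i, AEMeasurable (f i) μ) : ρ (fun x => ∑ i ∈ s, f i x) ≤ ∑ i ∈ s, ρ (f i) := by
  classical
  induction s using Finset.induction_on with
  | empty => simp [h.zero]
  | insert i s hi ih =>
    simp only [Finset.sum_insert hi]
    refine (h.add_le _ _ (hf i) (Finset.aemeasurable_fun_sum _ fun i _ => hf i)).trans ?_
    gcongr

lemma tsum_le (h : IsRINorm μ ρ) {f : ℕ → Ω → ℝ≥0∞} (hf : ∀ i, AEMeasurable (f i) μ) :
    ρ (fun x => ∑' i, f i x) ≤ ∑' i, ρ (f i) := by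
  simp only [ENNReal.tsum_eq_iSup_nat]
  rw [h.fatou (fun n x => ∑ i ∈ Finset.range n, f i x)
    (fun n => Finset.aemeasurable_fun_sum _ fun i _ => hf i)]
  · exact iSup_mono fun n => h.sum_le _ hf
  · intro m n hmn x
    exact Finset.sum_le_sum_of_subset (Finset.range_mono hmn)

lemma ae_lt_top [SigmaFinite μ] (h : IsRINorm μ ρ) {f : Ω → ℝ≥0∞} (hf : AEMeasurable f μ)
    (hρ : ρ f < ∞) : ∀ᵐ x ∂μ, f x < ∞ := by
  have : ∀ n, ∀ᵐ x ∂μ, x ∈ spanningSets μ n → f x < ∞ := by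
    intro n
    rw [← ae_restrict_iff' (measurableSet_spanningSets μ n)]
    obtain ⟨C, hC⟩ := h.setLIntegral_le _ (measurableSet_spanningSets μ n)
      (measure_spanningSets_lt_top μ n)
    exact ae_lt_top' hf.restrict ((hC f hf).trans_lt (ENNReal.mul_lt_top (by simp) hρ)).ne
  filter_upwards [ae_all_iff.2 this] with x hx
  exact hx _ (mem_spanningSetsIndex μ x)

/-- For c = ∞ the right side is ∞ unless ρ f = 0, and in that case f vanishes almost everywhere. -/
lemma ennreal_smul_le [SigmaFinite μ] (h : IsRINorm μ ρ) (c : ℝ≥0∞) {f : Ω → ℝ≥0∞}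
    (hf : AEMeasurable f μ) : ρ (fun x => c * f x) ≤ c * ρ f := by
  rcases eq_or_ne c ∞ with rfl | hc
  · rcases eq_or_ne (ρ f) 0 with h0 | h0
    · have h1 := (h.eq_zero_iff f hf).1 h0
      rw [h.congr_ae (g := fun _ => 0) (hf.const_mul _), h.zero]
      · exact zero_le
      · filter_upwards [h1] with x hx
        simp [hx]
    · simp [ENNReal.top_mul h0]
  · lift c to ℝ≥0 using hc
    exact (h.smul c f hf).le

end IsRINorm

/-! ### Averages over sets of finite measure -/

/-- An intermediate value property of diffuse measures. Countable separation gives an injective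
measurable map e to ℝ; the measure of S ∩ {e ≤ x} runs from 0 to μ S without jumps, and x₀ is the
point where it reaches t. -/
lemma exists_subset_measure_eq {Ω : Type*} [MeasurableSpace Ω] [MeasurableSpace.CountablySeparated Ω]
    (μ : Measure Ω) [NullSingletonClass μ] {S : Set Ω} (hS : MeasurableSet S) (hfin : μ S < ∞) {t : ℝ≥0∞}
    (ht : t ≤ μ S) : ∃ A ⊆ S, MeasurableSet A ∧ μ A = t := by
  obtain ⟨e₁, he₁, hi₁⟩ := MeasurableSpace.measurable_injection_nat_bool_of_countablySeparated Ω
  set e : Ω → ℝ := embeddingReal (ℕ → Bool) ∘ e₁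
  have he : Measurable e := (measurableEmbedding_embeddingReal _).measurable.comp he₁
  have hi : Function.Injective e := (measurableEmbedding_embeddingReal _).injective.comp hi₁
  rcases eq_or_ne t 0 with rfl | ht0
  · exact ⟨∅, empty_subset _, MeasurableSet.empty, measure_empty⟩
  rcases eq_or_lt_of_le ht with rfl | htS
  · exact ⟨S, Subset.rfl, hS, rfl⟩
  have hup : Tendsto (fun x : ℝ => μ (S ∩ e ⁻¹' Iic x)) atTop (𝓝 (μ S)) := by
    have : S = ⋃ x : ℝ, S ∩ e ⁻¹' Iic x := by
      ext y
      simp only [mem_iUnion, mem_inter_iff, mem_preimage, mem_Iic]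
      exact ⟨fun hy => ⟨e y, hy, le_rfl⟩, fun ⟨_, hy, _⟩ => hy⟩
    conv in (𝓝 (μ S)) => rw [this]
    refine tendsto_measure_iUnion_atTop fun a b hab => ?_
    exact inter_subset_inter_right _ (preimage_mono (Iic_subset_Iic.2 hab))
  have hdown : Tendsto (fun x : ℝ => μ (S ∩ e ⁻¹' Iic x)) atBot (𝓝 0) := by
    have : (0 : ℝ≥0∞) = μ (⋂ x : ℝ, S ∩ e ⁻¹' Iic x) := by
      rw [eq_comm, ← nonpos_iff_eq_zero, ← measure_empty (μ := μ)]
      refine measure_mono fun y hy => ?_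
      have := (mem_iInter.1 hy (e y - 1)).2
      simp only [mem_preimage, mem_Iic] at this
      linarith
    rw [this]
    refine tendsto_measure_iInter_atBot
      (fun x => (hS.inter (he measurableSet_Iic)).nullMeasurableSet) (fun a b hab => ?_) ⟨0, ?_⟩
    · exact inter_subset_inter_right _ (preimage_mono (Iic_subset_Iic.2 hab))
    · exact ((measure_mono inter_subset_left).trans_lt hfin).ne
  set T : Set ℝ := {x | μ (S ∩ e ⁻¹' Iic x) ≤ t}
  have hTne : T.Nonempty :=
    ((tendsto_order.1 hdown).2 t (pos_iff_ne_zero.2 ht0)).exists.imp fun x hx => le_of_lt hx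
  have hTb : BddAbove T := by
    obtain ⟨M, hM⟩ := ((tendsto_order.1 hup).1 t htS).exists
    refine ⟨M, fun x hx => le_of_not_gt fun hMx => ?_⟩
    exact (hM.trans_le (measure_mono (inter_subset_inter_right _
      (preimage_mono (Iic_subset_Iic.2 hMx.le))))).not_ge hx
  set x₀ := sSup T
  have hlow : μ (S ∩ e ⁻¹' Iio x₀) ≤ t := by
    obtain ⟨u, hu, hux, hlim⟩ := exists_seq_strictMono_tendsto x₀
    have : S ∩ e ⁻¹' Iio x₀ = ⋃ n, S ∩ e ⁻¹' Iic (u n) := by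
      ext y
      simp only [mem_iUnion, mem_inter_iff, mem_preimage, mem_Iic, mem_Iio]
      constructor
      · rintro ⟨h1, h2⟩
        obtain ⟨n, hn⟩ := ((tendsto_order.1 hlim).1 _ h2).exists
        exact ⟨n, h1, hn.le⟩
      · rintro ⟨n, h1, h2⟩
        exact ⟨h1, h2.trans_lt (hux n)⟩
    rw [this, Monotone.measure_iUnion]
    · refine iSup_le fun n => ?_
      obtain ⟨z, hz, hzu⟩ := exists_lt_of_lt_csSup hTne (hux n)
      exact (measure_mono (inter_subset_inter_right _
        (preimage_mono (Iic_subset_Iic.2 hzu.le)))).trans hz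
    · intro a b hab
      exact inter_subset_inter_right _ (preimage_mono (Iic_subset_Iic.2 (hu.monotone hab)))
  have hhigh : t ≤ μ (S ∩ e ⁻¹' Iic x₀) := by
    obtain ⟨u, hu, hux, hlim⟩ := exists_seq_strictAnti_tendsto x₀
    have : S ∩ e ⁻¹' Iic x₀ = ⋂ n, S ∩ e ⁻¹' Iic (u n) := by
      ext y
      simp only [mem_iInter, mem_inter_iff, mem_preimage, mem_Iic]
      constructor
      · rintro ⟨h1, h2⟩ n
        exact ⟨h1, h2.trans (hux n).le⟩
      · intro h
        exact ⟨(h 0).1, ge_of_tendsto' hlim fun n => (h n).2⟩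
    rw [this, Antitone.measure_iInter]
    · refine le_iInf fun n => le_of_not_gt fun hn => ?_
      exact (hux n).not_ge (le_csSup hTb hn.le)
    · intro a b hab
      exact inter_subset_inter_right _ (preimage_mono (Iic_subset_Iic.2 (hu.antitone hab)))
    · exact fun n => (hS.inter (he measurableSet_Iic)).nullMeasurableSet
    · exact ⟨0, ((measure_mono inter_subset_left).trans_lt hfin).ne⟩
  refine ⟨S ∩ e ⁻¹' Iic x₀, inter_subset_left, hS.inter (he measurableSet_Iic),
    le_antisymm (le_trans ?_ hlow) hhigh⟩
  -- No jump occurs at x₀: by injectivity the fibre of e over x₀ has at most one point, so it is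
  -- null.
  have hsub : S ∩ e ⁻¹' Iic x₀ ⊆ (S ∩ e ⁻¹' Iio x₀) ∪ e ⁻¹' {x₀} := by
    rintro y ⟨h1, h2⟩
    rcases eq_or_lt_of_le (show e y ≤ x₀ from h2) with h | h
    · exact Or.inr h
    · exact Or.inl ⟨h1, h⟩
  have hnull : μ (e ⁻¹' {x₀}) = 0 :=
    (subsingleton_singleton.preimage hi).measure_zero μ
  calc _ ≤ _ := measure_mono hsub
    _ ≤ _ := measure_union_le _ _
    _ = _ := by rw [hnull, add_zero]

section Averages

variable {Ω : Type*} [MeasurableSpace Ω] [MeasurableSpace.CountablySeparated Ω]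
  {μ : Measure Ω} [NullSingletonClass μ] {ρ : (Ω → ℝ≥0∞) → ℝ≥0∞}

lemma exists_equal_labelling (N : ℕ) {a : ℝ≥0∞} (ha : a ≠ ∞) :
    ∀ {S : Set Ω}, MeasurableSet S → μ S = (N + 1 : ℕ) * a →
    ∃ l : Ω → Fin (N + 1), Measurable l ∧ ∀ i, μ (S ∩ l ⁻¹' {i}) = a := by
  induction N with
  | zero =>
    intro S hS hm
    refine ⟨fun _ => 0, measurable_const, fun i => ?_⟩
    have : S ∩ (fun _ => 0) ⁻¹' {i} = S := by
      ext x
      have : (0 : Fin (0 + 1)) = i := Fin.ext (by omega)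
      simp [this]
    simpa [this] using hm
  | succ N ih =>
    intro S hS hm
    have hfin : μ S < ∞ := by
      rw [hm]
      exact ENNReal.mul_lt_top (by simp) ha.lt_top
    obtain ⟨A, hAS, hA, hAa⟩ := exists_subset_measure_eq μ hS hfin (t := a) (by
      rw [hm]
      push_cast
      calc a = 1 * a := (one_mul a).symm
        _ ≤ _ := by gcongr; exact le_add_self)
    have hdiff : μ (S \ A) = (N + 1 : ℕ) * a := by
      rw [measure_sdiff hAS hA.nullMeasurableSet (by rw [hAa]; exact ha), hm, hAa]
      push_cast
      rw [add_mul _ (1 : ℝ≥0∞), one_mul]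
      exact ENNReal.add_sub_cancel_right ha
    obtain ⟨l, hl, hla⟩ := ih (hS.diff hA) hdiff
    classical
    refine ⟨fun x => if x ∈ A then Fin.last (N + 1) else (l x).castSucc,
      Measurable.ite hA measurable_const ((measurable_of_finite _).comp hl), fun i => ?_⟩
    induction i using Fin.lastCases with
    | last =>
      convert hAa using 2
      ext x
      by_cases hx : x ∈ A
      · simp [hx, hAS hx]
      · simp [hx]
    | cast i =>
      convert hla i using 2
      ext x
      by_cases hx : x ∈ A
      · simp [hx, Fin.ext_iff, (Fin.is_lt i).ne']
      · simp [hx]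

namespace IsRINorm

/-- Averaging by cyclic permutations. S is cut into N + 1 pieces of equal measure a, and the values
of the rearrangement of g χ_S at multiples of a are distributed over the pieces in all cyclic
orders. Each arrangement has norm at most ρ g, while their sum is constant on S. The second term on
the right is the discretisation error, which vanishes as N grows. -/
lemma setLIntegral_mul_le_of_bounded (h : IsRINorm μ ρ) {S : Set Ω} (hS : MeasurableSet S)
    (hfin : μ S < ∞) {g : Ω → ℝ≥0∞} (hg : AEMeasurable g μ) {M : ℝ≥0} (hM : ∀ x, g x ≤ M)
    (N : ℕ) :
    (∫⁻ x in S, g x ∂μ) * ρ (S.indicator fun _ => 1) ≤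
      μ S * ρ g + μ S / (N + 1 : ℕ) * M * ρ (S.indicator fun _ => 1) := by
  set a : ℝ≥0∞ := μ S / (N + 1 : ℕ) with ha_def
  have hN0 : ((N + 1 : ℕ) : ℝ≥0∞) ≠ 0 := by simp
  have hNt : ((N + 1 : ℕ) : ℝ≥0∞) ≠ ∞ := ENNReal.natCast_ne_top _
  have ha : a ≠ ∞ := (ENNReal.div_lt_top hfin.ne hN0).ne
  have hm : μ S = (N + 1 : ℕ) * a := (ENNReal.mul_div_cancel hN0 hNt).symm
  obtain ⟨l, hl, hla⟩ := exists_equal_labelling N ha hS hm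
  have hgS : AEMeasurable (S.indicator g) μ := hg.indicator hS
  set D : ℝ≥0∞ → ℝ≥0∞ := fun t => μ {x | t < S.indicator g x} with hD
  set c : Fin (N + 1) → ℝ≥0∞ := fun i => decRearr μ (S.indicator g) ((i + 1 : ℕ) * a.toReal)
    with hc_def
  have hc : ∀ i t, t < c i ↔ ((i + 1 : ℕ) : ℝ≥0∞) * a < D t := by
    intro i t
    rw [hc_def, lt_decRearr_iff, ENNReal.ofReal_mul (by positivity), ENNReal.ofReal_toReal ha,
      ENNReal.ofReal_natCast]
  set J : ℝ≥0∞ → Finset (Fin (N + 1)) := fun t => Finset.univ.filter fun i => t < c i with hJ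
  have hcanti : ∀ i j t, i ≤ j → t < c j → t < c i := by
    intro i j t hij hj
    refine hj.trans_le (decRearr_antitone _ ?_)
    have : ((i + 1 : ℕ) : ℝ) ≤ ((j + 1 : ℕ) : ℝ) := by exact_mod_cast Nat.succ_le_succ hij
    gcongr
  -- Since c is decreasing, J t is an initial segment, and the distribution function D t lies
  -- between card (J t) · a and (card (J t) + 1) · a.
  have hlow : ∀ t, ((J t).card : ℝ≥0∞) * a ≤ D t := by
    intro t
    rcases (J t).eq_empty_or_nonempty with h0 | hne
    · simp [h0]
    · set i := (J t).max' hne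
      have hi : t < c i := (Finset.mem_filter.1 ((J t).max'_mem hne)).2
      refine le_trans ?_ ((hc i t).1 hi).le
      gcongr
      calc (J t).card ≤ (Finset.Iic i).card :=
            Finset.card_le_card fun j hj => Finset.mem_Iic.2 (Finset.le_max' _ _ hj)
        _ = i + 1 := by simp
  have hupp : ∀ t, D t ≤ ((J t).card + 1 : ℝ≥0∞) * a := by
    intro t
    rcases Nat.lt_or_ge (J t).card (N + 1) with hlt | hge
    · have hi : ¬ t < c ⟨(J t).card, hlt⟩ := by
        intro hi
        have : Finset.Iic (⟨(J t).card, hlt⟩ : Fin (N + 1)) ⊆ J t := fun j hj =>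
          Finset.mem_filter.2 ⟨Finset.mem_univ _, hcanti _ _ t (Finset.mem_Iic.1 hj) hi⟩
        have := Finset.card_le_card this
        simp at this
      rw [hc, not_lt] at hi
      simpa using hi
    · calc D t ≤ μ S := measure_mono fun x (hx : t < S.indicator g x) => by
            by_contra hxS
            simp [indicator_of_notMem hxS] at hx
        _ = (N + 1 : ℕ) * a := hm
        _ ≤ _ := by
          gcongr
          calc ((N + 1 : ℕ) : ℝ≥0∞) ≤ ((J t).card : ℝ≥0∞) := by exact_mod_cast hge
            _ ≤ _ := le_self_add
  -- Addition in `Fin (N + 1)` is cyclic, so k rotates the values c over the pieces; at each point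
  -- of S the sum over k runs once through all c i.
  set v : Fin (N + 1) → Ω → ℝ≥0∞ := fun k => S.indicator fun x => c (l x + k) with hv
  have hvm : ∀ k, Measurable (v k) := fun k =>
    (Measurable.comp (g := fun i => c (i + k)) (measurable_of_finite _) hl).indicator hS
  have hvρ : ∀ k, ρ (v k) ≤ ρ g := by
    intro k
    refine (h.le_of_distribution_le (hvm k).aemeasurable hgS fun t => ?_).trans
      (h.mono' hgS hg fun x => indicator_le_self _ _ x)
    refine le_trans ?_ (hlow t)
    have hsub : {x | t < v k x} ⊆
        ⋃ i ∈ (Finset.univ.filter fun i : Fin (N + 1) => t < c (i + k)), S ∩ l ⁻¹' {i} := by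
      intro x hx
      have hxS : x ∈ S := by
        by_contra hxS
        simp [hv, indicator_of_notMem hxS] at hx
      simp only [hv, mem_ofPred_eq, indicator_of_mem hxS] at hx
      simp only [mem_iUnion]
      exact ⟨l x, Finset.mem_filter.2 ⟨Finset.mem_univ _, hx⟩, hxS, rfl⟩
    calc _ ≤ _ := measure_mono hsub
      _ ≤ _ := measure_biUnion_finset_le _ _
      _ = ((Finset.univ.filter fun i : Fin (N + 1) => t < c (i + k)).card : ℝ≥0∞) * a := by
        simp [hla]
      _ ≤ _ := by
        refine mul_le_mul' (Nat.cast_le.2 ?_) le_rfl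
        refine Finset.card_le_card_of_injOn (fun i => i + k) (fun i hi => ?_)
          (fun i _ j _ hij => add_right_cancel hij)
        simpa [hJ] using hi
  have hsum : (∑ i, c i) * ρ (S.indicator fun _ => 1) ≤ (N + 1 : ℕ) * ρ g := by
    have hcfin : ∀ i, c i ≠ ∞ := by
      intro i
      refine (lt_of_le_of_lt (decRearr_le_iff.2 ?_) (ENNReal.coe_lt_top (r := M))).ne
      have : {x | (M : ℝ≥0∞) < S.indicator g x} = ∅ := by
        ext x
        simpa using (indicator_le_self _ _ x).trans (hM x)
      simp [this]
    have hsfin : (∑ i, c i) ≠ ∞ := ENNReal.sum_ne_top.2 fun i _ => hcfin i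
    calc (∑ i, c i) * ρ (S.indicator fun _ => 1)
        = ρ (fun x => ((∑ i, c i).toNNReal : ℝ≥0∞) * S.indicator (fun _ => 1) x) := by
          rw [h.smul _ _ (aemeasurable_const.indicator hS), ENNReal.coe_toNNReal hsfin]
      _ = ρ (fun x => ∑ k, v k x) := by
          congr 1
          ext x
          rw [ENNReal.coe_toNNReal hsfin]
          by_cases hx : x ∈ S
          · simp only [hv, indicator_of_mem hx, mul_one]
            exact (Equiv.sum_comp (Equiv.addLeft (l x)) c).symm
          · simp [hv, indicator_of_notMem hx]
      _ ≤ ∑ k, ρ (v k) := h.sum_le _ fun k => (hvm k).aemeasurable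
      _ ≤ ∑ k : Fin (N + 1), ρ g := Finset.sum_le_sum fun k _ => hvρ k
      _ = _ := by simp
  -- The upper bound for D is integrated over levels: level t contributes a for each c i above it,
  -- plus one further a for t < M.
  have hint : ∫⁻ x in S, g x ∂μ ≤ a * (∑ i, c i) + a * M := by
    have h1 : ∫⁻ x in S, g x ∂μ = ∫⁻ x in S, ENNReal.ofReal (g x).toReal ∂μ := by
      refine lintegral_congr fun x => (ENNReal.ofReal_toReal ?_).symm
      exact ((hM x).trans_lt ENNReal.coe_lt_top).ne
    rw [h1, lintegral_eq_lintegral_meas_lt _ (Eventually.of_forall fun _ => ENNReal.toReal_nonneg)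
      hg.restrict.ennreal_toReal]
    have h2 : ∀ t ∈ Ioi (0 : ℝ), (μ.restrict S) {x | t < (g x).toReal} ≤
        (∑ i, a * (Ioi 0 ∩ {t : ℝ | ENNReal.ofReal t < c i}).indicator (fun _ => 1) t) +
          a * (Ioo (0 : ℝ) M).indicator (fun _ => 1) t := by
      intro t ht
      have hgt : ∀ x, t < (g x).toReal ↔ ENNReal.ofReal t < g x := fun x =>
        (ENNReal.ofReal_lt_iff_lt_toReal (le_of_lt ht)
          ((hM x).trans_lt ENNReal.coe_lt_top).ne).symm
      rcases lt_or_ge t M with htM | htM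
      · have h3 : (μ.restrict S) {x | t < (g x).toReal} ≤ D (ENNReal.ofReal t) := by
          rw [Measure.restrict_apply' hS]
          refine measure_mono fun x hx => ?_
          rw [mem_ofPred_eq, indicator_of_mem hx.2]
          exact (hgt x).1 hx.1
        refine h3.trans ((hupp _).trans (le_of_eq ?_))
        rw [add_mul, one_mul, indicator_of_mem (show t ∈ Ioo (0 : ℝ) M from ⟨ht, htM⟩), mul_one,
          ← Finset.mul_sum, mul_comm a]
        congr 2
        rw [hJ, Finset.card_filter, Nat.cast_sum]
        refine Finset.sum_congr rfl fun i _ => ?_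
        by_cases hti : ENNReal.ofReal t < c i
        · rw [indicator_of_mem (show t ∈ Ioi 0 ∩ {t : ℝ | ENNReal.ofReal t < c i} from ⟨ht, hti⟩)]
          simp [hti]
        · rw [indicator_of_notMem fun hmem => hti hmem.2]
          simp [hti]
      · have : {x | t < (g x).toReal} = ∅ := by
          ext x
          have : (g x).toReal ≤ M := ENNReal.toReal_le_coe_of_le_coe (hM x)
          simpa using this.trans htM
        simp [this]
    have hms : ∀ i, MeasurableSet (Ioi 0 ∩ {t : ℝ | ENNReal.ofReal t < c i}) := fun i =>
      measurableSet_Ioi.inter (measurableSet_lt ENNReal.measurable_ofReal measurable_const)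
    refine (setLIntegral_mono' measurableSet_Ioi h2).trans ?_
    refine (setLIntegral_le_lintegral _ _).trans ?_
    rw [lintegral_add_right _ ((measurable_const.indicator measurableSet_Ioo).const_mul _),
      lintegral_finsetSum _ fun i _ => (measurable_const.indicator (hms i)).const_mul _,
      Finset.mul_sum]
    gcongr with i
    · rw [lintegral_const_mul _ (measurable_const.indicator (hms i)), lintegral_indicator (hms i)]
      gcongr
      simp only [setLIntegral_one]
      rcases eq_or_ne (c i) ∞ with hi | hi
      · simp [hi]
      · calc volume (Ioi 0 ∩ {t : ℝ | ENNReal.ofReal t < c i})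
            ≤ volume (Ioo 0 (c i).toReal) := measure_mono fun t ht =>
              ⟨ht.1, (ENNReal.ofReal_lt_iff_lt_toReal (le_of_lt ht.1) hi).1 ht.2⟩
          _ = c i := by rw [Real.volume_Ioo, sub_zero, ENNReal.ofReal_toReal hi]
    · rw [lintegral_const_mul _ (measurable_const.indicator measurableSet_Ioo),
        lintegral_indicator measurableSet_Ioo]
      gcongr
      simp
  calc (∫⁻ x in S, g x ∂μ) * ρ (S.indicator fun _ => 1)
      ≤ (a * (∑ i, c i) + a * M) * ρ (S.indicator fun _ => 1) := by gcongr
    _ = a * ((∑ i, c i) * ρ (S.indicator fun _ => 1)) + a * M * ρ (S.indicator fun _ => 1) := by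
        ring
    _ ≤ a * ((N + 1 : ℕ) * ρ g) + a * M * ρ (S.indicator fun _ => 1) := by gcongr
    _ = _ := by rw [hm]; ring

/-- The average of `g` over `S` times the norm of `χ_S` is at most the norm of `g`. -/
lemma setLIntegral_mul_le (h : IsRINorm μ ρ) {S : Set Ω} (hS : MeasurableSet S)
    (hfin : μ S < ∞) {g : Ω → ℝ≥0∞} (hg : AEMeasurable g μ) :
    (∫⁻ x in S, g x ∂μ) * ρ (S.indicator fun _ => 1) ≤ μ S * ρ g := by
  -- For a fixed truncation M the error is removed by N → ∞; the truncation is removed afterwards by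
  -- monotone convergence.
  have hbdd : ∀ M : ℕ, (∫⁻ x in S, min (g x) M ∂μ) * ρ (S.indicator fun _ => 1) ≤ μ S * ρ g := by
    intro M
    have hm : AEMeasurable (fun x => min (g x) M) μ := hg.min aemeasurable_const
    have hlim : Tendsto (fun N : ℕ => μ S * ρ (fun x => min (g x) M) +
        μ S / (N + 1 : ℕ) * (M : ℝ≥0) * ρ (S.indicator fun _ => 1)) atTop
        (𝓝 (μ S * ρ (fun x => min (g x) M) + 0 * (M : ℝ≥0) * ρ (S.indicator fun _ => 1))) := by
      refine tendsto_const_nhds.add (ENNReal.Tendsto.mul_const (ENNReal.Tendsto.mul_const ?_ ?_) ?_)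
      · refine Tendsto.comp (g := fun n : ℕ => μ S / (n : ℝ≥0∞)) ?_ (tendsto_add_atTop_nat 1)
        simpa using ENNReal.Tendsto.const_div ENNReal.tendsto_nat_nhds_top (Or.inr hfin.ne)
      · exact Or.inr (by simp)
      · exact Or.inr (h.indicator_lt_top S hS hfin).ne
    have := ge_of_tendsto' hlim fun N => h.setLIntegral_mul_le_of_bounded hS hfin hm
      (M := (M : ℝ≥0)) (fun x => by simp) N
    refine this.trans ?_
    rw [zero_mul, zero_mul, add_zero]
    gcongr
    exact h.mono' hm hg fun x => min_le_left _ _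
  have hsup : ∀ x, g x = ⨆ M : ℕ, min (g x) M := by
    intro x
    refine le_antisymm (le_of_forall_lt fun t ht => ?_) (iSup_le fun _ => min_le_left _ _)
    obtain ⟨M, hM⟩ := ENNReal.exists_nat_gt ht.ne_top
    exact (lt_min ht hM).trans_le (le_iSup (fun M : ℕ => min (g x) (M : ℝ≥0∞)) M)
  rw [lintegral_congr hsup, lintegral_iSup' (fun M => (hg.min aemeasurable_const).restrict)
    (Eventually.of_forall fun x M M' hMM => min_le_min_left _ (by exact_mod_cast hMM)),
    ENNReal.iSup_mul]
  exact iSup_le hbdd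

/-- A form of the quasi-concavity of the fundamental function: averaging χ_G over F ∪ G compares the
norms of the two indicators with the ratio μ(F ∪ G)/μ(G) ≤ K + 1. -/
lemma indicator_le_of_measure_le (h : IsRINorm μ ρ) {F G : Set Ω} (hF : MeasurableSet F)
    (hG : MeasurableSet G) (hGfin : μ G < ∞) {K : ℝ≥0} (hFG : μ F ≤ K * μ G) :
    ρ (F.indicator fun _ => 1) ≤ (K + 1) * ρ (G.indicator fun _ => 1) := by
  rcases eq_or_ne (μ G) 0 with h0 | h0
  · have hF0 : μ F = 0 := by simpa [h0] using hFG
    rw [h.congr_ae (g := fun _ => 0) (aemeasurable_const.indicator hF), h.zero]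
    · exact zero_le
    · exact indicator_meas_zero hF0
  have hFfin : μ F < ∞ := hFG.trans_lt (ENNReal.mul_lt_top (by simp) hGfin)
  have h1 := h.setLIntegral_mul_le (hF.union hG) (measure_union_lt_top hFfin hGfin)
    (aemeasurable_const.indicator hG : AEMeasurable (G.indicator fun _ => (1 : ℝ≥0∞)) μ)
  have h2 : ∫⁻ x in F ∪ G, G.indicator (fun _ => 1) x ∂μ = μ G := by
    rw [setLIntegral_indicator hG, inter_eq_left.2 subset_union_right]
    simp
  rw [h2] at h1
  have h3 : μ (F ∪ G) ≤ μ G * (K + 1) := (measure_union_le _ _).trans (by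
    rw [mul_add, mul_one, mul_comm]
    gcongr)
  refine (ENNReal.mul_le_mul_iff_right h0 hGfin.ne).1 ?_
  calc μ G * ρ (F.indicator fun _ => 1)
      ≤ μ G * ρ ((F ∪ G).indicator fun _ => 1) := by
        gcongr
        exact h.mono' (aemeasurable_const.indicator hF)
          (aemeasurable_const.indicator (hF.union hG))
          fun x => indicator_le_indicator_of_subset subset_union_left (fun _ => zero_le) x
    _ ≤ _ := h1
    _ ≤ μ G * (K + 1) * ρ (G.indicator fun _ => 1) := by gcongr
    _ = _ := mul_assoc _ _ _

end IsRINorm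

end Averages

/-! ### Convexifications -/

section Convexification

lemma convexification_rpow {Ω : Type*} {ρ : (Ω → ℝ≥0∞) → ℝ≥0∞} {q : ℝ} (hq : 0 < q) (f : Ω → ℝ≥0∞) :
    convexification q ρ f ^ q = ρ fun x => f x ^ q := by
  unfold convexification
  rw [← ENNReal.rpow_mul, one_div_mul_cancel hq.ne', ENNReal.rpow_one]

variable {Ω : Type*} [MeasurableSpace Ω] {μ : Measure Ω} {ρ : (Ω → ℝ≥0∞) → ℝ≥0∞}

namespace IsRINorm

lemma convexification_mono (h : IsRINorm μ ρ) {q : ℝ} (hq : 0 < q) {f g : Ω → ℝ≥0∞}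
    (hf : AEMeasurable f μ) (hg : AEMeasurable g μ) (hfg : f ≤ᵐ[μ] g) :
    convexification q ρ f ≤ convexification q ρ g := by
  refine ENNReal.rpow_le_rpow (h.mono _ _ (hf.pow_const q) (hg.pow_const q) ?_) (by positivity)
  filter_upwards [hfg] with x hx
  exact ENNReal.rpow_le_rpow hx hq.le

lemma convexification_congr_ae (h : IsRINorm μ ρ) {q : ℝ} (hq : 0 < q) {f g : Ω → ℝ≥0∞}
    (hf : AEMeasurable f μ) (hfg : f =ᵐ[μ] g) :
    convexification q ρ f = convexification q ρ g :=
  le_antisymm (h.convexification_mono hq hf (hf.congr hfg) hfg.le)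
    (h.convexification_mono hq (hf.congr hfg) hf hfg.symm.le)

lemma convexification_eq_zero_iff (h : IsRINorm μ ρ) {q : ℝ} (hq : 0 < q) {f : Ω → ℝ≥0∞}
    (hf : AEMeasurable f μ) : convexification q ρ f = 0 ↔ f =ᵐ[μ] 0 := by
  unfold convexification
  rw [ENNReal.rpow_eq_zero_iff_of_pos (by positivity), h.eq_zero_iff _ (hf.pow_const q)]
  constructor
  all_goals
    intro h0
    filter_upwards [h0] with x hx
    simpa [hq, ENNReal.rpow_eq_zero_iff, hq.not_gt] using hx

lemma convexification_zero (h : IsRINorm μ ρ) {q : ℝ} (hq : 0 < q) :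
    convexification q ρ (fun _ => 0) = 0 :=
  (h.convexification_eq_zero_iff hq aemeasurable_const).2 (Eventually.of_forall fun _ => rfl)

lemma smul_of_ne_top (h : IsRINorm μ ρ) {c : ℝ≥0∞} (hc : c ≠ ∞) {f : Ω → ℝ≥0∞}
    (hf : AEMeasurable f μ) : ρ (fun x => c * f x) = c * ρ f := by
  lift c to ℝ≥0 using hc
  exact h.smul c f hf

lemma convexification_smul_le [SigmaFinite μ] (h : IsRINorm μ ρ) {q : ℝ} (hq : 0 < q) (c : ℝ≥0∞)
    {f : Ω → ℝ≥0∞} (hf : AEMeasurable f μ) :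
    convexification q ρ (fun x => c * f x) ≤ c * convexification q ρ f := by
  unfold convexification
  have : (fun x => (c * f x) ^ q) = fun x => c ^ q * f x ^ q := by
    ext x
    exact ENNReal.mul_rpow_of_nonneg _ _ hq.le
  rw [this]
  calc _ ≤ (c ^ q * ρ fun x => f x ^ q) ^ (1 / q) :=
        ENNReal.rpow_le_rpow (h.ennreal_smul_le _ (hf.pow_const q)) (by positivity)
    _ = _ := by
      rw [ENNReal.mul_rpow_of_nonneg _ _ (by positivity), ← ENNReal.rpow_mul,
        mul_one_div_cancel hq.ne', ENNReal.rpow_one]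

/-- Convexity of u ↦ u^q, applied to f/A and g/B with weights A/(A+B) and B/(A+B), where A and B are
the two norms. When A or B is 0 or ∞ the normalisation fails and the inequality is checked directly.
-/
lemma convexification_add_le (h : IsRINorm μ ρ) {q : ℝ} (hq : 1 ≤ q) {f g : Ω → ℝ≥0∞}
    (hf : AEMeasurable f μ) (hg : AEMeasurable g μ) :
    convexification q ρ (fun x => f x + g x) ≤
      convexification q ρ f + convexification q ρ g := by
  have hq0 : 0 < q := by linarith
  set A := convexification q ρ f with hA
  set B := convexification q ρ g with hB
  rcases eq_or_ne A 0 with hA0 | hA0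
  · have := (h.convexification_eq_zero_iff hq0 hf).1 hA0
    rw [hA0, zero_add]
    refine h.convexification_mono hq0 (hf.add hg) hg ?_
    filter_upwards [this] with x hx
    simp [hx]
  rcases eq_or_ne B 0 with hB0 | hB0
  · have := (h.convexification_eq_zero_iff hq0 hg).1 hB0
    rw [hB0, add_zero]
    refine h.convexification_mono hq0 (hf.add hg) hf ?_
    filter_upwards [this] with x hx
    simp [hx]
  rcases eq_or_ne A ∞ with hAt | hAt
  · simp [hAt]
  rcases eq_or_ne B ∞ with hBt | hBt
  · simp [hBt]
  set S := A + B with hS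
  have hS0 : S ≠ 0 := by simp [hS, hA0]
  have hSt : S ≠ ∞ := by simp [hS, hAt, hBt]
  have hw : S⁻¹ * A + S⁻¹ * B = 1 := by rw [← mul_add]; exact ENNReal.inv_mul_cancel hS0 hSt
  have hpt : ∀ x, (S⁻¹) ^ q * (f x + g x) ^ q ≤
      S⁻¹ * A * (A⁻¹ ^ q * f x ^ q) + S⁻¹ * B * (B⁻¹ ^ q * g x ^ q) := by
    intro x
    have := ENNReal.rpow_arith_mean_le_arith_mean2_rpow (S⁻¹ * A) (S⁻¹ * B) (A⁻¹ * f x)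
      (B⁻¹ * g x) hw hq
    rw [← ENNReal.mul_rpow_of_nonneg _ _ hq0.le, ← ENNReal.mul_rpow_of_nonneg _ _ hq0.le,
      ← ENNReal.mul_rpow_of_nonneg _ _ hq0.le]
    refine le_trans (le_of_eq ?_) this
    congr 1
    rw [mul_assoc, mul_assoc, ← mul_assoc A, ← mul_assoc B, ENNReal.mul_inv_cancel hA0 hAt,
      ENNReal.mul_inv_cancel hB0 hBt]
    ring
  have hfq := hf.pow_const q
  have hgq := hg.pow_const q
  have hne : ∀ {a : ℝ≥0∞}, a ≠ 0 → a⁻¹ ^ q ≠ ∞ := fun ha =>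
    ENNReal.rpow_ne_top_of_nonneg hq0.le (ENNReal.inv_ne_top.2 ha)
  have hone : ∀ {a : ℝ≥0∞}, a ≠ 0 → a ≠ ∞ → a⁻¹ ^ q * a ^ q = 1 := fun ha hat => by
    rw [← ENNReal.mul_rpow_of_nonneg _ _ hq0.le, ENNReal.inv_mul_cancel ha hat, ENNReal.one_rpow]
  have key : S⁻¹ ^ q * ρ (fun x => (f x + g x) ^ q) ≤ 1 := by
    have hfg : AEMeasurable (fun x => (f x + g x) ^ q) μ := (hf.add hg).pow_const q
    rw [← h.smul_of_ne_top (hne hS0) hfg]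
    refine (h.mono' (hfg.const_mul _)
      (((hfq.const_mul _).const_mul _).add ((hgq.const_mul _).const_mul _)) hpt).trans ?_
    refine (h.add_le _ _ ((hfq.const_mul _).const_mul _) ((hgq.const_mul _).const_mul _)).trans ?_
    rw [h.smul_of_ne_top (ENNReal.mul_ne_top (ENNReal.inv_ne_top.2 hS0) hAt) (hfq.const_mul _),
      h.smul_of_ne_top (ENNReal.mul_ne_top (ENNReal.inv_ne_top.2 hS0) hBt) (hgq.const_mul _),
      h.smul_of_ne_top (hne hA0) hfq, h.smul_of_ne_top (hne hB0) hgq,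
      ← convexification_rpow (ρ := ρ) hq0 f, ← convexification_rpow (ρ := ρ) hq0 g, hone hA0 hAt, hone hB0 hBt,
      mul_one, mul_one, hw]
  have key2 : ρ (fun x => (f x + g x) ^ q) ≤ S ^ q := by
    calc _ = S ^ q * (S⁻¹ ^ q * ρ (fun x => (f x + g x) ^ q)) := by
          rw [← mul_assoc, mul_comm (S ^ q), hone hS0 hSt, one_mul]
      _ ≤ S ^ q * 1 := by gcongr
      _ = _ := mul_one _
  calc convexification q ρ (fun x => f x + g x) ≤ (S ^ q) ^ (1 / q) :=
        ENNReal.rpow_le_rpow key2 (by positivity)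
    _ = S := by rw [← ENNReal.rpow_mul, mul_one_div_cancel hq0.ne', ENNReal.rpow_one]

lemma convexification_sum_le (h : IsRINorm μ ρ) {q : ℝ} (hq : 1 ≤ q) {ι : Type*} (s : Finset ι)
    {f : ι → Ω → ℝ≥0∞} (hf : ∀ i, AEMeasurable (f i) μ) :
    convexification q ρ (fun x => ∑ i ∈ s, f i x) ≤ ∑ i ∈ s, convexification q ρ (f i) := by
  classical
  induction s using Finset.induction_on with
  | empty => simp [h.convexification_zero (zero_lt_one.trans_le hq)]
  | insert i s hi ih =>
    simp only [Finset.sum_insert hi]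
    refine (h.convexification_add_le hq (hf i)
      (Finset.aemeasurable_fun_sum _ fun i _ => hf i)).trans ?_
    gcongr

lemma convexification_tsum_le (h : IsRINorm μ ρ) {q : ℝ} (hq : 1 ≤ q) {f : ℕ → Ω → ℝ≥0∞}
    (hf : ∀ i, AEMeasurable (f i) μ) :
    convexification q ρ (fun x => ∑' i, f i x) ≤ ∑' i, convexification q ρ (f i) := by
  have hq0 : 0 < q := by linarith
  simp only [ENNReal.tsum_eq_iSup_nat]
  have hmono : Monotone fun (n : ℕ) x => (∑ i ∈ Finset.range n, f i x) ^ q :=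
    fun m n hmn x => ENNReal.rpow_le_rpow
      (Finset.sum_le_sum_of_subset (Finset.range_mono hmn)) hq0.le
  have hrw : (fun x => (⨆ n : ℕ, ∑ i ∈ Finset.range n, f i x) ^ q) =
      fun x => ⨆ n : ℕ, (∑ i ∈ Finset.range n, f i x) ^ q := by
    ext x
    exact (ENNReal.orderIsoRpow q hq0).map_iSup _
  have hpos : 0 < 1 / q := by positivity
  calc convexification q ρ (fun x => ⨆ n : ℕ, ∑ i ∈ Finset.range n, f i x)
      = ⨆ n : ℕ, convexification q ρ (fun x => ∑ i ∈ Finset.range n, f i x) := by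
        unfold convexification
        rw [hrw, h.fatou _ (fun n => (Finset.aemeasurable_fun_sum _ fun i _ => hf i).pow_const q)
          hmono]
        exact (ENNReal.orderIsoRpow (1 / q) hpos).map_iSup _
    _ ≤ _ := iSup_mono fun n => h.convexification_sum_le hq _ hf

lemma convexification_ae_lt_top [SigmaFinite μ] (h : IsRINorm μ ρ) {q : ℝ} (hq : 0 < q)
    {f : Ω → ℝ≥0∞} (hf : AEMeasurable f μ) (hρ : convexification q ρ f < ∞) :
    ∀ᵐ x ∂μ, f x < ∞ := by
  have h1 : ρ (fun x => f x ^ q) < ∞ := by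
    rw [← convexification_rpow (ρ := ρ) hq]
    exact ENNReal.rpow_lt_top_of_nonneg hq.le hρ.ne
  filter_upwards [h.ae_lt_top (hf.pow_const q) h1] with x hx
  exact (ENNReal.rpow_lt_top_iff_of_pos hq).1 hx

/-- Interpolation between `L^∞` and the `p`-convexification. -/
lemma convexification_le_of_le_const [SigmaFinite μ] (h : IsRINorm μ ρ) {p σ : ℝ} (hp : 0 < p)
    (hσ : 1 < σ) {M : ℝ≥0∞} {f : Ω → ℝ≥0∞} (hf : AEMeasurable f μ) (hM : ∀ x, f x ≤ M) :
    convexification (σ * p) ρ f ≤ M ^ (1 - 1 / σ) * convexification p ρ f ^ (1 / σ) := by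
  have hσ0 : 0 < σ := by linarith
  have h1 : ∀ x, f x ^ (σ * p) ≤ M ^ (σ * p - p) * f x ^ p := by
    intro x
    have hsp : 0 ≤ σ * p - p := by nlinarith
    calc f x ^ (σ * p) = f x ^ (σ * p - p) * f x ^ p := by
          rw [← ENNReal.rpow_add_of_nonneg _ _ hsp hp.le, sub_add_cancel]
      _ ≤ _ := by gcongr; exact hM x
  calc convexification (σ * p) ρ f
      ≤ (M ^ (σ * p - p) * ρ fun x => f x ^ p) ^ (1 / (σ * p)) := by
        refine ENNReal.rpow_le_rpow ?_ (by positivity)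
        exact (h.mono' (hf.pow_const _) ((hf.pow_const _).const_mul _) h1).trans
          (h.ennreal_smul_le _ (hf.pow_const _))
    _ = _ := by
        rw [ENNReal.mul_rpow_of_nonneg _ _ (by positivity), ← ENNReal.rpow_mul]
        unfold convexification
        rw [← ENNReal.rpow_mul]
        congr 2
        · field_simp
        · field_simp

end IsRINorm

end Convexification

/-! ### Geometry of RD-spaces -/

section Geometry

/-- Vitali covering with a single radius: two meeting balls of radius r have centres at distance
less than 2r. -/
lemma exists_disjoint_balls {Ω : Type*} [MetricSpace Ω] (F : Set Ω) {r : ℝ} (hr : 0 < r) :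
    ∃ u ⊆ F, (u.PairwiseDisjoint fun x => Metric.ball x r) ∧
      ∀ x ∈ F, ∃ y ∈ u, x ∈ Metric.ball y (2 * r) := by
  obtain ⟨u, huF, hu, hcov⟩ := Vitali.exists_disjoint_subfamily_covering_enlargement
    (fun x : Ω => Metric.ball x r) F (fun _ => r) 2 one_lt_two (fun _ _ => hr.le) r
    (fun _ _ => le_rfl) (fun x _ => ⟨x, Metric.mem_ball_self hr⟩)
  refine ⟨u, huF, hu, fun x hx => ?_⟩
  obtain ⟨y, hy, ⟨z, hzx, hzy⟩, -⟩ := hcov x hx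
  refine ⟨y, hy, ?_⟩
  rw [Metric.mem_ball] at *
  have := dist_triangle_left x y z
  linarith

variable {Ω : Type*} [MetricSpace Ω] [MeasurableSpace Ω] {μ : Measure Ω} {k n : ℝ}

namespace IsRDSpace

lemma nullSingletonClass (h : IsRDSpace μ k n) : NullSingletonClass μ := ⟨h.atom_free⟩

lemma exists_doubling (h : IsRDSpace μ k n) : ∃ K : ℝ≥0, 1 ≤ K ∧ ∀ (x : Ω) (r : ℝ), 0 < r →
    μ (Metric.ball x (2 * r)) ≤ K * μ (Metric.ball x r) := by
  obtain ⟨C₁, C₂, hC₁, -, hC₂, hg⟩ := h.growth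
  refine ⟨(C₂ * 2 ^ n).toNNReal, ?_, fun x r hr => (hg x r hr 2 one_le_two).2⟩
  rw [← NNReal.coe_le_coe, Real.coe_toNNReal _ (by positivity), NNReal.coe_one]
  have := Real.one_le_rpow one_le_two (h.k_pos.le.trans h.k_le_n)
  nlinarith

/-- The upper growth bound with dilation factor 1/r compares B(x,r) with B(x,1), whose measure is
bounded below uniformly in x. -/
lemma exists_ball_lower (h : IsRDSpace μ k n) (hnc : NonCollapsing μ) [Nonempty Ω] :
    ∃ c : ℝ, 0 < c ∧ ∀ (x : Ω) (r : ℝ), 0 < r → r ≤ 1 →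
      ENNReal.ofReal (c * r ^ n) ≤ μ (Metric.ball x r) := by
  obtain ⟨C₁, C₂, hC₁, -, hC₂, hg⟩ := h.growth
  set m := ⨅ x : Ω, μ (Metric.ball x 1)
  have hm0 : 0 < m := hnc
  have hmt : m < ∞ := (iInf_le _ (Classical.arbitrary Ω)).trans_lt (h.ball_lt_top _ 1 one_pos)
  have hm : 0 < m.toReal := ENNReal.toReal_pos hm0.ne' hmt.ne
  refine ⟨m.toReal / C₂, by positivity, fun x r hr hr1 => ?_⟩
  have h1 := (hg x r hr (1 / r) ((one_le_div hr).2 hr1)).2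
  rw [one_div_mul_cancel hr.ne'] at h1
  have h2 : m ≤ μ (Metric.ball x 1) := iInf_le _ x
  have hpos : 0 < C₂ * (1 / r) ^ n := by positivity
  have hfin := (h.ball_lt_top x r hr).ne
  have h3 : m.toReal ≤ C₂ * (1 / r) ^ n * (μ (Metric.ball x r)).toReal := by
    have := ENNReal.toReal_mono (ENNReal.mul_ne_top ENNReal.ofReal_ne_top hfin) (h2.trans h1)
    rwa [ENNReal.toReal_mul, ENNReal.toReal_ofReal hpos.le] at this
  rw [ENNReal.ofReal_le_iff_le_toReal hfin, div_mul_eq_mul_div, div_le_iff₀ (by linarith)]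
  rw [one_div, Real.inv_rpow hr.le] at h3
  have hrn : 0 < r ^ n := by positivity
  calc m.toReal * r ^ n ≤ C₂ * (r ^ n)⁻¹ * (μ (Metric.ball x r)).toReal * r ^ n := by gcongr
    _ = _ := by field_simp

/-- The lower growth exponent k is positive, so the space has infinite measure; this is what forces
γ ≥ 0 in `gamma_nonneg`. -/
lemma tendsto_measure_ball (h : IsRDSpace μ k n) (x : Ω) :
    Tendsto (fun r : ℝ => (μ (Metric.ball x r)).toReal) atTop atTop := by
  obtain ⟨C₁, C₂, hC₁, -, hC₂, hg⟩ := h.growth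
  have h1 := (ENNReal.toReal_pos (h.ball_pos x 1 one_pos).ne' (h.ball_lt_top x 1 one_pos).ne)
  refine tendsto_atTop_mono' _ ?_ (((tendsto_rpow_atTop h.k_pos).const_mul_atTop hC₁).atTop_mul_const
    h1)
  filter_upwards [eventually_ge_atTop 1] with r hr
  have h2 := (hg x 1 one_pos r hr).1
  rw [mul_one] at h2
  have h3 := ENNReal.toReal_mono (h.ball_lt_top x r (by linarith)).ne h2
  rwa [ENNReal.toReal_mul, ENNReal.toReal_ofReal (by positivity)] at h3

lemma sigmaFinite (h : IsRDSpace μ k n) : SigmaFinite μ := by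
  rcases isEmpty_or_nonempty Ω with hΩ | ⟨⟨x⟩⟩
  · have : μ = 0 := Measure.eq_zero_of_isEmpty μ
    rw [this]
    infer_instance
  · refine ⟨⟨⟨fun i => Metric.ball x (i + 1), fun _ => trivial,
      fun i => h.ball_lt_top x _ (by positivity), ?_⟩⟩⟩
    exact eq_univ_of_forall fun y => mem_iUnion.2
      ((exists_nat_gt (dist y x)).imp fun i hi => Metric.mem_ball.2 (by linarith))

variable [BorelSpace Ω]

lemma countable_of_pairwiseDisjoint (h : IsRDSpace μ k n) {u : Set Ω} {r : ℝ} (hr : 0 < r)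
    (hu : u.PairwiseDisjoint fun x => Metric.ball x r) : u.Countable := by
  have := h.sigmaFinite
  have h1 := Measure.countable_meas_pos_of_disjoint_iUnion (μ := μ)
    (As := fun x : u => Metric.ball (x : Ω) r) (fun _ => Metric.isOpen_ball.measurableSet)
    (fun x y hxy => hu x.2 y.2 fun h => hxy (Subtype.ext h))
  have h2 : {i : u | 0 < μ (Metric.ball (i : Ω) r)} = univ :=
    eq_univ_of_forall fun x => h.ball_pos x r hr
  rw [h2, countable_univ_iff] at h1
  exact h1

/-- By σ-finiteness a disjoint family of balls of positive measure is countable. The centres of a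
disjoint family whose doubled balls cover the space are then a countable ε-dense set. -/
lemma secondCountableTopology (h : IsRDSpace μ k n) : SecondCountableTopology Ω := by
  refine Metric.secondCountable_of_almost_dense_set fun ε hε => ?_
  obtain ⟨u, -, hu, hcov⟩ := exists_disjoint_balls (univ : Set Ω) (half_pos hε)
  refine ⟨u, h.countable_of_pairwiseDisjoint (half_pos hε) hu, fun x => ?_⟩
  obtain ⟨y, hy, hxy⟩ := hcov x (mem_univ x)
  rw [Metric.mem_ball] at hxy
  exact ⟨y, hy, by linarith⟩

end IsRDSpace

end Geometry

/-! ### Measurability of averages over balls -/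

section Measurability

variable {Ω : Type*} [MetricSpace Ω] [MeasurableSpace Ω] [BorelSpace Ω]
  [SecondCountableTopology Ω] {μ : Measure Ω} [SigmaFinite μ]

lemma measurable_setLIntegral_ball (t : ℝ) {F : Ω → Ω → ℝ≥0∞}
    (hF : Measurable (Function.uncurry F)) :
    Measurable fun x => ∫⁻ y in Metric.ball x t, F x y ∂μ := by
  have hset : MeasurableSet {q : Ω × Ω | dist q.2 q.1 < t} :=
    (isOpen_lt (continuous_snd.dist continuous_fst) continuous_const).measurableSet
  have h1 := (hF.indicator hset).lintegral_prod_right' (ν := μ)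
  convert h1 using 2 with x
  rw [← lintegral_indicator Metric.isOpen_ball.measurableSet]
  rfl

lemma measurable_laverage_ball (t : ℝ) {F : Ω → Ω → ℝ≥0∞}
    (hF : Measurable (Function.uncurry F)) :
    Measurable fun x => ⨍⁻ y in Metric.ball x t, F x y ∂μ := by
  simp only [setLAverage_eq]
  refine (measurable_setLIntegral_ball t hF).div ?_
  simpa using measurable_setLIntegral_ball (μ := μ) t (F := fun _ _ => 1) measurable_const

lemma measurable_laverage_enorm_sub (t : ℝ) {f : Ω → ℝ} (hf : Measurable f) :
    Measurable fun x => ⨍⁻ y in Metric.ball x t, ‖f x - f y‖ₑ ∂μ :=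
  measurable_laverage_ball t
    (F := fun x y => ‖f x - f y‖ₑ) ((hf.comp measurable_fst).sub (hf.comp measurable_snd)).enorm

end Measurability

/-! ### The fundamental function -/

section FundamentalFunction

variable {Ω : Type*} [MeasurableSpace Ω] {μ : Measure Ω} {ρ : (Ω → ℝ≥0∞) → ℝ≥0∞}

lemma IsRINorm.ofReal_fundamentalFunction (h : IsRINorm μ ρ) {F : Set Ω} (hF : MeasurableSet F)
    (hfin : μ F < ∞) :
    ENNReal.ofReal (fundamentalFunction μ ρ (μ F).toReal) = ρ (F.indicator fun _ => 1) := by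
  have hdist : ∀ {G : Set Ω} (t : ℝ≥0∞), μ {x | t < G.indicator (fun _ => (1 : ℝ≥0∞)) x} =
      if t < 1 then μ G else 0 := by
    intro G t
    split_ifs with ht
    · congr 1
      ext x
      by_cases hx : x ∈ G <;> simp [hx, ht]
    · convert measure_empty (μ := μ)
      ext x
      by_cases hx : x ∈ G
      · simpa [hx] using ht
      · simp [hx]
  have : (⨆ (G : Set Ω) (_ : MeasurableSet G ∧ μ G = ENNReal.ofReal (μ F).toReal),
      ρ (G.indicator fun _ => 1)) = ρ (F.indicator fun _ => 1) := by
    rw [ENNReal.ofReal_toReal hfin.ne]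
    refine le_antisymm (iSup₂_le fun G hG => ?_) (le_iSup₂_of_le F ⟨hF, rfl⟩ le_rfl)
    refine h.le_of_distribution_le (aemeasurable_const.indicator hG.1)
      (aemeasurable_const.indicator hF) fun t => ?_
    rw [hdist, hdist, hG.2]
  rw [fundamentalFunction, this, ENNReal.ofReal_toReal (h.indicator_lt_top F hF hfin).ne]

lemma fundamentalFunction_nonneg (t : ℝ) : 0 ≤ fundamentalFunction μ ρ t := ENNReal.toReal_nonneg

lemma IsRINorm.fundamentalFunction_pos (h : IsRINorm μ ρ) {F : Set Ω} (hF : MeasurableSet F)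
    (hpos : 0 < μ F) (hfin : μ F < ∞) : 0 < fundamentalFunction μ ρ (μ F).toReal := by
  rw [← ENNReal.ofReal_pos, h.ofReal_fundamentalFunction hF hfin, pos_iff_ne_zero]
  intro h0
  have h1 := (h.eq_zero_iff _ (aemeasurable_const.indicator hF)).1 h0
  refine hpos.ne' (measure_mono_null (fun x hx => ?_) h1)
  simp [hx]

lemma IsRINorm.fundamentalFunction_mono (h : IsRINorm μ ρ) {F G : Set Ω} (hF : MeasurableSet F)
    (hG : MeasurableSet G) (hFG : F ⊆ G) (hfin : μ G < ∞) :
    fundamentalFunction μ ρ (μ F).toReal ≤ fundamentalFunction μ ρ (μ G).toReal := by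
  rw [← ENNReal.ofReal_le_ofReal_iff (fundamentalFunction_nonneg _),
    h.ofReal_fundamentalFunction hF ((measure_mono hFG).trans_lt hfin),
    h.ofReal_fundamentalFunction hG hfin]
  exact h.mono' (aemeasurable_const.indicator hF) (aemeasurable_const.indicator hG)
    fun x => indicator_le_indicator_of_subset hFG (fun _ => zero_le) x

lemma AlmostDecreasing.exists_le {f : ℝ → ℝ} (h : AlmostDecreasing f) :
    ∃ C : ℝ, 0 < C ∧ ∀ s t : ℝ, 0 < s → s ≤ t → f t ≤ C * f s := by
  obtain ⟨g, hg, c, C, hc, hC, hf⟩ := h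
  refine ⟨C / c, by positivity, fun s t hs hst => ?_⟩
  calc f t ≤ C * g t := (hf t (hs.trans_le hst)).2
    _ ≤ C * g s := by gcongr; exact hg hs (hs.trans_le hst) hst
    _ = C / c * (c * g s) := by field_simp
    _ ≤ C / c * f s := by gcongr; exact (hf s hs).1

lemma AlmostIncreasing.exists_le {f : ℝ → ℝ} (h : AlmostIncreasing f) :
    ∃ C : ℝ, 0 < C ∧ ∀ s t : ℝ, 0 < s → s ≤ t → f s ≤ C * f t := by
  obtain ⟨g, hg, c, C, hc, hC, hf⟩ := h
  refine ⟨C / c, by positivity, fun s t hs hst => ?_⟩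
  calc f s ≤ C * g s := (hf s hs).2
    _ ≤ C * g t := by gcongr; exact hg hs (hs.trans_le hst) hst
    _ = C / c * (c * g t) := by field_simp
    _ ≤ C / c * f t := by gcongr; exact (hf t (hs.trans_le hst)).1

end FundamentalFunction

/-! ### Lower bounds for the norms of indicators of balls. -/

section BallNorms

variable {Ω : Type*} [MetricSpace Ω] [MeasurableSpace Ω] [BorelSpace Ω] {μ : Measure Ω}
  {k n γ : ℝ} {ρ : (Ω → ℝ≥0∞) → ℝ≥0∞}

/-- The fundamental function is monotone along concentric balls, whose measures tend to infinity.
For γ < 0 the quotient φ(t)/t^γ would be unbounded along them, against its quasi-decrease. -/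
lemma IsRDSpace.gamma_nonneg [Nonempty Ω] (hΩ : IsRDSpace μ k n) (h : IsRINorm μ ρ)
    (hφ : AlmostDecreasing fun t => fundamentalFunction μ ρ t / t ^ γ) : 0 ≤ γ := by
  by_contra! hγ
  obtain ⟨C, hC, hle⟩ := hφ.exists_le
  set x : Ω := Classical.arbitrary Ω
  set m : ℝ → ℝ := fun r => (μ (Metric.ball x r)).toReal with hm
  have hmeas : ∀ r, MeasurableSet (Metric.ball x r) := fun r => Metric.isOpen_ball.measurableSet
  have hm1 : 0 < m 1 :=
    ENNReal.toReal_pos (hΩ.ball_pos x 1 one_pos).ne' (hΩ.ball_lt_top x 1 one_pos).ne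
  have hφ1 : 0 < fundamentalFunction μ ρ (m 1) :=
    h.fundamentalFunction_pos (hmeas 1) (hΩ.ball_pos x 1 one_pos) (hΩ.ball_lt_top x 1 one_pos)
  have hlim : Tendsto (fun r => fundamentalFunction μ ρ (m 1) * m r ^ (-γ)) atTop atTop :=
    ((tendsto_rpow_atTop (neg_pos.2 hγ)).comp (hΩ.tendsto_measure_ball x)).const_mul_atTop hφ1
  obtain ⟨r, hr, hr1⟩ := ((hlim.eventually_gt_atTop
    (C * (fundamentalFunction μ ρ (m 1) / m 1 ^ γ))).and (eventually_ge_atTop 1)).exists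
  have hsub : Metric.ball x 1 ⊆ Metric.ball x r := Metric.ball_subset_ball hr1
  have hfin := hΩ.ball_lt_top x r (by linarith)
  have hmr : m 1 ≤ m r := ENNReal.toReal_mono hfin.ne (measure_mono hsub)
  refine hr.not_ge ?_
  calc fundamentalFunction μ ρ (m 1) * m r ^ (-γ)
      ≤ fundamentalFunction μ ρ (m r) * m r ^ (-γ) := by
        gcongr
        exact h.fundamentalFunction_mono (hmeas 1) (hmeas r) hsub hfin
    _ = fundamentalFunction μ ρ (m r) / m r ^ γ := by
        rw [Real.rpow_neg (hm1.le.trans hmr), div_eq_mul_inv]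
    _ ≤ _ := hle _ _ hm1 hmr

/-- In a non-collapsing space, the norm of the characteristic function of a ball of radius `r ≤ 1`
is at least of the order `r ^ (n γ)`. -/
lemma IsRDSpace.exists_norm_ball_lower [Nonempty Ω] [SecondCountableTopology Ω]
    [NullSingletonClass μ] (hΩ : IsRDSpace μ k n) (hnc : NonCollapsing μ) (h : IsRINorm μ ρ)
    (hφ : AlmostDecreasing fun t => fundamentalFunction μ ρ t / t ^ γ) :
    ∃ c : ℝ, 0 < c ∧ ∀ (x : Ω) (r : ℝ), 0 < r → r ≤ 1 →
      ENNReal.ofReal (c * r ^ (n * γ)) ≤ ρ ((Metric.ball x r).indicator fun _ => 1) := by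
  have hγ := hΩ.gamma_nonneg h hφ
  have hn : 0 ≤ n := hΩ.k_pos.le.trans hΩ.k_le_n
  obtain ⟨C, hC, hle⟩ := hφ.exists_le
  obtain ⟨c₁, hc₁, hball⟩ := hΩ.exists_ball_lower hnc
  set x₀ : Ω := Classical.arbitrary Ω
  have hmeas : ∀ (x : Ω) r, MeasurableSet (Metric.ball x r) :=
    fun x r => Metric.isOpen_ball.measurableSet
  set m₀ := (μ (Metric.ball x₀ 1)).toReal with hm₀
  have hfin₀ := hΩ.ball_lt_top x₀ 1 one_pos
  have hm0 : 0 < m₀ := ENNReal.toReal_pos (hΩ.ball_pos x₀ 1 one_pos).ne' hfin₀.ne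
  set φ₀ := fundamentalFunction μ ρ m₀ with hφ₀
  have hφ0 : 0 < φ₀ := h.fundamentalFunction_pos (hmeas x₀ 1) (hΩ.ball_pos x₀ 1 one_pos) hfin₀
  set q := C⁻¹ * (φ₀ / m₀ ^ γ)
  have hq : 0 < q := by positivity
  refine ⟨min (q * c₁ ^ γ) (φ₀ / 2), lt_min (by positivity) (by positivity),
    fun x r hr hr1 => ?_⟩
  have hfin := hΩ.ball_lt_top x r hr
  set m := (μ (Metric.ball x r)).toReal with hm
  have hmpos : 0 < m := ENNReal.toReal_pos (hΩ.ball_pos x r hr).ne' hfin.ne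
  have hmlow : c₁ * r ^ n ≤ m := (ENNReal.ofReal_le_iff_le_toReal hfin.ne).1 (hball x r hr hr1)
  -- Quasi-decrease compares m with the fixed reference m₀ only when m ≤ m₀. A ball of larger
  -- measure is compared directly with the reference ball, at the cost of the factor 1 + 1 = 2.
  rcases le_or_gt m m₀ with hmm | hmm
  · rw [← h.ofReal_fundamentalFunction (hmeas x r) hfin]
    refine ENNReal.ofReal_le_ofReal ?_
    have h1 : q * m ^ γ ≤ fundamentalFunction μ ρ m := by
      have := hle m m₀ hmpos hmm
      rw [← le_div_iff₀ (by positivity)]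
      exact (inv_mul_le_iff₀ hC).2 this
    calc min (q * c₁ ^ γ) (φ₀ / 2) * r ^ (n * γ) ≤ q * c₁ ^ γ * r ^ (n * γ) := by
          gcongr
          exact min_le_left _ _
      _ = q * (c₁ * r ^ n) ^ γ := by
          rw [Real.mul_rpow hc₁.le (by positivity), ← Real.rpow_mul hr.le, mul_assoc]
      _ ≤ q * m ^ γ := by gcongr
      _ ≤ _ := h1
  · have h1 : μ (Metric.ball x₀ 1) ≤ (1 : ℝ≥0) * μ (Metric.ball x r) := by
      rw [ENNReal.coe_one, one_mul]
      exact ((ENNReal.toReal_lt_toReal hfin₀.ne hfin.ne).1 hmm).le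
    have h2 := h.indicator_le_of_measure_le (hmeas x₀ 1) (hmeas x r) hfin h1
    rw [← h.ofReal_fundamentalFunction (hmeas x₀ 1) hfin₀] at h2
    have h3 : ENNReal.ofReal (φ₀ / 2) ≤ ρ ((Metric.ball x r).indicator fun _ => 1) := by
      rw [ENNReal.ofReal_div_of_pos two_pos]
      refine ENNReal.div_le_of_le_mul (h2.trans (le_of_eq ?_))
      rw [mul_comm]
      norm_num
    refine le_trans (ENNReal.ofReal_le_ofReal ?_) h3
    calc min (q * c₁ ^ γ) (φ₀ / 2) * r ^ (n * γ) ≤ φ₀ / 2 * 1 := by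
          gcongr
          · exact min_le_right _ _
          · exact Real.rpow_le_one hr.le hr1 (by positivity)
      _ = _ := mul_one _

end BallNorms

/-! ### Averages -/

section LAverage

variable {Ω : Type*} [MeasurableSpace Ω] {μ : Measure Ω}

lemma setLAverage_le_mul_of_subset {S T : Set Ω} {K : ℝ≥0} (hST : S ⊆ T) (hS : 0 < μ S)
    (hT : μ T < ∞) (hK : μ T ≤ K * μ S) (F : Ω → ℝ≥0∞) :
    ⨍⁻ y in S, F y ∂μ ≤ K * ⨍⁻ y in T, F y ∂μ := by
  rw [setLAverage_eq, setLAverage_eq]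
  have hSt : μ S ≠ ∞ := ((measure_mono hST).trans_lt hT).ne
  have hT0 : μ T ≠ 0 := (hS.trans_le (measure_mono hST)).ne'
  refine ENNReal.div_le_of_le_mul ?_
  calc ∫⁻ y in S, F y ∂μ ≤ ∫⁻ y in T, F y ∂μ := lintegral_mono_set hST
    _ = (∫⁻ y in T, F y ∂μ) / μ T * μ T := (ENNReal.div_mul_cancel hT0 hT.ne).symm
    _ ≤ (∫⁻ y in T, F y ∂μ) / μ T * (K * μ S) := by gcongr
    _ = _ := by ring

/-- Jensen's inequality, read off from the monotonicity in the exponent of L^p norms for a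
probability measure. -/
lemma laverage_rpow_le {S : Set Ω} (hS : 0 < μ S) (hfin : μ S < ∞) {p : ℝ} (hp : 1 ≤ p)
    {g : Ω → ℝ≥0∞} (hg : AEMeasurable g μ) :
    (⨍⁻ y in S, g y ∂μ) ^ p ≤ ⨍⁻ y in S, g y ^ p ∂μ := by
  have hp0 : 0 < p := by linarith
  have : IsProbabilityMeasure ((μ.restrict S univ)⁻¹ • μ.restrict S) := by
    refine ⟨?_⟩
    rw [Measure.smul_apply, smul_eq_mul, Measure.restrict_apply_univ]
    exact ENNReal.inv_mul_cancel hS.ne' hfin.ne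
  have h1 := eLpNorm'_le_eLpNorm'_of_exponent_le (f := g) one_pos hp
    ((μ.restrict S univ)⁻¹ • μ.restrict S) (hg.restrict.smul_measure _).aestronglyMeasurable
  simp only [eLpNorm', enorm_eq_self, ENNReal.rpow_one, div_one] at h1
  calc (⨍⁻ y in S, g y ∂μ) ^ p ≤ ((⨍⁻ y in S, g y ^ p ∂μ) ^ (1 / p)) ^ p :=
        ENNReal.rpow_le_rpow h1 hp0.le
    _ = _ := by rw [← ENNReal.rpow_mul, one_div_mul_cancel hp0.ne', ENNReal.rpow_one]

lemma setLAverage_const_add_le {S : Set Ω} (hS : 0 < μ S) (hfin : μ S < ∞) (c : ℝ≥0∞)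
    {F G : Ω → ℝ≥0∞} (h : ∀ y ∈ S, F y ≤ c + G y) (hmS : MeasurableSet S) :
    ⨍⁻ y in S, F y ∂μ ≤ c + ⨍⁻ y in S, G y ∂μ := by
  rw [setLAverage_eq, setLAverage_eq]
  calc (∫⁻ y in S, F y ∂μ) / μ S ≤ (∫⁻ y in S, (c + G y) ∂μ) / μ S := by
        gcongr 1
        exact setLIntegral_mono' hmS h
    _ = (c * μ S + ∫⁻ y in S, G y ∂μ) / μ S := by
        rw [lintegral_add_left measurable_const, setLIntegral_const]
    _ = _ := by rw [ENNReal.add_div, ENNReal.mul_div_cancel_right hS.ne' hfin.ne]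

lemma IsRINorm.laverage_mul_le [MeasurableSpace.CountablySeparated Ω] [NullSingletonClass μ]
    {ρ : (Ω → ℝ≥0∞) → ℝ≥0∞} (h : IsRINorm μ ρ) {S : Set Ω} (hS : MeasurableSet S)
    (hfin : μ S < ∞) {g : Ω → ℝ≥0∞} (hg : AEMeasurable g μ) :
    (⨍⁻ y in S, g y ∂μ) * ρ (S.indicator fun _ => 1) ≤ ρ g := by
  rw [setLAverage_eq, div_eq_mul_inv, mul_right_comm, ← div_eq_mul_inv]
  refine ENNReal.div_le_of_le_mul ?_
  rw [mul_comm (ρ g)]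
  exact h.setLIntegral_mul_le hS hfin hg

lemma IsRINorm.laverage_mul_le_convexification [MeasurableSpace.CountablySeparated Ω]
    [NullSingletonClass μ] {ρ : (Ω → ℝ≥0∞) → ℝ≥0∞} (h : IsRINorm μ ρ) {p : ℝ} (hp : 1 ≤ p)
    {S : Set Ω} (hS : MeasurableSet S) (hpos : 0 < μ S)
    (hfin : μ S < ∞) {g : Ω → ℝ≥0∞} (hg : AEMeasurable g μ) :
    (⨍⁻ y in S, g y ∂μ) * ρ (S.indicator fun _ => 1) ^ (1 / p) ≤ convexification p ρ g := by
  have hp0 : 0 < p := by linarith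
  calc (⨍⁻ y in S, g y ∂μ) * ρ (S.indicator fun _ => 1) ^ (1 / p)
      = ((⨍⁻ y in S, g y ∂μ) ^ p * ρ (S.indicator fun _ => 1)) ^ (1 / p) := by
        rw [ENNReal.mul_rpow_of_nonneg _ _ (by positivity), ← ENNReal.rpow_mul,
          mul_one_div_cancel hp0.ne', ENNReal.rpow_one]
    _ ≤ ((⨍⁻ y in S, g y ^ p ∂μ) * ρ (S.indicator fun _ => 1)) ^ (1 / p) := by
        gcongr
        exact laverage_rpow_le hpos hfin hp hg
    _ ≤ _ := by
        refine ENNReal.rpow_le_rpow ?_ (by positivity)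
        exact h.laverage_mul_le hS hfin (hg.pow_const p)

end LAverage

/-! ### Mean oscillations -/

/-- The mean of `|f x - f|` over the ball of radius `t` around `x`. -/
noncomputable def osc {Ω : Type*} [MetricSpace Ω] [MeasurableSpace Ω] (μ : Measure Ω) (f : Ω → ℝ) (t : ℝ)
    (x : Ω) : ℝ≥0∞ := ⨍⁻ y in Metric.ball x t, ‖f x - f y‖ₑ ∂μ

section Oscillation

variable {Ω : Type*} [MetricSpace Ω] [MeasurableSpace Ω] {μ : Measure Ω} {k n : ℝ} {K : ℝ≥0}

lemma osc_le_mul_osc (hΩ : IsRDSpace μ k n)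
    (hK : ∀ (x : Ω) (r : ℝ), 0 < r → μ (Metric.ball x (2 * r)) ≤ K * μ (Metric.ball x r))
    (f : Ω → ℝ) {s t : ℝ} (hs : 0 < s) (hst : s ≤ t) (hts : t ≤ 2 * s) (x : Ω) :
    osc μ f s x ≤ K * osc μ f t x :=
  setLAverage_le_mul_of_subset (Metric.ball_subset_ball hst) (hΩ.ball_pos x s hs)
    (hΩ.ball_lt_top x t (by linarith))
    ((measure_mono (Metric.ball_subset_ball hts)).trans (hK x s hs)) _

variable [BorelSpace Ω] [SecondCountableTopology Ω] [SigmaFinite μ]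

lemma measurable_osc {f : Ω → ℝ} (hf : Measurable f) (t : ℝ) : Measurable (osc μ f t) :=
  measurable_laverage_enorm_sub t hf

/-- For z in B(x,t/2), the value f(z) is inserted between f(x) and f(y), and B(x,t) ⊆ B(z,2t) ⊆
B(x,4t) costs two doublings. Averaging over z gives the claim. -/
lemma osc_le_osc_half_add (hΩ : IsRDSpace μ k n)
    (hK : ∀ (x : Ω) (r : ℝ), 0 < r → μ (Metric.ball x (2 * r)) ≤ K * μ (Metric.ball x r))
    {f : Ω → ℝ} (hf : Measurable f) {t : ℝ} (ht : 0 < t) (x : Ω) :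
    osc μ f t x ≤ osc μ f (t / 2) x + K ^ 2 * ⨍⁻ z in Metric.ball x (t / 2), osc μ f (2 * t) z ∂μ := by
  have ht2 : 0 < t / 2 := by linarith
  have hb : MeasurableSet (Metric.ball x (t / 2)) := Metric.isOpen_ball.measurableSet
  have hpt : ∀ z ∈ Metric.ball x (t / 2),
      osc μ f t x ≤ ‖f x - f z‖ₑ + K ^ 2 * osc μ f (2 * t) z := by
    intro z hz
    rw [Metric.mem_ball] at hz
    have h1 : osc μ f t x ≤ ‖f x - f z‖ₑ + ⨍⁻ y in Metric.ball x t, ‖f z - f y‖ₑ ∂μ := by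
      refine setLAverage_const_add_le (hΩ.ball_pos x t ht) (hΩ.ball_lt_top x t ht) _ (fun y _ => ?_)
        Metric.isOpen_ball.measurableSet
      calc ‖f x - f y‖ₑ = ‖(f x - f z) + (f z - f y)‖ₑ := by congr 1; ring
        _ ≤ _ := enorm_add_le _ _
    refine h1.trans (add_le_add le_rfl ?_)
    have h2 : μ (Metric.ball z (2 * t)) ≤ (K ^ 2 : ℝ≥0) * μ (Metric.ball x t) := by
      calc μ (Metric.ball z (2 * t)) ≤ μ (Metric.ball x (2 * (2 * t))) :=
            measure_mono (Metric.ball_subset_ball' (by linarith))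
        _ ≤ K * (K * μ (Metric.ball x t)) :=
            (hK x (2 * t) (by linarith)).trans (mul_le_mul' le_rfl (hK x t ht))
        _ = _ := by push_cast; ring
    have h3 := setLAverage_le_mul_of_subset (F := fun y => ‖f z - f y‖ₑ)
      (Metric.ball_subset_ball' (by linarith [dist_comm x z]) :
        Metric.ball x t ⊆ Metric.ball z (2 * t))
      (hΩ.ball_pos x t ht) (hΩ.ball_lt_top z (2 * t) (by linarith)) h2
    rwa [ENNReal.coe_pow] at h3
  have hpos := hΩ.ball_pos x _ ht2
  have hfin := hΩ.ball_lt_top x _ ht2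
  have hm : Measurable fun z => ‖f x - f z‖ₑ := (measurable_const.sub hf).enorm
  calc osc μ f t x = ⨍⁻ _ in Metric.ball x (t / 2), osc μ f t x ∂μ := by
        rw [setLAverage_eq, setLIntegral_const, ENNReal.mul_div_cancel_right hpos.ne' hfin.ne]
    _ ≤ ⨍⁻ z in Metric.ball x (t / 2), (‖f x - f z‖ₑ + K ^ 2 * osc μ f (2 * t) z) ∂μ := by
        rw [setLAverage_eq, setLAverage_eq]
        gcongr 1
        exact setLIntegral_mono' hb hpt
    _ = _ := by
        rw [setLAverage_eq, lintegral_add_left hm, lintegral_const_mul _ (measurable_osc hf _),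
          ENNReal.add_div, mul_div_assoc, setLAverage_eq, osc, setLAverage_eq]

variable {ρ : (Ω → ℝ≥0∞) → ℝ≥0∞}

lemma modulus_le_mul_modulus (hΩ : IsRDSpace μ k n) (h : IsRINorm μ ρ)
    (hK : ∀ (x : Ω) (r : ℝ), 0 < r → μ (Metric.ball x (2 * r)) ≤ K * μ (Metric.ball x r))
    {f : Ω → ℝ} (hf : Measurable f) {q : ℝ} (hq : 0 < q) {s t : ℝ} (hs : 0 < s) (hst : s ≤ t)
    (hts : t ≤ 2 * s) :
    modulus μ (convexification q ρ) f s ≤ K * modulus μ (convexification q ρ) f t :=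
  (h.convexification_mono hq (measurable_osc hf s).aemeasurable
    ((measurable_osc hf t).const_mul _).aemeasurable
    (Eventually.of_forall (osc_le_mul_osc hΩ hK f hs hst hts))).trans
    (h.convexification_smul_le hq _ (measurable_osc hf t).aemeasurable)

variable [NullSingletonClass μ]

/-- The minimum keeps both bounds on the increment: one entry is controlled in X^(p), the other is a
constant, so the minimum can be interpolated into X^(σp). -/
lemma osc_le_osc_half_add_min (hΩ : IsRDSpace μ k n) (h : IsRINorm μ ρ)
    (hK : ∀ (x : Ω) (r : ℝ), 0 < r → μ (Metric.ball x (2 * r)) ≤ K * μ (Metric.ball x r))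
    {f : Ω → ℝ} (hf : Measurable f) {p : ℝ} (hp : 1 ≤ p) {t : ℝ} (ht : 0 < t) {L : ℝ≥0∞}
    (hL0 : L ≠ 0) (hLt : L ≠ ∞)
    (hL : ∀ x, L ≤ ρ ((Metric.ball x (t / 2)).indicator fun _ => 1)) (x : Ω) :
    osc μ f t x ≤ osc μ f (t / 2) x + min (osc μ f t x + osc μ f (t / 2) x)
      (K ^ 2 * (modulus μ (convexification p ρ) f (2 * t) / L ^ (1 / p))) := by
  rcases min_choice (osc μ f t x + osc μ f (t / 2) x)
      (K ^ 2 * (modulus μ (convexification p ρ) f (2 * t) / L ^ (1 / p))) with hmin | hmin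
  · rw [hmin]
    exact le_add_left le_self_add
  · rw [hmin]
    refine (osc_le_osc_half_add hΩ hK hf ht x).trans ?_
    gcongr
    have hp0 : 0 < 1 / p := by positivity
    have h1 : L ^ (1 / p) ≠ 0 := by
      rw [Ne, ENNReal.rpow_eq_zero_iff_of_pos hp0]
      exact hL0
    rw [ENNReal.le_div_iff_mul_le (Or.inl h1)
      (Or.inl (ENNReal.rpow_ne_top_of_nonneg hp0.le hLt))]
    refine le_trans ?_ (h.laverage_mul_le_convexification hp
      (S := Metric.ball x (t / 2)) Metric.isOpen_ball.measurableSet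
      (hΩ.ball_pos x _ (by linarith)) (hΩ.ball_lt_top x _ (by linarith))
      (measurable_osc hf (2 * t)).aemeasurable)
    exact mul_le_mul' le_rfl (ENNReal.rpow_le_rpow (hL x) hp0.le)

/-- The modulus of continuity in `X^(σp)` is controlled by a sum of moduli in `X^(p)`. -/
lemma exists_modulus_le_tsum {γ p σ : ℝ} (hΩ : IsRDSpace μ k n) (h : IsRINorm μ ρ)
    (hγ : 0 ≤ γ) (hp : 1 ≤ p) (hσ : 1 < σ) {c : ℝ} (hc : 0 < c)
    (hball : ∀ (x : Ω) (r : ℝ), 0 < r → r ≤ 1 →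
      ENNReal.ofReal (c * r ^ (n * γ)) ≤ ρ ((Metric.ball x r).indicator fun _ => 1)) :
    ∃ C : ℝ≥0, ∀ f : Ω → ℝ, Measurable f → ∀ t : ℝ, 0 < t → t ≤ 1 →
      modulus μ (convexification (σ * p) ρ) f t ≤ C * ∑' j : ℕ,
        ENNReal.ofReal ((t / 2 ^ j) ^ (-(n * γ / p * (1 - 1 / σ)))) *
          modulus μ (convexification p ρ) f (2 * (t / 2 ^ j)) := by
  obtain ⟨K, hK1, hK⟩ := hΩ.exists_doubling
  have hn : 0 ≤ n := hΩ.k_pos.le.trans hΩ.k_le_n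
  have hp0 : 0 < p := by linarith
  have hσ0 : 0 < σ := by linarith
  have hσp : 1 ≤ σ * p := by nlinarith
  have hσ1 : 0 ≤ 1 - 1 / σ := by
    rw [sub_nonneg, div_le_one hσ0]
    exact hσ.le
  set δ := n * γ / p * (1 - 1 / σ) with hδ
  have hδ0 : 0 ≤ δ := by positivity
  set Y := convexification p ρ with hY
  set Z := convexification (σ * p) ρ with hZ
  set C₀ : ℝ := ((K : ℝ) ^ 2 * (c * (1 / 2) ^ (n * γ)) ^ (-(1 / p))) ^ (1 - 1 / σ) *
    ((K : ℝ) + K ^ 2) ^ (1 / σ) with hC₀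
  have hKpos : (0 : ℝ) < K := lt_of_lt_of_le one_pos (by exact_mod_cast hK1)
  have hC₀pos : 0 < C₀ := by positivity
  set L : ℝ → ℝ≥0∞ := fun t => ENNReal.ofReal (c * (t / 2) ^ (n * γ)) with hL
  set M : (Ω → ℝ) → ℝ → ℝ≥0∞ := fun f t => K ^ 2 * (modulus μ Y f (2 * t) / L t ^ (1 / p)) with hM
  set D : (Ω → ℝ) → ℝ → Ω → ℝ≥0∞ := fun f t x =>
    min (osc μ f t x + osc μ f (t / 2) x) (M f t) with hD
  have hDmeas : ∀ f, Measurable f → ∀ t, Measurable (D f t) := fun f hf t =>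
    ((measurable_osc hf t).add (measurable_osc hf (t / 2))).min measurable_const
  -- Interpolation of the increment D: the sup bound M contributes t^(-nγ/p) to the power 1 - 1/σ,
  -- which is t^(-δ), and the powers of the modulus add up to one.
  have hDZ : ∀ f, Measurable f → ∀ t, 0 < t → t ≤ 1 →
      Z (D f t) ≤ ENNReal.ofReal C₀ * (ENNReal.ofReal (t ^ (-δ)) * modulus μ Y f (2 * t)) := by
    intro f hf t ht ht1
    have h1 : Z (D f t) ≤ M f t ^ (1 - 1 / σ) * Y (D f t) ^ (1 / σ) :=
      h.convexification_le_of_le_const hp0 hσ (hDmeas f hf t).aemeasurable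
        fun x => min_le_right _ _
    have h2 : Y (D f t) ≤ ENNReal.ofReal ((K : ℝ) + K ^ 2) * modulus μ Y f (2 * t) := by
      calc Y (D f t) ≤ Y (fun x => osc μ f t x + osc μ f (t / 2) x) :=
            h.convexification_mono hp0 (hDmeas f hf t).aemeasurable
              ((measurable_osc hf t).add (measurable_osc hf (t / 2))).aemeasurable
              (Eventually.of_forall fun x => min_le_left _ _)
        _ ≤ modulus μ Y f t + modulus μ Y f (t / 2) :=
            h.convexification_add_le hp (measurable_osc hf t).aemeasurable
              (measurable_osc hf _).aemeasurable
        _ ≤ K * modulus μ Y f (2 * t) + K * (K * modulus μ Y f (2 * t)) := by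
            have h3 := modulus_le_mul_modulus hΩ h hK hf hp0 ht (by linarith : t ≤ 2 * t) le_rfl
            have h4 := modulus_le_mul_modulus hΩ h hK hf hp0 (half_pos ht)
              (by linarith : t / 2 ≤ t) (by linarith)
            exact add_le_add h3 (h4.trans (mul_le_mul' le_rfl h3))
        _ = _ := by
            rw [ENNReal.ofReal_add (by positivity) (by positivity),
              ENNReal.ofReal_pow (by positivity), ENNReal.ofReal_coe_nnreal]
            ring
    have h3 : M f t = ENNReal.ofReal ((K : ℝ) ^ 2 * (c * (1 / 2) ^ (n * γ)) ^ (-(1 / p)) *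
        t ^ (-(n * γ / p))) * modulus μ Y f (2 * t) := by
      have e1 : L t ^ (1 / p) = ENNReal.ofReal ((c * (t / 2) ^ (n * γ)) ^ (1 / p)) :=
        ENNReal.ofReal_rpow_of_pos (by positivity)
      have e2 : (c * (t / 2) ^ (n * γ)) ^ (-(1 / p)) =
          (c * (1 / 2) ^ (n * γ)) ^ (-(1 / p)) * t ^ (-(n * γ / p)) := by
        rw [show t / 2 = 1 / 2 * t by ring, Real.mul_rpow (by positivity) ht.le, ← mul_assoc,
          Real.mul_rpow (by positivity) (by positivity), ← Real.rpow_mul ht.le]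
        congr 2
        ring
      rw [hM]
      simp only
      rw [e1, div_eq_mul_inv, ← ENNReal.ofReal_inv_of_pos (by positivity),
        ← Real.rpow_neg (by positivity), e2, mul_assoc ((K : ℝ) ^ 2),
        ENNReal.ofReal_mul (p := (K : ℝ) ^ 2) (by positivity), ENNReal.ofReal_pow (by positivity),
        ENNReal.ofReal_coe_nnreal]
      ring
    set e := modulus μ Y f (2 * t)
    calc Z (D f t) ≤ M f t ^ (1 - 1 / σ) *
          (ENNReal.ofReal ((K : ℝ) + K ^ 2) * e) ^ (1 / σ) := h1.trans (by gcongr)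
      _ = ENNReal.ofReal (((K : ℝ) ^ 2 * (c * (1 / 2) ^ (n * γ)) ^ (-(1 / p)) *
            t ^ (-(n * γ / p))) ^ (1 - 1 / σ)) * ENNReal.ofReal (((K : ℝ) + K ^ 2) ^ (1 / σ)) *
            (e ^ (1 - 1 / σ) * e ^ (1 / σ)) := by
          rw [h3, ENNReal.mul_rpow_of_nonneg _ _ hσ1,
            ENNReal.mul_rpow_of_nonneg _ _ (by positivity : 0 ≤ 1 / σ),
            ENNReal.ofReal_rpow_of_pos (by positivity), ENNReal.ofReal_rpow_of_pos (by positivity)]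
          ring
      _ = ENNReal.ofReal (C₀ * t ^ (-δ)) * e := by
          rw [← ENNReal.rpow_add_of_nonneg _ _ hσ1 (by positivity), sub_add_cancel,
            ENNReal.rpow_one, ← ENNReal.ofReal_mul (by positivity),
            Real.mul_rpow (by positivity) (by positivity), ← Real.rpow_mul ht.le, hC₀]
          congr 2
          rw [show -(n * γ / p) * (1 - 1 / σ) = -δ by rw [hδ]; ring]
          ring
      _ = _ := by rw [ENNReal.ofReal_mul hC₀pos.le, mul_assoc]
  refine ⟨C₀.toNNReal, fun f hf t ht ht1 => ?_⟩
  have hC₀' : ((C₀.toNNReal : ℝ≥0) : ℝ≥0∞) = ENNReal.ofReal C₀ := rfl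
  rw [hC₀']
  set S := ∑' j : ℕ, ENNReal.ofReal ((t / 2 ^ j) ^ (-δ)) * modulus μ Y f (2 * (t / 2 ^ j)) with hS
  rcases eq_or_ne S ∞ with hSt | hSt
  · rw [hSt, ENNReal.mul_top (ENNReal.ofReal_pos.2 hC₀pos).ne']
    exact le_top
  have htj : ∀ j : ℕ, 0 < t / 2 ^ j := fun j => by positivity
  have htj1 : ∀ j : ℕ, t / 2 ^ j ≤ 1 := fun j =>
    (div_le_self ht.le (one_le_pow₀ one_le_two)).trans ht1
  have hchain : ∀ (N : ℕ) x,
      osc μ f t x ≤ osc μ f (t / 2 ^ N) x + ∑ j ∈ Finset.range N, D f (t / 2 ^ j) x := by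
    intro N x
    induction N with
    | zero => simp
    | succ N ih =>
      have h1 := osc_le_osc_half_add_min hΩ h hK hf hp (htj N) (L := L (t / 2 ^ N))
        (ENNReal.ofReal_pos.2 (by have := htj N; positivity)).ne' ENNReal.ofReal_ne_top
        (fun x => hball x _ (half_pos (htj N)) (by linarith [htj1 N])) x
      have h2 : t / 2 ^ (N + 1) = t / 2 ^ N / 2 := by rw [pow_succ, div_div]
      rw [Finset.sum_range_succ, h2]
      calc _ ≤ _ := ih
        _ ≤ (osc μ f (t / 2 ^ N / 2) x + D f (t / 2 ^ N) x) +
            ∑ j ∈ Finset.range N, D f (t / 2 ^ j) x := by gcongr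
        _ = _ := by ring
  have hsummable : ∑' j : ℕ, modulus μ Y f (t / 2 ^ j) ≠ ∞ := by
    have : ∑' j : ℕ, modulus μ Y f (t / 2 ^ j) ≤ K * S := by
      rw [hS, ← ENNReal.tsum_mul_left]
      refine ENNReal.tsum_le_tsum fun j => ?_
      calc modulus μ Y f (t / 2 ^ j) ≤ K * modulus μ Y f (2 * (t / 2 ^ j)) :=
            modulus_le_mul_modulus hΩ h hK hf hp0 (htj j) (by linarith [htj j]) le_rfl
        _ = K * (1 * modulus μ Y f (2 * (t / 2 ^ j))) := by rw [one_mul]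
        _ ≤ _ := by
          gcongr
          rw [← ENNReal.ofReal_one]
          exact ENNReal.ofReal_le_ofReal
            (Real.one_le_rpow_of_pos_of_le_one_of_nonpos (htj j) (htj1 j) (by linarith))
    exact ne_top_of_le_ne_top (ENNReal.mul_ne_top (by simp) hSt) this
  -- The remainder osc(t/2^N) tends to 0 almost everywhere because the oscillations at all dyadic
  -- scales have a sum of finite X^(p)-norm. This replaces Lebesgue differentiation and is why the
  -- case S = ∞ was set aside.
  have hae : ∀ᵐ x ∂μ, osc μ f t x ≤ ∑' j : ℕ, D f (t / 2 ^ j) x := by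
    have h1 := h.convexification_ae_lt_top hp0
      (f := fun x => ∑' j : ℕ, osc μ f (t / 2 ^ j) x)
      (AEMeasurable.tsum fun j => (measurable_osc hf _).aemeasurable)
      ((h.convexification_tsum_le hp fun j => (measurable_osc hf _).aemeasurable).trans_lt
        hsummable.lt_top)
    filter_upwards [h1] with x hx
    have hlim := ENNReal.tendsto_atTop_zero_of_tsum_ne_top hx.ne
    have h2 : Tendsto (fun N => osc μ f (t / 2 ^ N) x + ∑' j : ℕ, D f (t / 2 ^ j) x) atTop
        (𝓝 (0 + ∑' j : ℕ, D f (t / 2 ^ j) x)) := hlim.add tendsto_const_nhds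
    rw [zero_add] at h2
    exact ge_of_tendsto' h2 fun N => (hchain N x).trans (by gcongr; exact ENNReal.sum_le_tsum _)
  calc modulus μ Z f t ≤ Z (fun x => ∑' j : ℕ, D f (t / 2 ^ j) x) :=
        h.convexification_mono (by linarith) (measurable_osc hf t).aemeasurable
          (AEMeasurable.tsum fun j => (hDmeas f hf _).aemeasurable) hae
    _ ≤ ∑' j : ℕ, Z (D f (t / 2 ^ j)) :=
        h.convexification_tsum_le hσp fun j => (hDmeas f hf _).aemeasurable
    _ ≤ ∑' j : ℕ, ENNReal.ofReal C₀ * (ENNReal.ofReal ((t / 2 ^ j) ^ (-δ)) *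
          modulus μ Y f (2 * (t / 2 ^ j))) :=
        ENNReal.tsum_le_tsum fun j => hDZ f hf _ (htj j) (htj1 j)
    _ = _ := ENNReal.tsum_mul_left

end Oscillation

/-! ### Averaging operators -/

section WeakType

variable {Ω : Type*} [MetricSpace Ω] [MeasurableSpace Ω] [BorelSpace Ω]
  [SecondCountableTopology Ω] {μ : Measure Ω} [SigmaFinite μ]
  {k n : ℝ} {K : ℝ≥0} {ρ : (Ω → ℝ≥0∞) → ℝ≥0∞}

lemma measurable_laverage_ball_const (t : ℝ) {g : Ω → ℝ≥0∞} (hg : Measurable g) :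
    Measurable fun x => ⨍⁻ y in Metric.ball x t, g y ∂μ :=
  measurable_laverage_ball t (F := fun _ y => g y) (hg.comp measurable_snd)

variable [NullSingletonClass μ]

/-- Weak type estimate for the averaging operator over balls of a fixed radius. -/
lemma mul_norm_level_laverage_le (hΩ : IsRDSpace μ k n) (h : IsRINorm μ ρ)
    (hK : ∀ (x : Ω) (r : ℝ), 0 < r → μ (Metric.ball x (2 * r)) ≤ K * μ (Metric.ball x r))
    {t : ℝ} (ht : 0 < t) {g : Ω → ℝ≥0∞} (hg : Measurable g) (l : ℝ≥0∞) :
    l * ρ ({x | l < ⨍⁻ y in Metric.ball x t, g y ∂μ}.indicator fun _ => 1) ≤ (K + 1) * ρ g := by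
  classical
  set F : Set Ω := {x | l < ⨍⁻ y in Metric.ball x t, g y ∂μ} with hF
  have hFm : MeasurableSet F :=
    measurableSet_lt measurable_const (measurable_laverage_ball_const t hg)
  obtain ⟨u, huF, hu, hcov⟩ := exists_disjoint_balls F ht
  have hcount : u.Countable := hΩ.countable_of_pairwiseDisjoint ht hu
  rcases u.eq_empty_or_nonempty with hue | hune
  · have hFe : F = ∅ := by
      ext x
      simp only [mem_empty_iff_false, iff_false]
      intro hx
      obtain ⟨y, hy, -⟩ := hcov x hx
      simp [hue] at hy
    rw [hFe, indicator_empty]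
    change l * ρ (fun _ => 0) ≤ _
    rw [h.zero, mul_zero]
    exact zero_le
  obtain ⟨y, hy⟩ := hcount.exists_eq_range hune
  -- The enumeration y may repeat centres; passing to a finite image keeps the balls disjoint.
  set v : ℕ → Finset Ω := fun N => (Finset.range N).image y with hv
  have hvu : ∀ N, ∀ z ∈ v N, z ∈ u := by
    intro N z hz
    obtain ⟨i, -, rfl⟩ := Finset.mem_image.1 hz
    rw [hy]
    exact mem_range_self i
  have hb : ∀ (z : Ω) s, MeasurableSet (Metric.ball z s) :=
    fun z s => Metric.isOpen_ball.measurableSet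
  set G : ℕ → Set Ω := fun N => ⋃ z ∈ v N, Metric.ball z t with hG
  set F' : ℕ → Set Ω := fun N => F ∩ ⋃ z ∈ v N, Metric.ball z (2 * t) with hF'
  have hGm : ∀ N, MeasurableSet (G N) := fun N => Finset.measurableSet_biUnion _ fun z _ => hb z t
  have hF'm : ∀ N, MeasurableSet (F' N) := fun N =>
    hFm.inter (Finset.measurableSet_biUnion _ fun z _ => hb z _)
  have hdisj : ∀ N, (v N : Set Ω).PairwiseDisjoint fun z => Metric.ball z t := fun N =>
    hu.subset fun z hz => hvu N z hz
  have hGμ : ∀ N, μ (G N) = ∑ z ∈ v N, μ (Metric.ball z t) := fun N =>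
    measure_biUnion_finset (hdisj N) fun z _ => hb z t
  have hGfin : ∀ N, μ (G N) < ∞ := fun N => by
    rw [hGμ]
    exact ENNReal.sum_lt_top.2 fun z _ => hΩ.ball_lt_top z t ht
  have hFG : ∀ N, μ (F' N) ≤ K * μ (G N) := fun N => by
    rw [hGμ, Finset.mul_sum]
    calc μ (F' N) ≤ μ (⋃ z ∈ v N, Metric.ball z (2 * t)) := measure_mono inter_subset_right
      _ ≤ ∑ z ∈ v N, μ (Metric.ball z (2 * t)) := measure_biUnion_finset_le _ _
      _ ≤ _ := Finset.sum_le_sum fun z _ => hK z t ht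
  -- Each centre lies in F, so the mean of g over its ball exceeds l, and disjointness lets these
  -- bounds be added.
  have hGg : ∀ N, l * μ (G N) ≤ ∫⁻ x in G N, g x ∂μ := fun N => by
    rw [hGμ, lintegral_biUnion_finset (hdisj N) fun z _ => hb z t, Finset.mul_sum]
    refine Finset.sum_le_sum fun z hz => ?_
    have h1 : l < ⨍⁻ y in Metric.ball z t, g y ∂μ := huF (hvu N z hz)
    rw [setLAverage_eq] at h1
    exact (ENNReal.le_div_iff_mul_le (Or.inl (hΩ.ball_pos z t ht).ne')
      (Or.inl (hΩ.ball_lt_top z t ht).ne)).1 h1.le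
  have hstep : ∀ N, l * ρ ((F' N).indicator fun _ => 1) ≤ (K + 1) * ρ g := fun N => by
    rcases eq_or_ne (μ (G N)) 0 with h0 | h0
    · have hF0 : μ (F' N) = 0 := by simpa [h0] using hFG N
      rw [h.congr_ae (g := fun _ => 0) (aemeasurable_const.indicator (hF'm N)), h.zero, mul_zero]
      · exact zero_le
      · exact indicator_meas_zero hF0
    have h1 : l * ρ ((G N).indicator fun _ => 1) ≤ ρ g := by
      refine (ENNReal.mul_le_mul_iff_right h0 (hGfin N).ne).1 ?_
      calc μ (G N) * (l * ρ ((G N).indicator fun _ => 1))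
          = l * μ (G N) * ρ ((G N).indicator fun _ => 1) := by ring
        _ ≤ (∫⁻ x in G N, g x ∂μ) * ρ ((G N).indicator fun _ => 1) := by gcongr; exact hGg N
        _ ≤ _ := h.setLIntegral_mul_le (hGm N) (hGfin N) hg.aemeasurable
    calc l * ρ ((F' N).indicator fun _ => 1)
        ≤ l * ((K + 1) * ρ ((G N).indicator fun _ => 1)) := by
          gcongr
          exact h.indicator_le_of_measure_le (hF'm N) (hGm N) (hGfin N) (hFG N)
      _ = (K + 1) * (l * ρ ((G N).indicator fun _ => 1)) := by ring
      _ ≤ _ := by gcongr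
  have hmono : Monotone F' := fun N N' hN =>
    inter_subset_inter_right _ (biUnion_subset_biUnion_left
      (Finset.image_subset_image (Finset.range_mono hN)))
  have hsup : (F.indicator fun _ => (1 : ℝ≥0∞)) =
      fun x => ⨆ N, (F' N).indicator (fun _ => (1 : ℝ≥0∞)) x := by
    ext x
    by_cases hx : x ∈ F
    · refine le_antisymm ?_ (iSup_le fun N =>
        indicator_le_indicator_of_subset inter_subset_left (fun _ => zero_le) x)
      obtain ⟨z, hz, hxz⟩ := hcov x hx
      rw [hy] at hz
      obtain ⟨i, rfl⟩ := hz
      have hxF' : x ∈ F' (i + 1) := by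
        refine ⟨hx, mem_iUnion₂.2 ⟨y i, ?_, hxz⟩⟩
        exact Finset.mem_image_of_mem y (Finset.self_mem_range_succ i)
      refine le_trans ?_ (le_iSup _ (i + 1))
      rw [indicator_of_mem hx, indicator_of_mem hxF']
    · rw [indicator_of_notMem hx, eq_comm, ← nonpos_iff_eq_zero]
      refine iSup_le fun N => ?_
      rw [indicator_of_notMem fun hxN => hx hxN.1]
  rw [hsup, h.fatou _ (fun N => aemeasurable_const.indicator (hF'm N))
    (fun N N' hN x => indicator_le_indicator_of_subset (hmono hN) (fun _ => zero_le) x),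
    ENNReal.mul_iSup]
  exact iSup_le hstep

/-- Interpolation between the weak type estimate and the sup bound H. The averages are split at the
levels H/2^j; the weak estimate bounds the j-th layer of the σ-th power by a multiple of H^(σ-1)
2^(-j(σ-1)) ρ g, which is summable because σ > 1. -/
lemma exists_norm_laverage_rpow_le {σ : ℝ} (hσ : 1 < σ) (hΩ : IsRDSpace μ k n)
    (h : IsRINorm μ ρ) :
    ∃ C : ℝ≥0, C ≠ 0 ∧ ∀ (t : ℝ), 0 < t → ∀ (g : Ω → ℝ≥0∞), Measurable g → ∀ H : ℝ≥0∞, H ≠ ∞ →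
      (∀ x, ⨍⁻ y in Metric.ball x t, g y ∂μ ≤ H) →
      ρ (fun x => (⨍⁻ y in Metric.ball x t, g y ∂μ) ^ σ) ≤ C * H ^ (σ - 1) * ρ g := by
  obtain ⟨K, hK1, hK⟩ := hΩ.exists_doubling
  have hσ0 : 0 < σ := by linarith
  set q : ℝ≥0 := (1 / 2) ^ (σ - 1) with hq
  have hq1 : q < 1 := NNReal.rpow_lt_one (by
    rw [← NNReal.coe_lt_coe]; norm_num) (by linarith)
  have hqt : (1 - (q : ℝ≥0∞))⁻¹ ≠ ∞ := by
    rw [ENNReal.inv_ne_top, Ne, tsub_eq_zero_iff_le, not_le]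
    exact_mod_cast hq1
  set C : ℝ≥0∞ := 2 * (K + 1) * (1 - (q : ℝ≥0∞))⁻¹ with hC
  have hCt : C ≠ ∞ := ENNReal.mul_ne_top (ENNReal.mul_ne_top (by simp) (by simp)) hqt
  have hC0 : C ≠ 0 := by
    refine mul_ne_zero (mul_ne_zero (by simp) (by simp)) (ENNReal.inv_ne_zero.2 ?_)
    exact ne_top_of_le_ne_top ENNReal.one_ne_top tsub_le_self
  refine ⟨C.toNNReal, (ENNReal.toNNReal_ne_zero).2 ⟨hC0, hCt⟩, fun t ht g hg H hHt hH => ?_⟩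
  rw [ENNReal.coe_toNNReal hCt]
  have hTm : Measurable fun x => ⨍⁻ y in Metric.ball x t, g y ∂μ :=
    measurable_laverage_ball_const t hg
  set T : Ω → ℝ≥0∞ := fun x => ⨍⁻ y in Metric.ball x t, g y ∂μ with hT
  rcases eq_or_ne H 0 with hH0 | hH0
  · have : (fun x => T x ^ σ) = fun _ => 0 := by
      ext x
      have : T x = 0 := le_antisymm ((hH x).trans hH0.le) zero_le
      rw [this, ENNReal.zero_rpow_of_pos hσ0]
    rw [this, h.zero]
    exact zero_le
  set E : ℕ → Set Ω := fun j => {x | H / 2 ^ (j + 1) < T x} with hE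
  have hEm : ∀ j, MeasurableSet (E j) := fun j => measurableSet_lt measurable_const hTm
  have hpt : ∀ x, T x ^ σ ≤ ∑' j : ℕ, (H / 2 ^ j) ^ σ * (E j).indicator (fun _ => 1) x := by
    intro x
    rcases eq_or_ne (T x) 0 with h0 | h0
    · rw [h0, ENNReal.zero_rpow_of_pos hσ0]
      exact zero_le
    have hex : ∃ j : ℕ, H / 2 ^ (j + 1) < T x := by
      have hlim : Tendsto (fun j : ℕ => H * (2⁻¹ : ℝ≥0∞) ^ j) atTop (𝓝 (H * 0)) :=
        ENNReal.Tendsto.const_mul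
          (ENNReal.tendsto_pow_atTop_nhds_zero_of_lt_one (by simp)) (Or.inr hHt)
      rw [mul_zero] at hlim
      obtain ⟨j, hj⟩ := (((tendsto_order.1 hlim).2 _ (pos_iff_ne_zero.2 h0)).and
        (eventually_ge_atTop 1)).exists
      refine ⟨j - 1, ?_⟩
      rw [Nat.sub_add_cancel hj.2, div_eq_mul_inv, ENNReal.inv_pow]
      exact hj.1
    classical
    set j := Nat.find hex with hj
    have hjE : x ∈ E j := Nat.find_spec hex
    have hup : T x ≤ H / 2 ^ j := by
      rcases Nat.eq_zero_or_pos j with hj0 | hj0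
      · rw [hj0, pow_zero, div_one]
        exact hH x
      · have := Nat.find_min hex (Nat.sub_lt hj0 one_pos)
        rw [not_lt, Nat.sub_add_cancel (Nat.one_le_iff_ne_zero.2 hj0.ne')] at this
        exact this
    refine le_trans ?_ (ENNReal.le_tsum j)
    rw [indicator_of_mem hjE, mul_one]
    exact ENNReal.rpow_le_rpow hup hσ0.le
  have hterm : ∀ j : ℕ, ρ (fun x => (H / 2 ^ j) ^ σ * (E j).indicator (fun _ => 1) x) ≤
      2 * (K + 1) * H ^ (σ - 1) * ρ g * (q : ℝ≥0∞) ^ j := by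
    intro j
    have h2j : (2 : ℝ≥0∞) ^ j ≠ 0 := by simp
    have h2jt : (2 : ℝ≥0∞) ^ j ≠ ∞ := by finiteness
    have hd0 : H / 2 ^ j ≠ 0 := (ENNReal.div_pos hH0 h2jt).ne'
    have hdt : H / 2 ^ j ≠ ∞ := (ENNReal.div_lt_top hHt h2j).ne
    rw [h.smul_of_ne_top (ENNReal.rpow_ne_top_of_nonneg hσ0.le hdt)
      (aemeasurable_const.indicator (hEm j))]
    have hw := mul_norm_level_laverage_le hΩ h hK ht hg (H / 2 ^ (j + 1))
    have e1 : (H / 2 ^ j) ^ σ = (H / 2 ^ j) ^ (σ - 1) * (2 * (H / 2 ^ (j + 1))) := by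
      have : 2 * (H / 2 ^ (j + 1)) = H / 2 ^ j := by
        rw [pow_succ, div_eq_mul_inv, ENNReal.mul_inv (Or.inr (by simp)) (Or.inr (by simp)),
          ← mul_assoc, mul_comm 2, mul_assoc H, mul_comm (2 : ℝ≥0∞), mul_assoc,
          ENNReal.inv_mul_cancel two_ne_zero (by simp), mul_one, div_eq_mul_inv]
      rw [this]
      nth_rewrite 3 [← ENNReal.rpow_one (H / 2 ^ j)]
      rw [← ENNReal.rpow_add _ _ hd0 hdt, sub_add_cancel]
    have e2 : (H / 2 ^ j) ^ (σ - 1) = H ^ (σ - 1) * (q : ℝ≥0∞) ^ j := by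
      rw [div_eq_mul_inv, ENNReal.mul_rpow_of_nonneg _ _ (by linarith), ENNReal.inv_pow, hq,
        ENNReal.coe_rpow_of_nonneg _ (by linarith : 0 ≤ σ - 1),
        ← ENNReal.rpow_natCast, ← ENNReal.rpow_natCast, ← ENNReal.rpow_mul, ← ENNReal.rpow_mul,
        mul_comm (j : ℝ)]
      simp
    calc (H / 2 ^ j) ^ σ * ρ ((E j).indicator fun _ => 1)
        = 2 * (H ^ (σ - 1) * (q : ℝ≥0∞) ^ j) *
          (H / 2 ^ (j + 1) * ρ ((E j).indicator fun _ => 1)) := by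
          rw [e1, e2]
          ring
      _ ≤ 2 * (H ^ (σ - 1) * (q : ℝ≥0∞) ^ j) * ((K + 1) * ρ g) := by gcongr
      _ = _ := by ring
  calc ρ (fun x => T x ^ σ)
      ≤ ρ (fun x => ∑' j : ℕ, (H / 2 ^ j) ^ σ * (E j).indicator (fun _ => 1) x) :=
        h.mono' (hTm.pow_const σ).aemeasurable (AEMeasurable.tsum fun j =>
          (aemeasurable_const.indicator (hEm j)).const_mul _) hpt
    _ ≤ ∑' j : ℕ, ρ (fun x => (H / 2 ^ j) ^ σ * (E j).indicator (fun _ => 1) x) :=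
        h.tsum_le fun j => (aemeasurable_const.indicator (hEm j)).const_mul _
    _ ≤ ∑' j : ℕ, 2 * (K + 1) * H ^ (σ - 1) * ρ g * (q : ℝ≥0∞) ^ j :=
        ENNReal.tsum_le_tsum hterm
    _ = _ := by
        rw [ENNReal.tsum_mul_left, ENNReal.tsum_geometric, hC]
        ring

/-- Averages over balls map `X^(p)` to `X^(σp)`. -/
lemma exists_convexification_laverage_le {γ p σ : ℝ} (hΩ : IsRDSpace μ k n) (h : IsRINorm μ ρ)
    (hp : 1 ≤ p) (hσ : 1 < σ) {c : ℝ} (hc : 0 < c)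
    (hball : ∀ (x : Ω) (r : ℝ), 0 < r → r ≤ 1 →
      ENNReal.ofReal (c * r ^ (n * γ)) ≤ ρ ((Metric.ball x r).indicator fun _ => 1)) :
    ∃ C : ℝ≥0, ∀ g : Ω → ℝ≥0∞, Measurable g → ∀ s t : ℝ, 0 < s → s ≤ 1 → s ≤ t →
      convexification (σ * p) ρ (fun x => ⨍⁻ y in Metric.ball x t, g y ∂μ) ≤
        C * (ENNReal.ofReal (s ^ (-(n * γ / p * (1 - 1 / σ)))) * convexification p ρ g) := by
  obtain ⟨C₁, hC₁0, hC₁⟩ := exists_norm_laverage_rpow_le (ρ := ρ) hσ hΩ h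
  have hp0 : 0 < p := by linarith
  have hσ0 : 0 < σ := by linarith
  have hσp : 0 < σ * p := by positivity
  set C : ℝ := ((C₁ : ℝ) * c ^ (-(σ - 1))) ^ (1 / (σ * p)) with hC
  have hC₁pos : (0 : ℝ) < C₁ := by exact_mod_cast pos_iff_ne_zero.2 hC₁0
  have hCpos : 0 < C := by positivity
  refine ⟨C.toNNReal, fun g hg s t hs hs1 hst => ?_⟩
  have hC' : ((C.toNNReal : ℝ≥0) : ℝ≥0∞) = ENNReal.ofReal C := rfl
  rw [hC']
  have ht : 0 < t := hs.trans_le hst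
  have hgp : Measurable fun y => g y ^ p := hg.pow_const p
  rcases eq_or_ne (ρ fun y => g y ^ p) ∞ with htop | htop
  · have : convexification p ρ g = ∞ := by
      rw [convexification, htop, ENNReal.top_rpow_of_pos (by positivity)]
    rw [this, ENNReal.mul_top (ENNReal.ofReal_pos.2 (by positivity)).ne',
      ENNReal.mul_top (ENNReal.ofReal_pos.2 hCpos).ne']
    exact le_top
  set L : ℝ := c * s ^ (n * γ) with hL
  have hLpos : 0 < L := by positivity
  set R := ρ fun y => g y ^ p with hR
  -- The radius t may exceed 1, where no lower bound for the norm of χ_B(x,t) is assumed; the bound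
  -- for the smaller ball of radius s ≤ 1 is used.
  have hH : ∀ x, ⨍⁻ y in Metric.ball x t, g y ^ p ∂μ ≤ R / ENNReal.ofReal L := by
    intro x
    rw [ENNReal.le_div_iff_mul_le (Or.inl (ENNReal.ofReal_pos.2 hLpos).ne')
      (Or.inl ENNReal.ofReal_ne_top)]
    refine le_trans (mul_le_mul' le_rfl ?_) (h.laverage_mul_le (S := Metric.ball x t)
      Metric.isOpen_ball.measurableSet (hΩ.ball_lt_top x t ht) hgp.aemeasurable)
    refine (hball x s hs hs1).trans (h.mono'
      (aemeasurable_const.indicator Metric.isOpen_ball.measurableSet)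
      (aemeasurable_const.indicator Metric.isOpen_ball.measurableSet) fun y =>
      indicator_le_indicator_of_subset (Metric.ball_subset_ball hst) (fun _ => zero_le) y)
  have h1 := hC₁ t ht _ hgp _
    (ENNReal.div_lt_top htop (ENNReal.ofReal_pos.2 hLpos).ne').ne hH
  have h2 : ρ (fun x => (⨍⁻ y in Metric.ball x t, g y ∂μ) ^ (σ * p)) ≤
      ρ (fun x => (⨍⁻ y in Metric.ball x t, g y ^ p ∂μ) ^ σ) := by
    refine h.mono' ((measurable_laverage_ball_const t hg).pow_const _).aemeasurable
      ((measurable_laverage_ball_const t hgp).pow_const _).aemeasurable fun x => ?_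
    rw [mul_comm, ENNReal.rpow_mul]
    exact ENNReal.rpow_le_rpow
      (laverage_rpow_le (hΩ.ball_pos x t ht) (hΩ.ball_lt_top x t ht) hp hg.aemeasurable) hσ0.le
  have h3 : (C₁ : ℝ≥0∞) * (R / ENNReal.ofReal L) ^ (σ - 1) * R =
      ENNReal.ofReal (C₁ * L ^ (-(σ - 1))) * R ^ σ := by
    rw [div_eq_mul_inv, ENNReal.mul_rpow_of_nonneg _ _ (by linarith),
      ← ENNReal.ofReal_inv_of_pos hLpos, ENNReal.ofReal_rpow_of_pos (by positivity),
      Real.inv_rpow hLpos.le, ← Real.rpow_neg hLpos.le, ENNReal.ofReal_mul hC₁pos.le,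
      ENNReal.ofReal_coe_nnreal]
    have : R ^ σ = R ^ (σ - 1) * R := by
      nth_rewrite 3 [← ENNReal.rpow_one R]
      rw [← ENNReal.rpow_add_of_nonneg _ _ (by linarith) zero_le_one, sub_add_cancel]
    rw [this]
    ring
  calc convexification (σ * p) ρ (fun x => ⨍⁻ y in Metric.ball x t, g y ∂μ)
      ≤ (ENNReal.ofReal (C₁ * L ^ (-(σ - 1))) * R ^ σ) ^ (1 / (σ * p)) := by
        rw [← h3]
        exact ENNReal.rpow_le_rpow (h2.trans h1) (by positivity)
    _ = ENNReal.ofReal ((C₁ * L ^ (-(σ - 1))) ^ (1 / (σ * p))) * R ^ (1 / p) := by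
        rw [ENNReal.mul_rpow_of_nonneg _ _ (by positivity), ← ENNReal.rpow_mul,
          ENNReal.ofReal_rpow_of_pos (by positivity)]
        congr 2
        field_simp
    _ = _ := by
        rw [← mul_assoc, ← ENNReal.ofReal_mul hCpos.le, convexification]
        congr 2
        rw [hL, hC, Real.mul_rpow hc.le (by positivity), ← mul_assoc,
          Real.mul_rpow (by positivity) (by positivity), ← Real.rpow_mul hs.le,
          ← Real.rpow_mul hs.le]
        congr 2
        field_simp

end WeakType

/-! ### The space `Ẽ` on dyadic step functions -/

section Sequences

lemma ofReal_log_two_pos : 0 < ENNReal.ofReal (Real.log 2) :=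
  ENNReal.ofReal_pos.2 (Real.log_pos one_lt_two)

lemma floor_logb_eq_iff {t : ℝ} (ht : 0 < t) (k : ℤ) :
    ⌊Real.logb 2 t⌋ = k ↔ (2 : ℝ) ^ (k : ℝ) ≤ t ∧ t < (2 : ℝ) ^ ((k : ℝ) + 1) := by
  rw [Int.floor_eq_iff, Real.le_logb_iff_rpow_le one_lt_two ht,
    Real.logb_lt_iff_lt_rpow one_lt_two ht]

lemma measurable_floor_logb : Measurable fun t : ℝ => ⌊Real.logb 2 t⌋ :=
  Int.measurable_floor.comp (Real.measurable_log.div_const _)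

lemma measure_eq_smul_count {ν : Measure ℤ} {l : ℝ≥0∞} (h : ∀ k, ν {k} = l) :
    ν = l • Measure.count :=
  Measure.ext_of_singleton fun k => by simp [h]

/-- Every interval [2^k, 2^(k+1)) has dt/t-measure log 2. -/
lemma map_homMeasure : homMeasure.map (fun t : ℝ => ⌊Real.logb 2 t⌋) =
    ENNReal.ofReal (Real.log 2) • Measure.count := by
  refine measure_eq_smul_count fun k => ?_
  have hm : MeasurableSet ((fun t : ℝ => ⌊Real.logb 2 t⌋) ⁻¹' {k}) :=
    measurable_floor_logb (measurableSet_singleton k)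
  rw [Measure.map_apply measurable_floor_logb (measurableSet_singleton k), homMeasure,
    withDensity_apply _ hm, Measure.restrict_restrict hm]
  have hset : (fun t : ℝ => ⌊Real.logb 2 t⌋) ⁻¹' {k} ∩ Ioi 0 =
      Ico ((2 : ℝ) ^ (k : ℝ)) ((2 : ℝ) ^ ((k : ℝ) + 1)) := by
    ext t
    simp only [mem_inter_iff, mem_preimage, mem_singleton_iff, mem_Ioi, mem_Ico]
    constructor
    · rintro ⟨h1, h2⟩
      exact (floor_logb_eq_iff h2 k).1 h1
    · intro h
      have ht : 0 < t := (by positivity : (0 : ℝ) < 2 ^ (k : ℝ)).trans_le h.1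
      exact ⟨(floor_logb_eq_iff ht k).2 h, ht⟩
  have ha : (0 : ℝ) < 2 ^ (k : ℝ) := by positivity
  have hab : (2 : ℝ) ^ (k : ℝ) ≤ 2 ^ ((k : ℝ) + 1) :=
    Real.rpow_le_rpow_of_exponent_le one_le_two (by linarith)
  rw [hset, restrict_Ico_eq_restrict_Ioc, ← ofReal_integral_eq_lintegral_ofReal,
    ← intervalIntegral.integral_of_le hab, integral_inv_of_pos ha (ha.trans_le hab),
    Real.rpow_add two_pos, Real.rpow_one, mul_div_cancel_left₀ _ ha.ne']
  · refine (intervalIntegrable_iff_integrableOn_Ioc_of_le hab).1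
      (intervalIntegral.intervalIntegrable_inv (fun x hx => ?_) continuousOn_id)
    rw [uIcc_of_le hab] at hx
    exact (ha.trans_le hx.1).ne'
  · filter_upwards [ae_restrict_mem measurableSet_Ioc] with t ht
    exact (inv_pos.2 (ha.trans ht.1)).le

/-- A labelling of intervals of length `log 2` in `(0,∞)` by the integers. -/
noncomputable def intervalLabel (s : ℝ) : ℤ := Equiv.intEquivNat.symm ⌊s / Real.log 2⌋₊

lemma measurable_intervalLabel : Measurable intervalLabel :=
  (measurable_of_countable _).comp (Nat.measurable_floor.comp (measurable_id.div_const _))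

lemma map_intervalLabel : (volume.restrict (Ioi (0 : ℝ))).map intervalLabel =
    ENNReal.ofReal (Real.log 2) • Measure.count := by
  refine measure_eq_smul_count fun k => ?_
  have hm : MeasurableSet (intervalLabel ⁻¹' {k}) :=
    measurable_intervalLabel (measurableSet_singleton k)
  rw [Measure.map_apply measurable_intervalLabel (measurableSet_singleton k),
    Measure.restrict_congr_set Ioi_ae_eq_Ici, Measure.restrict_apply hm]
  have hl : 0 < Real.log 2 := Real.log_pos one_lt_two
  set m := Equiv.intEquivNat k with hm_def
  have hset : intervalLabel ⁻¹' {k} ∩ Ici 0 = Ico (m * Real.log 2) ((m + 1) * Real.log 2) := by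
    ext s
    simp only [mem_inter_iff, mem_preimage, mem_singleton_iff, mem_Ici, mem_Ico, intervalLabel]
    rw [Equiv.symm_apply_eq, ← hm_def]
    constructor
    · rintro ⟨h1, h2⟩
      rw [Nat.floor_eq_iff (by positivity), le_div_iff₀ hl, div_lt_iff₀ hl] at h1
      exact h1
    · intro h
      have hs : 0 ≤ s := le_trans (by positivity) h.1
      refine ⟨?_, hs⟩
      rw [Nat.floor_eq_iff (by positivity), le_div_iff₀ hl, div_lt_iff₀ hl]
      exact h
  rw [hset, Real.volume_Ico]
  congr 1
  ring

lemma measure_lt_comp {ν : Measure ℝ} {π : ℝ → ℤ} (hπ : Measurable π) {l : ℝ≥0∞}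
    (h : ν.map π = l • Measure.count) (w : ℤ → ℝ≥0∞) (c : ℝ≥0∞) :
    ν {t | c < w (π t)} = l * Measure.count {k | c < w k} := by
  have : {t | c < w (π t)} = π ⁻¹' {k | c < w k} := rfl
  rw [this, ← Measure.map_apply hπ (MeasurableSet.of_discrete), h]
  rfl

variable {E : (ℝ → ℝ≥0∞) → ℝ≥0∞}

/-- No measurability of g or g' is required, since only their rearrangements enter E. Weights whose
measurability in t is unknown can thus be compared with step functions. -/
lemma tildeNorm_mono (hE : IsParameter E) {g g' : ℝ → ℝ≥0∞} (h : ∀ t, 0 < t → g t ≤ g' t) :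
    tildeNorm E g ≤ tildeNorm E g' := by
  refine hE.le_of_distribution_le (measurable_decRearr g).aemeasurable
    (measurable_decRearr g').aemeasurable fun c => ?_
  rw [distribution_decRearr, distribution_decRearr]
  refine measure_mono_ae ?_
  refine (withDensity_absolutelyContinuous _ _).ae_le ?_
  filter_upwards [ae_restrict_mem measurableSet_Ioi] with t ht hc
  exact lt_of_lt_of_le hc (h t ht)

/-- The norm in `Ẽ` of the function which is `w k` on `[2^k, 2^(k+1))`. -/
noncomputable def seqNorm (E : (ℝ → ℝ≥0∞) → ℝ≥0∞) (w : ℤ → ℝ≥0∞) : ℝ≥0∞ :=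
  tildeNorm E fun t => w ⌊Real.logb 2 t⌋

lemma measurable_comp_intervalLabel (w : ℤ → ℝ≥0∞) : Measurable fun s => w (intervalLabel s) :=
  (measurable_of_countable w).comp measurable_intervalLabel

/-- A dyadic step function under dt/t is equimeasurable with the step function of the same values on
intervals of length log 2 under Lebesgue measure. The labelling is linear in w, so `seqNorm E`
inherits the triangle inequality and Fatou property from E. -/
lemma seqNorm_eq (hE : IsParameter E) (w : ℤ → ℝ≥0∞) :
    seqNorm E w = E fun s => w (intervalLabel s) := by
  have key : ∀ c, (volume.restrict (Ioi (0 : ℝ)))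
      {s | c < decRearr homMeasure (fun t => w ⌊Real.logb 2 t⌋) s} =
      (volume.restrict (Ioi (0 : ℝ))) {s | c < w (intervalLabel s)} := fun c => by
    rw [distribution_decRearr, measure_lt_comp measurable_floor_logb map_homMeasure,
      measure_lt_comp measurable_intervalLabel map_intervalLabel]
  have hm := (measurable_comp_intervalLabel w).aemeasurable (μ := volume.restrict (Ioi (0 : ℝ)))
  exact le_antisymm
    (hE.le_of_distribution_le (measurable_decRearr _).aemeasurable hm fun c => (key c).le)
    (hE.le_of_distribution_le hm (measurable_decRearr _).aemeasurable fun c => (key c).ge)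

lemma seqNorm_mono (hE : IsParameter E) {w w' : ℤ → ℝ≥0∞} (h : ∀ k, w k ≤ w' k) :
    seqNorm E w ≤ seqNorm E w' :=
  tildeNorm_mono hE fun _ _ => h _

lemma seqNorm_tsum_le (hE : IsParameter E) (W : ℕ → ℤ → ℝ≥0∞) :
    seqNorm E (fun k => ∑' j, W j k) ≤ ∑' j, seqNorm E (W j) := by
  simp only [seqNorm_eq hE]
  exact IsRINorm.tsum_le hE fun j => (measurable_comp_intervalLabel (W j)).aemeasurable

lemma seqNorm_add_le (hE : IsParameter E) (w w' : ℤ → ℝ≥0∞) :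
    seqNorm E (fun k => w k + w' k) ≤ seqNorm E w + seqNorm E w' := by
  simp only [seqNorm_eq hE]
  exact IsRINorm.add_le hE _ _ (measurable_comp_intervalLabel w).aemeasurable
    (measurable_comp_intervalLabel w').aemeasurable

lemma seqNorm_smul_le (hE : IsParameter E) (c : ℝ≥0∞) (w : ℤ → ℝ≥0∞) :
    seqNorm E (fun k => c * w k) ≤ c * seqNorm E w := by
  simp only [seqNorm_eq hE]
  exact IsRINorm.ennreal_smul_le hE c (measurable_comp_intervalLabel w).aemeasurable

/-- Translations of ℤ preserve counting measure, hence the distribution function of the step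
function. -/
lemma seqNorm_shift_le (hE : IsParameter E) (w : ℤ → ℝ≥0∞) (j : ℤ) :
    seqNorm E (fun k => w (k + j)) ≤ seqNorm E w := by
  simp only [seqNorm_eq hE]
  refine IsRINorm.le_of_distribution_le hE
    (measurable_comp_intervalLabel fun k => w (k + j)).aemeasurable
    (measurable_comp_intervalLabel w).aemeasurable fun c => ?_
  rw [measure_lt_comp measurable_intervalLabel map_intervalLabel (fun k => w (k + j)),
    measure_lt_comp measurable_intervalLabel map_intervalLabel]
  gcongr 1
  rw [Measure.count_apply MeasurableSet.of_discrete, Measure.count_apply MeasurableSet.of_discrete]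
  have : {k | c < w k} = (fun k => k + j) '' {k | c < w (k + j)} := by
    ext k
    simp only [mem_ofPred_eq, mem_image]
    exact ⟨fun h => ⟨k - j, by simpa using h, by ring⟩, by rintro ⟨i, hi, rfl⟩; exact hi⟩
  rw [this, (add_left_injective j).encard_image]

lemma single_comp_intervalLabel : (fun s => Pi.single (M := fun _ : ℤ => ℝ≥0∞) 0 1
    (intervalLabel s)) = (intervalLabel ⁻¹' {0}).indicator fun _ => 1 := by
  ext s
  by_cases hs : intervalLabel s = 0
  · simp [hs]
  · rw [Pi.single_eq_of_ne hs, indicator_of_notMem (by simpa using hs)]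

lemma volume_intervalLabel_preimage (k : ℤ) : (volume.restrict (Ioi (0 : ℝ)))
    (intervalLabel ⁻¹' {k}) = ENNReal.ofReal (Real.log 2) := by
  rw [← Measure.map_apply measurable_intervalLabel (measurableSet_singleton k), map_intervalLabel]
  simp

lemma seqNorm_single_lt_top (hE : IsParameter E) :
    seqNorm E (Pi.single 0 1) < ∞ := by
  rw [seqNorm_eq hE, single_comp_intervalLabel]
  refine IsRINorm.indicator_lt_top hE _ (measurable_intervalLabel (measurableSet_singleton 0)) ?_
  rw [volume_intervalLabel_preimage]
  exact ENNReal.ofReal_lt_top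

lemma seqNorm_single_ne_zero (hE : IsParameter E) :
    seqNorm E (Pi.single 0 1) ≠ 0 := by
  have hm : MeasurableSet (intervalLabel ⁻¹' {0}) :=
    measurable_intervalLabel (measurableSet_singleton 0)
  rw [seqNorm_eq hE, single_comp_intervalLabel]
  intro h0
  have h1 := (IsRINorm.eq_zero_iff hE _ (aemeasurable_const.indicator hm)).1 h0
  have h2 : (volume.restrict (Ioi (0 : ℝ))) (intervalLabel ⁻¹' {0}) = 0 := by
    refine measure_mono_null (fun s hs => ?_) h1
    simpa using hs
  rw [volume_intervalLabel_preimage] at h2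
  exact ofReal_log_two_pos.ne' h2

lemma seqNorm_single_shift_le (hE : IsParameter E) (i : ℤ) :
    seqNorm E (Pi.single i 1) ≤ seqNorm E (Pi.single 0 1) := by
  have := seqNorm_shift_le hE (Pi.single 0 1) (-i)
  refine le_trans (seqNorm_mono hE fun k => le_of_eq ?_) this
  simp [Pi.single_apply, add_neg_eq_zero]

lemma seqNorm_single_le_shift (hE : IsParameter E) (i : ℤ) :
    seqNorm E (Pi.single 0 1) ≤ seqNorm E (Pi.single i 1) := by
  have := seqNorm_shift_le hE (Pi.single i 1) i
  refine le_trans (seqNorm_mono hE fun k => le_of_eq ?_) this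
  simp [Pi.single_apply]

/-- Embedding into bounded sequences: w dominates w i times the i-th unit sequence, and all unit
sequences have the same finite nonzero norm. -/
lemma exists_le_mul_seqNorm (hE : IsParameter E) :
    ∃ C : ℝ≥0, ∀ (w : ℤ → ℝ≥0∞) (i : ℤ), w i ≤ C * seqNorm E w := by
  have h0 := seqNorm_single_ne_zero hE
  have ht := (seqNorm_single_lt_top hE).ne
  set A := seqNorm E (Pi.single 0 1)
  refine ⟨A⁻¹.toNNReal, fun w i => ?_⟩
  rw [ENNReal.coe_toNNReal (ENNReal.inv_ne_top.2 h0), mul_comm, ← div_eq_mul_inv]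
  rw [ENNReal.le_div_iff_mul_le (Or.inl h0) (Or.inl ht)]
  have h1 : ∀ c : ℝ≥0, (c : ℝ≥0∞) ≤ w i → c * A ≤ seqNorm E w := by
    intro c hc
    calc c * A ≤ c * seqNorm E (Pi.single i 1) := by
          gcongr
          exact seqNorm_single_le_shift hE i
      _ = seqNorm E (fun k => c * (Pi.single i 1 : ℤ → ℝ≥0∞) k) := by
          simp only [seqNorm_eq hE]
          exact (IsRINorm.smul hE c _ (measurable_comp_intervalLabel _).aemeasurable).symm
      _ ≤ _ := seqNorm_mono hE fun k => by
          by_cases hk : k = i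
          · subst hk
            simpa using hc
          · simp [hk]
  -- Homogeneity holds only for finite scalars, so an infinite entry is approached by arbitrary
  -- finite ones.
  rcases eq_or_ne (w i) ∞ with hw | hw
  · rw [hw, ENNReal.top_mul h0]
    refine (ENNReal.eq_top_of_forall_nnreal_le fun r => ?_).ge
    have := h1 (r / A.toNNReal) (by rw [hw]; exact le_top)
    rwa [ENNReal.coe_div (ENNReal.toNNReal_ne_zero.2 ⟨h0, ht⟩), ENNReal.coe_toNNReal ht,
      ENNReal.div_mul_cancel h0 ht] at this
  · have := h1 (w i).toNNReal (ENNReal.coe_toNNReal hw).le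
    rwa [ENNReal.coe_toNNReal hw] at this

end Sequences

/-! ### Slowly varying functions -/

section SlowlyVarying

variable {b : ℝ → ℝ}

/-- Bounds of Potter type: the ratio of two values of b is at most a multiple of an arbitrarily
small power of the ratio of the arguments. -/
lemma SlowlyVarying.exists_compare (hb : SlowlyVarying b) {ε : ℝ} (hε : 0 < ε) :
    ∃ C : ℝ, 0 < C ∧ ∀ s t : ℝ, 0 < s → s ≤ t →
      b s ≤ C * (t / s) ^ ε * b t ∧ b t ≤ C * (t / s) ^ ε * b s := by
  obtain ⟨C₁, hC₁, h1⟩ := (hb.almostIncreasing ε hε).exists_le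
  obtain ⟨C₂, hC₂, h2⟩ := (hb.almostDecreasing ε hε).exists_le
  refine ⟨max C₁ C₂, lt_max_of_lt_left hC₁, fun s t hs hst => ?_⟩
  have ht : 0 < t := hs.trans_le hst
  have hbs := hb.pos s hs
  have hbt := hb.pos t ht
  have hsε : 0 < s ^ ε := by positivity
  have htε : 0 < t ^ ε := by positivity
  rw [Real.div_rpow ht.le hs.le]
  constructor
  · calc b s = (s ^ ε)⁻¹ * (s ^ ε * b s) := by field_simp
      _ ≤ (s ^ ε)⁻¹ * (C₁ * (t ^ ε * b t)) :=
        mul_le_mul_of_nonneg_left (h1 s t hs hst) (by positivity)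
      _ = C₁ * (t ^ ε / s ^ ε) * b t := by field_simp
      _ ≤ _ := by gcongr; exact le_max_left _ _
  · have := h2 s t hs hst
    simp only [Real.rpow_neg hs.le, Real.rpow_neg ht.le] at this
    calc b t = t ^ ε * ((t ^ ε)⁻¹ * b t) := by field_simp
      _ ≤ t ^ ε * (C₂ * ((s ^ ε)⁻¹ * b s)) := by gcongr
      _ = C₂ * (t ^ ε / s ^ ε) * b s := by field_simp
      _ ≤ _ := by gcongr; exact le_max_right _ _

/-- The weights `t^{-α} b(t)` are comparable at comparable points. -/
lemma SlowlyVarying.exists_compare_weight (hb : SlowlyVarying b) {α : ℝ} (hα : 0 ≤ α) (m : ℝ)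
    (hm : 1 ≤ m) :
    ∃ C : ℝ, 0 < C ∧ ∀ s t : ℝ, 0 < s → s ≤ t → t ≤ m * s →
      s ^ (-α) * b s ≤ C * (t ^ (-α) * b t) ∧ t ^ (-α) * b t ≤ C * (s ^ (-α) * b s) := by
  obtain ⟨C, hC, h⟩ := hb.exists_compare one_pos
  refine ⟨C * m * m ^ α, by positivity, fun s t hs hst hts => ?_⟩
  have ht : 0 < t := hs.trans_le hst
  have hbs := hb.pos s hs
  have hbt := hb.pos t ht
  obtain ⟨h1, h2⟩ := h s t hs hst
  have hq : t / s ≤ m := (div_le_iff₀ hs).2 hts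
  rw [Real.rpow_one] at h1 h2
  have h3 : s ^ (-α) ≤ m ^ α * t ^ (-α) := by
    rw [Real.rpow_neg hs.le, Real.rpow_neg ht.le, ← div_eq_mul_inv, ← Real.div_rpow (by linarith)
      ht.le, ← Real.inv_rpow hs.le]
    refine Real.rpow_le_rpow (by positivity) ?_ hα
    rw [le_div_iff₀ ht, inv_mul_eq_div]
    exact hq
  have h4 : t ^ (-α) ≤ s ^ (-α) := Real.rpow_le_rpow_of_nonpos hs hst (by linarith)
  constructor
  · calc s ^ (-α) * b s ≤ (m ^ α * t ^ (-α)) * (C * (t / s) * b t) := by gcongr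
      _ ≤ (m ^ α * t ^ (-α)) * (C * m * b t) := by gcongr
      _ = _ := by ring
  · calc t ^ (-α) * b t ≤ s ^ (-α) * (C * (t / s) * b s) := by gcongr
      _ ≤ s ^ (-α) * (C * m * b s) := by gcongr
      _ = C * m * 1 * (s ^ (-α) * b s) := by ring
      _ ≤ _ := by
        gcongr
        exact Real.one_le_rpow hm hα

end SlowlyVarying

/-! ### Dyadic estimates -/

/-- The dyadic number `2^i`. -/
noncomputable def dyad (i : ℤ) : ℝ := (2 : ℝ) ^ (i : ℝ)

lemma dyad_pos (i : ℤ) : 0 < dyad i := by unfold dyad; positivity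

lemma dyad_add_one (i : ℤ) : dyad (i + 1) = 2 * dyad i := by
  unfold dyad
  push_cast
  rw [Real.rpow_add two_pos, Real.rpow_one, mul_comm]

lemma dyad_sub_nat (i : ℤ) (j : ℕ) : dyad (i - j) = dyad i / 2 ^ j := by
  unfold dyad
  push_cast
  rw [Real.rpow_sub two_pos, Real.rpow_natCast]

lemma dyad_le_one {i : ℤ} (hi : i ≤ 0) : dyad i ≤ 1 :=
  Real.rpow_le_one_of_one_le_of_nonpos one_le_two (by exact_mod_cast hi)

lemma dyad_floor_le {t : ℝ} (ht : 0 < t) : dyad ⌊Real.logb 2 t⌋ ≤ t :=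
  ((floor_logb_eq_iff ht _).1 rfl).1

lemma lt_dyad_floor {t : ℝ} (ht : 0 < t) : t < dyad (⌊Real.logb 2 t⌋ + 1) := by
  have := ((floor_logb_eq_iff ht _).1 rfl).2
  unfold dyad
  push_cast
  exact this

lemma dyad_mono {i j : ℤ} (h : i ≤ j) : dyad i ≤ dyad j :=
  Real.rpow_le_rpow_of_exponent_le one_le_two (by exact_mod_cast h)

/-- The sequence `2^{-iα} b(2^i) E_Y(f, 2^i)`, `i ≤ -1`. -/
noncomputable def dyadicWeight {Ω : Type*} [MetricSpace Ω] [MeasurableSpace Ω] (μ : Measure Ω)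
    (Y : (Ω → ℝ≥0∞) → ℝ≥0∞) (α : ℝ) (b : ℝ → ℝ) (f : Ω → ℝ) (i : ℤ) : ℝ≥0∞ :=
  if i ≤ -1 then besovWeight μ Y α b f (dyad i) else 0

section Dyadic

variable {Ω : Type*} [MetricSpace Ω] [MeasurableSpace Ω] [BorelSpace Ω]
  [SecondCountableTopology Ω] {μ : Measure Ω} [SigmaFinite μ]
  {k n : ℝ} {ρ : (Ω → ℝ≥0∞) → ℝ≥0∞} {E : (ℝ → ℝ≥0∞) → ℝ≥0∞} {b : ℝ → ℝ}

lemma exists_besovWeight_compare (hΩ : IsRDSpace μ k n) (h : IsRINorm μ ρ)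
    (hb : SlowlyVarying b) {q α : ℝ} (hq : 0 < q) (hα : 0 ≤ α) :
    ∃ C : ℝ≥0, C ≠ 0 ∧ ∀ f : Ω → ℝ, Measurable f → ∀ s t : ℝ, 0 < s → s ≤ t → t ≤ 2 * s →
      besovWeight μ (convexification q ρ) α b f s ≤
        C * besovWeight μ (convexification q ρ) α b f t := by
  obtain ⟨K, hK1, hK⟩ := hΩ.exists_doubling
  obtain ⟨C, hC, hCw⟩ := hb.exists_compare_weight hα 2 one_le_two
  refine ⟨C.toNNReal * K, mul_ne_zero (by simpa using hC) (by
    rintro rfl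
    simp at hK1), fun f hf s t hs hst hts => ?_⟩
  have hC' : ((C.toNNReal : ℝ≥0) : ℝ≥0∞) = ENNReal.ofReal C := rfl
  unfold besovWeight
  calc ENNReal.ofReal (s ^ (-α) * b s) * modulus μ (convexification q ρ) f s
      ≤ ENNReal.ofReal (C * (t ^ (-α) * b t)) *
        (K * modulus μ (convexification q ρ) f t) :=
        mul_le_mul' (ENNReal.ofReal_le_ofReal (hCw s t hs hst hts).1)
          (modulus_le_mul_modulus hΩ h hK hf hq hs hst hts)
    _ = _ := by
        rw [ENNReal.ofReal_mul hC.le, ENNReal.coe_mul, hC']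
        ring

/-- By doubling, the weight at 2^i is at most a constant times its value anywhere in [2^i, 2^(i+1)).
The cutoff i ≤ -1 keeps this interval below 1. -/
lemma exists_seqNorm_dyadicWeight_le (hΩ : IsRDSpace μ k n) (h : IsRINorm μ ρ)
    (hE : IsParameter E) (hb : SlowlyVarying b) {q α : ℝ} (hq : 0 < q) (hα : 0 ≤ α) :
    ∃ C : ℝ≥0, ∀ f : Ω → ℝ, Measurable f →
      seqNorm E (dyadicWeight μ (convexification q ρ) α b f) ≤
        C * tildeNorm E ((Ioo (0 : ℝ) 1).indicator
          (besovWeight μ (convexification q ρ) α b f)) := by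
  obtain ⟨C, hC0, hC⟩ := exists_besovWeight_compare hΩ h hb hq hα
  refine ⟨C, fun f hf => ?_⟩
  set Y := convexification q ρ
  set w := dyadicWeight μ Y α b f with hw
  have hC0' : (C : ℝ≥0∞) ≠ 0 := by simpa using hC0
  calc seqNorm E w = seqNorm E (fun i => C * ((C : ℝ≥0∞)⁻¹ * w i)) := by
        congr 1
        ext i
        rw [← mul_assoc, ENNReal.mul_inv_cancel hC0' ENNReal.coe_ne_top, one_mul]
    _ ≤ C * seqNorm E (fun i => (C : ℝ≥0∞)⁻¹ * w i) := seqNorm_smul_le hE _ _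
    _ ≤ _ := by
        refine mul_le_mul' le_rfl (tildeNorm_mono hE fun t ht => ?_)
        set i := ⌊Real.logb 2 t⌋ with hi
        have h1 := dyad_floor_le ht
        have h2 := lt_dyad_floor ht
        rw [← hi] at h1 h2
        simp only [hw, dyadicWeight]
        split_ifs with hi1
        · have ht1 : t < 1 := h2.trans_le (dyad_le_one (by omega))
          rw [indicator_of_mem (show t ∈ Ioo (0 : ℝ) 1 from ⟨ht, ht1⟩), mul_comm,
            ← div_eq_mul_inv]
          rw [dyad_add_one] at h2
          refine ENNReal.div_le_of_le_mul ?_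
          rw [mul_comm]
          exact hC f hf _ _ (dyad_pos i) h1 h2.le
        · simp

variable [NullSingletonClass μ]

/-- The discrete form of `exists_modulus_le_tsum`: a convolution with the geometric kernel
2^(-jθ/2). The argument 2 · 2^(i-j) causes the shift by one, and i ≤ -2 keeps i - j + 1 within the
cutoff i ≤ -1 of `dyadicWeight`. -/
lemma exists_besovWeight_le_tsum {γ p σ θ α c : ℝ} (hΩ : IsRDSpace μ k n) (h : IsRINorm μ ρ)
    (hb : SlowlyVarying b) (hγ : 0 ≤ γ) (hp : 1 ≤ p) (hσ : 1 < σ) (hθ : 0 < θ)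
    (hα : α = θ + n * γ / p * (1 - 1 / σ)) (hc : 0 < c)
    (hball : ∀ (x : Ω) (r : ℝ), 0 < r → r ≤ 1 →
      ENNReal.ofReal (c * r ^ (n * γ)) ≤ ρ ((Metric.ball x r).indicator fun _ => 1)) :
    ∃ C : ℝ≥0, ∀ f : Ω → ℝ, Measurable f → ∀ i : ℤ, i ≤ -2 →
      besovWeight μ (convexification (σ * p) ρ) θ b f (dyad i) ≤
        C * ∑' j : ℕ, ENNReal.ofReal (2 ^ (-(θ / 2))) ^ j *
          dyadicWeight μ (convexification p ρ) α b f (i - j + 1) := by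
  obtain ⟨C₁, hC₁⟩ := exists_modulus_le_tsum hΩ h hγ hp hσ hc hball
  obtain ⟨C₂, hC₂, hcomp⟩ := hb.exists_compare (half_pos hθ)
  obtain ⟨C₃, hC₃, hcomp'⟩ := hb.exists_compare_weight le_rfl 2 one_le_two
  set δ := n * γ / p * (1 - 1 / σ) with hδ
  set C₄ := C₂ * C₃ * 2 ^ α with hC₄
  have hC₄pos : 0 < C₄ := by positivity
  refine ⟨C₁ * C₄.toNNReal, fun f hf i hi => ?_⟩
  have hC' : ((C₄.toNNReal : ℝ≥0) : ℝ≥0∞) = ENNReal.ofReal C₄ := rfl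
  have h1 := hC₁ f hf (dyad i) (dyad_pos i) (dyad_le_one (by omega))
  simp only [← dyad_sub_nat, ← dyad_add_one] at h1
  -- With s = 2^(i-j), the factor 2^(-jθ) in (2^j s)^(-θ) is split in two: one half absorbs the
  -- growth (2^j)^(θ/2) of b, the other is the kernel. The remaining powers of s combine to s^(-α).
  have hreal : ∀ j : ℕ, (dyad i ^ (-θ) * b (dyad i)) * dyad (i - j) ^ (-δ) ≤
      C₄ * (2 ^ (-(θ / 2))) ^ j * (dyad (i - j + 1) ^ (-α) * b (dyad (i - j + 1))) := by
    intro j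
    set s := dyad (i - j) with hs_def
    have hs : 0 < s := dyad_pos _
    have hi' : dyad i = 2 ^ j * s := by
      rw [hs_def, dyad_sub_nat]
      field_simp
    have hle : s ≤ 2 ^ j * s := le_mul_of_one_le_left hs.le (one_le_pow₀ one_le_two)
    have hb1 := (hcomp s (2 ^ j * s) hs hle).2
    have hb2 := (hcomp' s (2 * s) hs (by linarith) le_rfl).1
    simp only [neg_zero, Real.rpow_zero, one_mul] at hb2
    have hbs := hb.pos s hs
    have hb2s := hb.pos (2 * s) (by linarith)
    rw [dyad_add_one, hi', ← hs_def]
    rw [mul_div_cancel_right₀ _ hs.ne'] at hb1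
    have e1 : ((2 : ℝ) ^ j * s) ^ (-θ) = ((2 : ℝ) ^ (-(θ / 2))) ^ j * ((2 : ℝ) ^ (-(θ / 2))) ^ j *
        s ^ (-θ) := by
      rw [Real.mul_rpow (by positivity) hs.le, ← Real.rpow_natCast, ← Real.rpow_natCast,
        ← Real.rpow_mul two_pos.le, ← Real.rpow_mul two_pos.le, ← Real.rpow_add two_pos]
      congr 2
      ring
    have e2 : (((2 : ℝ) ^ j) ^ (θ / 2)) * ((2 : ℝ) ^ (-(θ / 2))) ^ j = 1 := by
      rw [← Real.rpow_natCast, ← Real.rpow_natCast,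
        ← Real.rpow_mul two_pos.le, ← Real.rpow_mul two_pos.le, ← Real.rpow_add two_pos]
      ring_nf
      exact Real.rpow_zero 2
    have e3 : (2 * s) ^ (-α) = (2 ^ α)⁻¹ * (s ^ (-θ) * s ^ (-δ)) := by
      rw [Real.mul_rpow two_pos.le hs.le, Real.rpow_neg two_pos.le, ← Real.rpow_add hs, hα]
      congr 2
      ring
    have h2α : (0 : ℝ) < 2 ^ α := by positivity
    calc (2 ^ j * s) ^ (-θ) * b (2 ^ j * s) * s ^ (-δ)
        ≤ (2 ^ j * s) ^ (-θ) * (C₂ * (2 ^ j) ^ (θ / 2) * (C₃ * b (2 * s))) * s ^ (-δ) := by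
          gcongr
          exact hb1.trans (by gcongr)
      _ = C₂ * C₃ * ((2 : ℝ) ^ (-(θ / 2))) ^ j *
          ((((2 : ℝ) ^ j) ^ (θ / 2)) * ((2 : ℝ) ^ (-(θ / 2))) ^ j) *
          (s ^ (-θ) * s ^ (-δ)) * b (2 * s) := by
          rw [e1]
          ring
      _ = _ := by
          rw [e2, e3, hC₄]
          field_simp
  calc besovWeight μ (convexification (σ * p) ρ) θ b f (dyad i)
      ≤ ENNReal.ofReal (dyad i ^ (-θ) * b (dyad i)) * (C₁ * ∑' j : ℕ,
          ENNReal.ofReal (dyad (i - j) ^ (-δ)) *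
            modulus μ (convexification p ρ) f (dyad (i - j + 1))) := mul_le_mul' le_rfl h1
    _ = C₁ * ∑' j : ℕ, ENNReal.ofReal ((dyad i ^ (-θ) * b (dyad i)) * dyad (i - j) ^ (-δ)) *
          modulus μ (convexification p ρ) f (dyad (i - j + 1)) := by
        rw [mul_left_comm, ← ENNReal.tsum_mul_left]
        congr 2
        ext j
        have hbi := hb.pos _ (dyad_pos i)
        have := dyad_pos i
        rw [ENNReal.ofReal_mul (p := dyad i ^ (-θ) * b (dyad i)) (by positivity), mul_assoc]
    _ ≤ C₁ * ∑' j : ℕ, ENNReal.ofReal C₄ * (ENNReal.ofReal (2 ^ (-(θ / 2))) ^ j *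
          dyadicWeight μ (convexification p ρ) α b f (i - j + 1)) := by
        refine mul_le_mul' le_rfl (ENNReal.tsum_le_tsum fun j => ?_)
        rw [dyadicWeight, if_pos (by omega), besovWeight]
        have hbi := hb.pos _ (dyad_pos (i - j + 1))
        have := dyad_pos (i - j + 1)
        calc _ ≤ ENNReal.ofReal (C₄ * (2 ^ (-(θ / 2))) ^ j *
              (dyad (i - j + 1) ^ (-α) * b (dyad (i - j + 1)))) *
              modulus μ (convexification p ρ) f (dyad (i - j + 1)) :=
              mul_le_mul' (ENNReal.ofReal_le_ofReal (hreal j)) le_rfl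
          _ = _ := by
              rw [ENNReal.ofReal_mul (by positivity), ENNReal.ofReal_mul hC₄pos.le,
                ENNReal.ofReal_pow (by positivity)]
              ring
    _ = _ := by
        rw [ENNReal.tsum_mul_left, ENNReal.coe_mul, hC', mul_assoc]

end Dyadic

/-! ### Norm estimates for the embedding. -/

section Embedding

variable {Ω : Type*} [MetricSpace Ω] [MeasurableSpace Ω] [BorelSpace Ω]
  [SecondCountableTopology Ω] {μ : Measure Ω} [SigmaFinite μ]
  {k n : ℝ} {ρ : (Ω → ℝ≥0∞) → ℝ≥0∞} {E : (ℝ → ℝ≥0∞) → ℝ≥0∞} {b : ℝ → ℝ}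

lemma normOf_le_modulus_add (hΩ : IsRDSpace μ k n) (h : IsRINorm μ ρ) {q : ℝ} (hq : 1 ≤ q)
    {f : Ω → ℝ} (hf : Measurable f) {t : ℝ} (ht : 0 < t) :
    normOf (convexification q ρ) f ≤ modulus μ (convexification q ρ) f t +
      convexification q ρ (fun x => ⨍⁻ y in Metric.ball x t, ‖f y‖ₑ ∂μ) := by
  have hT := measurable_laverage_ball_const (μ := μ) t hf.enorm
  refine (h.convexification_mono (by linarith) hf.enorm.aemeasurable
    ((measurable_osc hf t).add hT).aemeasurable (Eventually.of_forall fun x => ?_)).trans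
    (h.convexification_add_le hq (measurable_osc hf t).aemeasurable hT.aemeasurable)
  have hpos := hΩ.ball_pos x t ht
  have hfin := hΩ.ball_lt_top x t ht
  have hm : Measurable fun y => ‖f x - f y‖ₑ := (measurable_const.sub hf).enorm
  calc ‖f x‖ₑ = (∫⁻ _ in Metric.ball x t, ‖f x‖ₑ ∂μ) / μ (Metric.ball x t) := by
        rw [setLIntegral_const, ENNReal.mul_div_cancel_right hpos.ne' hfin.ne]
    _ ≤ (∫⁻ y in Metric.ball x t, (‖f x - f y‖ₑ + ‖f y‖ₑ) ∂μ) / μ (Metric.ball x t) := by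
        gcongr with y
        calc ‖f x‖ₑ = ‖(f x - f y) + f y‖ₑ := by congr 1; ring
          _ ≤ _ := enorm_add_le _ _
    _ = _ := by
        rw [lintegral_add_left hm, ENNReal.add_div, Pi.add_apply, osc, setLAverage_eq,
          setLAverage_eq]

lemma modulus_le_normOf_add (hΩ : IsRDSpace μ k n) (h : IsRINorm μ ρ) {q : ℝ} (hq : 1 ≤ q)
    {f : Ω → ℝ} (hf : Measurable f) {t : ℝ} (ht : 0 < t) :
    modulus μ (convexification q ρ) f t ≤ normOf (convexification q ρ) f +
      convexification q ρ (fun x => ⨍⁻ y in Metric.ball x t, ‖f y‖ₑ ∂μ) := by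
  have hT := measurable_laverage_ball_const (μ := μ) t hf.enorm
  refine (h.convexification_mono (by linarith) (measurable_osc hf t).aemeasurable
    (hf.enorm.add hT).aemeasurable (Eventually.of_forall fun x => ?_)).trans
    (h.convexification_add_le hq hf.enorm.aemeasurable hT.aemeasurable)
  refine setLAverage_const_add_le (hΩ.ball_pos x t ht) (hΩ.ball_lt_top x t ht) _ (fun y _ => ?_)
    Metric.isOpen_ball.measurableSet
  rw [sub_eq_add_neg, ← enorm_neg (f y)]
  exact enorm_add_le _ _

lemma inv_one_sub_ofReal_ne_top {θ : ℝ} (hθ : 0 < θ) :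
    (1 - ENNReal.ofReal (2 ^ (-(θ / 2))))⁻¹ ≠ ∞ := by
  rw [ENNReal.inv_ne_top, Ne, tsub_eq_zero_iff_le, not_le, ENNReal.ofReal_lt_one]
  exact Real.rpow_lt_one_of_one_lt_of_neg one_lt_two (by linarith)

variable [NullSingletonClass μ]

/-- The scale i is left free. The modulus term comes from the pointwise bound of a sequence by its
norm, the other from averaging at radius 2^i. Item 3 optimises over i; items 1 and 2 need only i =
-2. -/
lemma exists_normOf_le {γ p σ θ α c : ℝ} (hΩ : IsRDSpace μ k n) (h : IsRINorm μ ρ)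
    (hE : IsParameter E) (hb : SlowlyVarying b) (hγ : 0 ≤ γ) (hp : 1 ≤ p) (hσ : 1 < σ)
    (hθ : 0 < θ) (hα0 : 0 ≤ α) (hα : α = θ + n * γ / p * (1 - 1 / σ)) (hc : 0 < c)
    (hball : ∀ (x : Ω) (r : ℝ), 0 < r → r ≤ 1 →
      ENNReal.ofReal (c * r ^ (n * γ)) ≤ ρ ((Metric.ball x r).indicator fun _ => 1)) :
    ∃ C : ℝ≥0, ∀ f : Ω → ℝ, Measurable f → ∀ i : ℤ, i ≤ -2 →
      normOf (convexification (σ * p) ρ) f ≤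
        C * (ENNReal.ofReal (dyad i ^ (-(n * γ / p * (1 - 1 / σ)))) *
            normOf (convexification p ρ) f +
          ENNReal.ofReal (dyad i ^ (-θ) * b (dyad i))⁻¹ *
            tildeNorm E ((Ioo (0 : ℝ) 1).indicator
              (besovWeight μ (convexification p ρ) α b f))) := by
  obtain ⟨C₁, hC₁⟩ := exists_besovWeight_le_tsum hΩ h hb hγ hp hσ hθ hα hc hball
  obtain ⟨C₂, hC₂⟩ := exists_le_mul_seqNorm hE
  obtain ⟨C₃, hC₃⟩ := exists_seqNorm_dyadicWeight_le hΩ h hE hb (zero_lt_one.trans_le hp) hα0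
  obtain ⟨C₄, hC₄⟩ := exists_convexification_laverage_le hΩ h hp hσ hc hball
  have hσp : 1 ≤ σ * p := by nlinarith
  set q := ENNReal.ofReal (2 ^ (-(θ / 2))) with hq
  set A : ℝ≥0 := ((1 - q)⁻¹).toNNReal with hA
  have hA' : (A : ℝ≥0∞) = (1 - q)⁻¹ := ENNReal.coe_toNNReal (inv_one_sub_ofReal_ne_top hθ)
  refine ⟨C₁ * A * C₂ * C₃ + C₄, fun f hf i hi => ?_⟩
  set B := tildeNorm E ((Ioo (0 : ℝ) 1).indicator (besovWeight μ (convexification p ρ) α b f))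
    with hB
  set w := dyadicWeight μ (convexification p ρ) α b f with hw
  have ht := dyad_pos i
  set t := dyad i with ht_def
  have hbt := hb.pos t ht
  have h1 : besovWeight μ (convexification (σ * p) ρ) θ b f t ≤ C₁ * A * C₂ * C₃ * B := by
    calc _ ≤ C₁ * ∑' j : ℕ, q ^ j * w (i - j + 1) := hC₁ f hf i hi
      _ ≤ C₁ * ∑' j : ℕ, q ^ j * (C₂ * seqNorm E w) := by
          gcongr with j
          exact hC₂ w _
      _ = C₁ * A * C₂ * seqNorm E w := by
          rw [ENNReal.tsum_mul_right, ENNReal.tsum_geometric, hA']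
          ring
      _ ≤ C₁ * A * C₂ * (C₃ * B) := by
          gcongr
          exact hC₃ f hf
      _ = _ := by ring
  have h2 : modulus μ (convexification (σ * p) ρ) f t ≤
      ENNReal.ofReal (t ^ (-θ) * b t)⁻¹ * (C₁ * A * C₂ * C₃ * B) := by
    have hx : 0 < t ^ (-θ) * b t := by positivity
    calc modulus μ (convexification (σ * p) ρ) f t
        = ENNReal.ofReal (t ^ (-θ) * b t)⁻¹ *
          besovWeight μ (convexification (σ * p) ρ) θ b f t := by
          rw [besovWeight, ← mul_assoc, ← ENNReal.ofReal_mul (by positivity),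
            inv_mul_cancel₀ hx.ne', ENNReal.ofReal_one, one_mul]
      _ ≤ _ := by gcongr
  have h3 := hC₄ _ hf.enorm t t ht (dyad_le_one (by omega)) le_rfl
  set δ := n * γ / p * (1 - 1 / σ)
  have h4 : convexification p ρ (fun x => ‖f x‖ₑ) = normOf (convexification p ρ) f := rfl
  rw [h4] at h3
  calc _ ≤ _ := normOf_le_modulus_add hΩ h hσp hf ht
    _ ≤ ENNReal.ofReal (t ^ (-θ) * b t)⁻¹ * (C₁ * A * C₂ * C₃ * B) +
        C₄ * (ENNReal.ofReal (t ^ (-δ)) * normOf (convexification p ρ) f) := add_le_add h2 h3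
    _ = C₄ * (ENNReal.ofReal (t ^ (-δ)) * normOf (convexification p ρ) f) +
        C₁ * A * C₂ * C₃ * (ENNReal.ofReal (t ^ (-θ) * b t)⁻¹ * B) := by ring
    _ ≤ _ := by
        rw [mul_add]
        push_cast
        gcongr
        · exact le_add_self
        · exact le_self_add

/-- Small scales use the geometric convolution. Large scales use only norms of f, so the X^(σp)-norm
remains on the right; `exists_normOf_le` absorbs it later. -/
lemma exists_homBesovNorm_le {γ p σ θ α c : ℝ} (hΩ : IsRDSpace μ k n) (h : IsRINorm μ ρ)
    (hE : IsParameter E) (hb : SlowlyVarying b) (hγ : 0 ≤ γ) (hp : 1 ≤ p) (hσ : 1 < σ)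
    (hθ : 0 < θ) (hα0 : 0 ≤ α) (hα : α = θ + n * γ / p * (1 - 1 / σ)) (hc : 0 < c)
    (hball : ∀ (x : Ω) (r : ℝ), 0 < r → r ≤ 1 →
      ENNReal.ofReal (c * r ^ (n * γ)) ≤ ρ ((Metric.ball x r).indicator fun _ => 1)) :
    ∃ C : ℝ≥0, ∀ f : Ω → ℝ, Measurable f →
      homBesovNorm μ (convexification (σ * p) ρ) E θ b f ≤
        C * (tildeNorm E ((Ioo (0 : ℝ) 1).indicator
          (besovWeight μ (convexification p ρ) α b f)) +
          normOf (convexification p ρ) f + normOf (convexification (σ * p) ρ) f) := by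
  have hσp : 1 ≤ σ * p := by nlinarith
  obtain ⟨C₁, hC₁⟩ := exists_besovWeight_le_tsum hΩ h hb hγ hp hσ hθ hα hc hball
  obtain ⟨C₃, hC₃⟩ := exists_seqNorm_dyadicWeight_le hΩ h hE hb (zero_lt_one.trans_le hp) hα0
  obtain ⟨C₄, hC₄⟩ := exists_convexification_laverage_le hΩ h hp hσ hc hball
  obtain ⟨C₅, -, hC₅⟩ := exists_besovWeight_compare hΩ h hb (zero_lt_one.trans_le hσp) hθ.le
  obtain ⟨C₆, hC₆, hcomp⟩ := hb.exists_compare (half_pos hθ)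
  set q := ENNReal.ofReal (2 ^ (-(θ / 2))) with hq
  set A : ℝ≥0 := ((1 - q)⁻¹).toNNReal with hA
  have hA' : (A : ℝ≥0∞) = (1 - q)⁻¹ := ENNReal.coe_toNNReal (inv_one_sub_ofReal_ne_top hθ)
  set S₀ : ℝ≥0 := (seqNorm E (Pi.single 0 1)).toNNReal with hS₀
  have hS₀' : (S₀ : ℝ≥0∞) = seqNorm E (Pi.single 0 1) :=
    ENNReal.coe_toNNReal (seqNorm_single_lt_top hE).ne
  -- Here r = 1/4 separates small from large scales.
  set r : ℝ := dyad (-2) with hr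
  have hrpos : 0 < r := dyad_pos _
  have hbr := hb.pos r hrpos
  set C₇ : ℝ := C₆ * b r * r ^ (-(θ / 2)) * r ^ (-(θ / 2)) with hC₇
  set δ := n * γ / p * (1 - 1 / σ) with hδ
  set C₈ : ℝ≥0 := C₄ * (r ^ (-δ)).toNNReal with hC₈
  have hC₈' : (C₈ : ℝ≥0∞) = C₄ * ENNReal.ofReal (r ^ (-δ)) := by
    rw [hC₈, ENNReal.coe_mul]
    rfl
  have hC₇' : ((C₇.toNNReal : ℝ≥0) : ℝ≥0∞) = ENNReal.ofReal C₇ := rfl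
  refine ⟨C₅ * C₁ * A * C₃ + C₇.toNNReal * A * S₀ * (C₈ + 1), fun f hf => ?_⟩
  set B := tildeNorm E ((Ioo (0 : ℝ) 1).indicator (besovWeight μ (convexification p ρ) α b f))
    with hB
  set w := dyadicWeight μ (convexification p ρ) α b f with hw
  set NY := normOf (convexification p ρ) f with hNY
  set NZ := normOf (convexification (σ * p) ρ) f with hNZ
  set Q := NZ + C₈ * NY with hQ
  have hmodQ : ∀ t, r ≤ t → modulus μ (convexification (σ * p) ρ) f t ≤ Q := by
    intro t hrt
    refine (modulus_le_normOf_add hΩ h hσp hf (hrpos.trans_le hrt)).trans ?_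
    refine add_le_add le_rfl ((hC₄ _ hf.enorm r t hrpos (dyad_le_one (by norm_num)) hrt).trans ?_)
    rw [hC₈', mul_assoc]
    exact le_rfl
  set W₁ : ℤ → ℝ≥0∞ := fun i => ∑' j : ℕ, q ^ j * w (i + (2 - j : ℤ)) with hW₁
  -- The large-scale weights are majorised by a geometric combination of unit sequences at -2, -1,
  -- 0, …; its norm is finite since all unit sequences have norm at most that of the one at 0.
  set W₂ : ℤ → ℝ≥0∞ := fun i =>
    ∑' j : ℕ, q ^ j * (Pi.single ((j : ℤ) - 2) 1 : ℤ → ℝ≥0∞) i with hW₂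
  have hpt : ∀ t, 0 < t → besovWeight μ (convexification (σ * p) ρ) θ b f t ≤
      C₅ * C₁ * W₁ ⌊Real.logb 2 t⌋ + ENNReal.ofReal C₇ * Q * W₂ ⌊Real.logb 2 t⌋ := by
    intro t ht
    set i := ⌊Real.logb 2 t⌋ with hi
    have h1 : dyad i ≤ t := dyad_floor_le ht
    have h2 : t < dyad (i + 1) := lt_dyad_floor ht
    -- The weight at t is bounded by the one at the right endpoint 2^(i+1), and the convolution
    -- estimate there requires i + 1 ≤ -2.
    rcases le_or_gt i (-3) with hi3 | hi3
    · refine le_trans ?_ le_self_add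
      calc _ ≤ C₅ * besovWeight μ (convexification (σ * p) ρ) θ b f (dyad (i + 1)) :=
            hC₅ f hf _ _ ht h2.le (by rw [dyad_add_one]; linarith)
        _ ≤ C₅ * (C₁ * ∑' j : ℕ, q ^ j * w (i + 1 - j + 1)) :=
            mul_le_mul' le_rfl (hC₁ f hf _ (by omega))
        _ = _ := by
            rw [mul_assoc, hW₁]
            congr 3
            ext j
            congr 2
            ring
    · refine le_trans ?_ le_add_self
      obtain ⟨m, hm⟩ : ∃ m : ℕ, i = m - 2 := ⟨(i + 2).toNat, by omega⟩
      have hri : r ≤ dyad i := dyad_mono (by omega)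
      have hrt : r ≤ t := hri.trans h1
      have hW : q ^ m ≤ W₂ i := by
        refine le_trans ?_ (ENNReal.le_tsum m)
        rw [← hm, Pi.single_eq_same, mul_one]
      have hdi : dyad i = 2 ^ m * r := by
        have := dyad_sub_nat i m
        rw [show i - m = -2 by omega, ← hr] at this
        rw [this]
        field_simp
      -- Relative to r, b(t) grows at most like (t/r)^(θ/2), which leaves the decay t^(-θ/2) ≤ (2^m
      -- r)^(-θ/2).
      have hreal : t ^ (-θ) * b t ≤ C₇ * (2 ^ (-(θ / 2))) ^ m := by
        have hb1 := (hcomp r t hrpos hrt).2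
        rw [Real.div_rpow ht.le hrpos.le, div_eq_mul_inv, ← Real.rpow_neg hrpos.le] at hb1
        have e1 : t ^ (-θ) * t ^ (θ / 2) = t ^ (-(θ / 2)) := by
          rw [← Real.rpow_add ht]
          congr 1
          ring
        have e2 : t ^ (-(θ / 2)) ≤ (2 ^ (-(θ / 2))) ^ m * r ^ (-(θ / 2)) := by
          calc t ^ (-(θ / 2)) ≤ (dyad i) ^ (-(θ / 2)) :=
                Real.rpow_le_rpow_of_nonpos (dyad_pos i) h1 (by linarith)
            _ = _ := by
                rw [hdi, Real.mul_rpow (by positivity) hrpos.le, ← Real.rpow_natCast,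
                  ← Real.rpow_natCast, ← Real.rpow_mul two_pos.le, ← Real.rpow_mul two_pos.le,
                  mul_comm (m : ℝ)]
        calc t ^ (-θ) * b t ≤ t ^ (-θ) * (C₆ * (t ^ (θ / 2) * r ^ (-(θ / 2))) * b r) := by gcongr
          _ = t ^ (-θ) * t ^ (θ / 2) * (C₆ * b r * r ^ (-(θ / 2))) := by ring
          _ ≤ (2 ^ (-(θ / 2))) ^ m * r ^ (-(θ / 2)) * (C₆ * b r * r ^ (-(θ / 2))) := by
              rw [e1]
              gcongr
          _ = _ := by rw [hC₇]; ring
      calc besovWeight μ (convexification (σ * p) ρ) θ b f t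
          ≤ ENNReal.ofReal (C₇ * (2 ^ (-(θ / 2))) ^ m) * Q :=
            mul_le_mul' (ENNReal.ofReal_le_ofReal hreal) (hmodQ t hrt)
        _ = ENNReal.ofReal C₇ * Q * q ^ m := by
            rw [ENNReal.ofReal_mul (by positivity), ENNReal.ofReal_pow (by positivity)]
            ring
        _ ≤ _ := by gcongr
  have hW₁' : seqNorm E W₁ ≤ A * (C₃ * B) := by
    calc seqNorm E W₁ ≤ ∑' j : ℕ, seqNorm E (fun i => q ^ j * w (i + (2 - j : ℤ))) :=
          seqNorm_tsum_le hE _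
      _ ≤ ∑' j : ℕ, q ^ j * seqNorm E w := by
          refine ENNReal.tsum_le_tsum fun j => (seqNorm_smul_le hE _ _).trans ?_
          gcongr
          exact seqNorm_shift_le hE w _
      _ = A * seqNorm E w := by rw [ENNReal.tsum_mul_right, ENNReal.tsum_geometric, hA']
      _ ≤ _ := by
          gcongr
          exact hC₃ f hf
  have hW₂' : seqNorm E W₂ ≤ A * S₀ := by
    calc seqNorm E W₂ ≤
          ∑' j : ℕ, seqNorm E (fun i => q ^ j * (Pi.single ((j : ℤ) - 2) 1 : ℤ → ℝ≥0∞) i) :=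
          seqNorm_tsum_le hE _
      _ ≤ ∑' j : ℕ, q ^ j * S₀ := by
          refine ENNReal.tsum_le_tsum fun j => (seqNorm_smul_le hE _ _).trans ?_
          rw [hS₀']
          gcongr
          exact seqNorm_single_shift_le hE _
      _ = _ := by rw [ENNReal.tsum_mul_right, ENNReal.tsum_geometric, hA']
  calc homBesovNorm μ (convexification (σ * p) ρ) E θ b f
      ≤ seqNorm E (fun i => C₅ * C₁ * W₁ i + ENNReal.ofReal C₇ * Q * W₂ i) :=
        tildeNorm_mono hE hpt
    _ ≤ C₅ * C₁ * seqNorm E W₁ + ENNReal.ofReal C₇ * Q * seqNorm E W₂ :=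
        (seqNorm_add_le hE _ _).trans
          (add_le_add (seqNorm_smul_le hE _ _) (seqNorm_smul_le hE _ _))
    _ ≤ C₅ * C₁ * (A * (C₃ * B)) + ENNReal.ofReal C₇ * Q * (A * S₀) := by gcongr
    _ = C₅ * C₁ * A * C₃ * B + ENNReal.ofReal C₇ * A * S₀ * Q := by ring
    _ ≤ C₅ * C₁ * A * C₃ * (B + NY + NZ) +
        ENNReal.ofReal C₇ * A * S₀ * ((C₈ + 1) * (B + NY + NZ)) := by
        gcongr
        · rw [add_assoc]
          exact le_self_add
        · calc Q = C₈ * NY + 1 * NZ := by rw [hQ]; ring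
            _ ≤ (C₈ + 1) * (B + NY + NZ) + 0 := by
              rw [add_zero]
              calc C₈ * NY + 1 * NZ ≤ C₈ * (B + NY + NZ) + 1 * (B + NY + NZ) := by
                    gcongr
                    · exact le_add_right le_add_self
                    · exact le_add_self
                _ = _ := by ring
            _ = _ := add_zero _
    _ = _ := by
        push_cast
        rw [hC₇']
        ring

end Embedding

/-! ### Invariance under almost everywhere equality, which permits a Borel representative of f. -/

section Congruence

variable {Ω : Type*} [MeasurableSpace Ω] {μ : Measure Ω}
  {ρ : (Ω → ℝ≥0∞) → ℝ≥0∞} {f f' : Ω → ℝ}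

lemma MemL1AddLinfty.aemeasurable (hf : MemL1AddLinfty μ f) : AEMeasurable f μ := by
  obtain ⟨g, h, hg, hh, hfgh⟩ := hf
  exact (hg.aestronglyMeasurable.aemeasurable.add hh.aestronglyMeasurable.aemeasurable).congr
    hfgh.symm

lemma normOf_congr_ae (h : IsRINorm μ ρ) {q : ℝ} (hq : 0 < q) (hf' : Measurable f')
    (hff' : f =ᵐ[μ] f') :
    normOf (convexification q ρ) f = normOf (convexification q ρ) f' := by
  refine (h.convexification_congr_ae hq hf'.enorm.aemeasurable ?_).symm
  filter_upwards [hff'] with x hx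
  rw [hx]

lemma besovWeight_congr_ae [MetricSpace Ω] [BorelSpace Ω] [SecondCountableTopology Ω] [SigmaFinite μ]
    (h : IsRINorm μ ρ) {q : ℝ} (hq : 0 < q) (hf' : Measurable f') (hff' : f =ᵐ[μ] f') (α : ℝ)
    (b : ℝ → ℝ) :
    besovWeight μ (convexification q ρ) α b f = besovWeight μ (convexification q ρ) α b f' := by
  ext t
  unfold besovWeight
  congr 1
  refine (h.convexification_congr_ae hq (measurable_osc hf' t).aemeasurable ?_).symm
  filter_upwards [hff'] with x hx
  rw [osc, hx, setLAverage_eq, setLAverage_eq]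
  congr 1
  refine lintegral_congr_ae (ae_restrict_of_ae ?_)
  filter_upwards [hff'] with y hy
  rw [hy]

end Congruence

/-! ### The empty space, where no reference ball is available and all norms vanish. -/

section Empty

variable {Ω : Type*} [MeasurableSpace Ω] [IsEmpty Ω] {μ : Measure Ω}
  {ρ : (Ω → ℝ≥0∞) → ℝ≥0∞} {E : (ℝ → ℝ≥0∞) → ℝ≥0∞}

lemma convexification_of_isEmpty (h : IsRINorm μ ρ) {q : ℝ} (hq : 0 < q) (g : Ω → ℝ≥0∞) :
    convexification q ρ g = 0 := by
  rw [show g = fun _ => 0 from Subsingleton.elim _ _, h.convexification_zero hq]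

lemma tildeNorm_zero (hE : IsParameter E) : tildeNorm E (fun _ => 0) = 0 := by
  have h1 := seqNorm_eq hE fun _ => 0
  rw [IsRINorm.zero hE] at h1
  exact h1

lemma homBesovNorm_of_isEmpty [MetricSpace Ω] (h : IsRINorm μ ρ) (hE : IsParameter E) {q : ℝ} (hq : 0 < q)
    (θ : ℝ) (b : ℝ → ℝ) (f : Ω → ℝ) : homBesovNorm μ (convexification q ρ) E θ b f = 0 := by
  have : besovWeight μ (convexification q ρ) θ b f = fun _ => 0 := by
    ext t
    rw [besovWeight, modulus, convexification_of_isEmpty h hq, mul_zero]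
  rw [homBesovNorm, this, tildeNorm_zero hE]

end Empty

lemma besovNorm_le_homBesovNorm_add {Ω : Type*} [MetricSpace Ω] [MeasurableSpace Ω]
    {μ : Measure Ω} {Y : (Ω → ℝ≥0∞) → ℝ≥0∞} {E : (ℝ → ℝ≥0∞) → ℝ≥0∞} (hE : IsParameter E)
    (α : ℝ) (b : ℝ → ℝ) (f : Ω → ℝ) :
    besovNorm μ Y E α b f ≤ homBesovNorm μ Y E α b f + normOf Y f :=
  add_le_add (tildeNorm_mono hE fun t _ => indicator_le_self _ _ t) le_rfl

/-- Optimisation over the dyadic scale in the estimate of the norm. -/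
lemma SlowlyVarying.exists_optimal_scale {b : ℝ → ℝ} (hb : SlowlyVarying b) {θ δ α : ℝ}
    (hθ : 0 < θ) (hδ : 0 ≤ δ) (hα : α = θ + δ) :
    ∃ C : ℝ≥0, ∀ A B : ℝ≥0∞, A ≠ 0 → A ≤ B → B ≠ ∞ → ∃ i : ℤ, i ≤ -2 ∧
      ENNReal.ofReal (dyad i ^ (-δ)) * A + ENNReal.ofReal (dyad i ^ (-θ) * b (dyad i))⁻¹ * B ≤
        C * (A ^ (θ / α) * B ^ (1 - θ / α) *
          ENNReal.ofReal (1 + 1 / b ((A / B).toReal ^ (1 / α)))) := by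
  have hα0 : 0 < α := by linarith
  obtain ⟨C₁, hC₁, hcomp⟩ := hb.exists_compare_weight hθ.le 8 (by norm_num)
  set C : ℝ := 8 ^ δ + C₁ with hC
  refine ⟨C.toNNReal, fun A B hA hAB hB => ?_⟩
  have hC' : ((C.toNNReal : ℝ≥0) : ℝ≥0∞) = ENNReal.ofReal C := rfl
  have hAt : A ≠ ∞ := ne_top_of_le_ne_top hB hAB
  have ha : 0 < A.toReal := ENNReal.toReal_pos hA hAt
  have hab : A.toReal ≤ B.toReal := ENNReal.toReal_mono hB hAB
  have hAa : A = ENNReal.ofReal A.toReal := (ENNReal.ofReal_toReal hAt).symm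
  have hBb : B = ENNReal.ofReal B.toReal := (ENNReal.ofReal_toReal hB).symm
  rw [ENNReal.toReal_div]
  set a := A.toReal
  set β := B.toReal
  have hβ : 0 < β := ha.trans_le hab
  -- The balancing scale: τ^α = a/β makes τ^(-δ) a and τ^θ β equal, with common value a^(θ/α)
  -- β^(1-θ/α).
  set τ := (a / β) ^ (1 / α) with hτ
  have hτ0 : 0 < τ := by positivity
  have hτ1 : τ ≤ 1 := Real.rpow_le_one (by positivity) ((div_le_one hβ).2 hab) (by positivity)
  set κ := ⌊Real.logb 2 τ⌋ with hκ
  have hκ0 : κ ≤ 0 := by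
    have : Real.logb 2 τ ≤ 0 := Real.logb_nonpos one_lt_two hτ0.le hτ1
    exact_mod_cast (Int.floor_le _).trans this
  -- Since τ ≤ 1, the dyadic exponent κ of τ is at most 0; lowering it by 2 meets i ≤ -2 and keeps
  -- 4r ≤ τ < 8r, whence the factor 8 in the constants.
  refine ⟨κ - 2, by omega, ?_⟩
  have h1 : dyad κ ≤ τ := dyad_floor_le hτ0
  have h2 : τ < dyad (κ + 1) := lt_dyad_floor hτ0
  set r := dyad (κ - 2) with hr
  have hr0 : 0 < r := dyad_pos _
  have hκr : dyad κ = 4 * r := by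
    have := dyad_sub_nat κ 2
    rw [Nat.cast_ofNat, ← hr] at this
    rw [this]
    ring
  rw [dyad_add_one] at h2
  have hrτ : r ≤ τ := by linarith
  have hτr : τ ≤ 8 * r := by linarith
  have hbτ := hb.pos τ hτ0
  have hbr := hb.pos r hr0
  have e1 : r ^ (-δ) ≤ 8 ^ δ * τ ^ (-δ) := by
    calc r ^ (-δ) ≤ (8⁻¹ * τ) ^ (-δ) :=
          Real.rpow_le_rpow_of_nonpos (by positivity) (by linarith) (by linarith)
      _ = _ := by
          rw [Real.mul_rpow (by norm_num) hτ0.le, Real.rpow_neg (by norm_num : (0:ℝ) ≤ 8⁻¹),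
            Real.inv_rpow (by norm_num), inv_inv]
  have e2 : (r ^ (-θ) * b r)⁻¹ ≤ C₁ * (τ ^ θ * (1 / b τ)) := by
    rw [inv_le_comm₀ (by positivity) (by positivity)]
    calc (C₁ * (τ ^ θ * (1 / b τ)))⁻¹ = C₁⁻¹ * (τ ^ (-θ) * b τ) := by
          rw [Real.rpow_neg hτ0.le]
          field_simp
      _ ≤ C₁⁻¹ * (C₁ * (r ^ (-θ) * b r)) := by
          exact mul_le_mul_of_nonneg_left (hcomp r τ hr0 hrτ hτr).2 (by positivity)
      _ = _ := by field_simp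
  set P := a ^ (θ / α) * β ^ (1 - θ / α) with hP
  have hP0 : 0 < P := by positivity
  have e3 : τ ^ θ * β = P := by
    rw [hτ, hP, ← Real.rpow_mul (by positivity), Real.div_rpow ha.le hβ.le, Real.rpow_sub hβ,
      Real.rpow_one, one_div_mul_eq_div]
    ring
  have e4 : τ ^ (-δ) * a = P := by
    have h5 : τ ^ θ = τ ^ α * τ ^ (-δ) := by
      rw [← Real.rpow_add hτ0]
      congr 1
      rw [hα]
      ring
    have h6 : τ ^ α = a / β := by
      rw [hτ, ← Real.rpow_mul (by positivity), one_div_mul_cancel hα0.ne', Real.rpow_one]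
    rw [← e3, h5, h6]
    field_simp
  have hreal : r ^ (-δ) * a + (r ^ (-θ) * b r)⁻¹ * β ≤ C * (P * (1 + 1 / b τ)) := by
    calc r ^ (-δ) * a + (r ^ (-θ) * b r)⁻¹ * β
        ≤ 8 ^ δ * τ ^ (-δ) * a + C₁ * (τ ^ θ * (1 / b τ)) * β := by gcongr
      _ = 8 ^ δ * (τ ^ (-δ) * a) + C₁ * (τ ^ θ * β * (1 / b τ)) := by ring
      _ = 8 ^ δ * P + C₁ * (P * (1 / b τ)) := by rw [e3, e4]
      _ ≤ 8 ^ δ * (P * (1 + 1 / b τ)) + C₁ * (P * (1 + 1 / b τ)) := by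
          have : 0 ≤ 1 / b τ := by positivity
          gcongr
          · nlinarith
          · linarith
      _ = _ := by rw [hC]; ring
  have hβ1 : B ^ (1 - θ / α) = ENNReal.ofReal (β ^ (1 - θ / α)) := by
    rw [hBb, ENNReal.ofReal_rpow_of_pos hβ]
  have ha1 : A ^ (θ / α) = ENNReal.ofReal (a ^ (θ / α)) := by
    rw [hAa, ENNReal.ofReal_rpow_of_pos ha]
  rw [hC', ha1, hβ1, hAa, hBb, ← ENNReal.ofReal_mul (by positivity),
    ← ENNReal.ofReal_mul (by positivity), ← ENNReal.ofReal_add (by positivity) (by positivity),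
    ← ENNReal.ofReal_mul (by positivity), ← ENNReal.ofReal_mul (by positivity),
    ← ENNReal.ofReal_mul (by positivity)]
  exact ENNReal.ofReal_le_ofReal hreal

/-! ### Assembly of the three estimates. -/

section Main

variable {Ω : Type*} [MetricSpace Ω] [MeasurableSpace Ω] [BorelSpace Ω] {μ : Measure Ω}
  {k n : ℝ} {X : (Ω → ℝ≥0∞) → ℝ≥0∞} {E : (ℝ → ℝ≥0∞) → ℝ≥0∞} {b : ℝ → ℝ}

/-- The Sobolev-type estimates on a nonempty space. -/
lemma exists_embedding_constant [Nonempty Ω] (hΩ : IsRDSpace μ k n) (hnc : NonCollapsing μ)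
    (hX : IsRINorm μ X) (hE : IsParameter E) (hb : SlowlyVarying b) {θ p σ γ α : ℝ} (hθ : 0 < θ)
    (hp : 1 ≤ p) (hσ : 1 < σ)
    (hφ : AlmostDecreasing fun t => fundamentalFunction μ X t / t ^ γ)
    (hα : α = θ + n * γ / p * (1 - 1 / σ)) :
    ∃ C : ℝ≥0, ∀ f : Ω → ℝ, AEMeasurable f μ →
      homBesovNorm μ (convexification (σ * p) X) E θ b f ≤
        C * besovNorm μ (convexification p X) E α b f ∧
      besovNorm μ (convexification (σ * p) X) E θ b f ≤
        C * besovNorm μ (convexification p X) E α b f ∧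
      (besovNorm μ (convexification p X) E α b f < ∞ →
        normOf (convexification (σ * p) X) f ≤
          C * (normOf (convexification p X) f ^ (θ / α) *
            besovNorm μ (convexification p X) E α b f ^ (1 - θ / α) *
            ENNReal.ofReal (1 + 1 / b ((normOf (convexification p X) f /
              besovNorm μ (convexification p X) E α b f).toReal ^ (1 / α))))) := by
  have := hΩ.secondCountableTopology
  have := hΩ.sigmaFinite
  have := hΩ.nullSingletonClass
  have hγ := hΩ.gamma_nonneg hX hφ
  have hn : 0 ≤ n := hΩ.k_pos.le.trans hΩ.k_le_n
  have hp0 : 0 < p := by linarith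
  have hσ0 : 0 < σ := by linarith
  have hσp : 0 < σ * p := by positivity
  have hδ : 0 ≤ n * γ / p * (1 - 1 / σ) := by
    have : 0 ≤ 1 - 1 / σ := by
      rw [sub_nonneg, div_le_one hσ0]
      exact hσ.le
    positivity
  have hα0 : 0 ≤ α := by linarith
  obtain ⟨c, hc, hball⟩ := hΩ.exists_norm_ball_lower hnc hX hφ
  obtain ⟨C₁, hC₁⟩ := exists_normOf_le hΩ hX hE hb hγ hp hσ hθ hα0 hα hc hball
  obtain ⟨C₂, hC₂⟩ := exists_homBesovNorm_le hΩ hX hE hb hγ hp hσ hθ hα0 hα hc hball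
  obtain ⟨C₃, hC₃⟩ := hb.exists_optimal_scale hθ hδ hα
  set c₁ : ℝ≥0 := (dyad (-2) ^ (-(n * γ / p * (1 - 1 / σ)))).toNNReal
  set c₂ : ℝ≥0 := ((dyad (-2) ^ (-θ) * b (dyad (-2)))⁻¹).toNNReal
  set D : ℝ≥0 := C₁ * (c₁ + c₂) with hD
  -- The first summand serves the homogeneous norm, the first two the inhomogeneous norm, and the
  -- last the interpolation inequality.
  refine ⟨C₂ * (1 + D) + D + C₁ * C₃, fun f₀ hf₀ => ?_⟩
  obtain ⟨f, hf, hff⟩ := hf₀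
  have eY := normOf_congr_ae hX hp0 hf hff
  have eZ := normOf_congr_ae hX hσp hf hff
  have eWY := besovWeight_congr_ae hX hp0 hf hff α b
  have eWZ := besovWeight_congr_ae hX hσp hf hff θ b
  have eBY : besovNorm μ (convexification p X) E α b f₀ =
      besovNorm μ (convexification p X) E α b f := by simp only [besovNorm, eY, eWY]
  have eBZ : besovNorm μ (convexification (σ * p) X) E θ b f₀ =
      besovNorm μ (convexification (σ * p) X) E θ b f := by simp only [besovNorm, eZ, eWZ]
  have eHZ : homBesovNorm μ (convexification (σ * p) X) E θ b f₀ =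
      homBesovNorm μ (convexification (σ * p) X) E θ b f := by simp only [homBesovNorm, eWZ]
  rw [eBY, eBZ, eHZ, eY, eZ]
  set NY := normOf (convexification p X) f with hNY
  set NZ := normOf (convexification (σ * p) X) f with hNZ
  set B := besovNorm μ (convexification p X) E α b f with hB
  set B' := tildeNorm E ((Ioo (0 : ℝ) 1).indicator
    (besovWeight μ (convexification p X) α b f)) with hB'
  have hBsum : B = B' + NY := rfl
  have hNYB : NY ≤ B := le_add_self
  have hB'B : B' ≤ B := le_self_add
  have hZ : NZ ≤ D * B := by
    refine (hC₁ f hf (-2) le_rfl).trans ?_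
    calc _ ≤ (C₁ : ℝ≥0∞) * (c₁ * B + c₂ * B) := by gcongr <;> exact le_rfl
      _ = _ := by
          rw [hD]
          push_cast
          ring
  have hH : homBesovNorm μ (convexification (σ * p) X) E θ b f ≤ C₂ * (1 + D) * B := by
    calc _ ≤ C₂ * (B' + NY + NZ) := hC₂ f hf
      _ ≤ C₂ * (B + D * B) := by
          rw [← hBsum]
          gcongr
      _ = _ := by ring
  refine ⟨hH.trans ?_, ?_, fun hfin => ?_⟩
  · gcongr
    push_cast
    rw [add_assoc]
    exact le_self_add
  · refine (besovNorm_le_homBesovNorm_add hE θ b f).trans ((add_le_add hH hZ).trans ?_)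
    rw [← add_mul]
    gcongr
    push_cast
    exact le_self_add
  -- If the X^(p)-norm is zero then f = 0 almost everywhere and the left side vanishes, so the value
  -- of b at 0 plays no role.
  · rcases eq_or_ne NY 0 with h0 | h0
    · have hf0 := (hX.convexification_eq_zero_iff hp0 hf.enorm.aemeasurable).1 h0
      have : NZ = 0 := (hX.convexification_eq_zero_iff hσp hf.enorm.aemeasurable).2 hf0
      rw [this]
      exact zero_le
    · obtain ⟨i, hi, hle⟩ := hC₃ NY B h0 hNYB hfin.ne
      refine (hC₁ f hf i hi).trans ?_
      calc _ ≤ C₁ * (ENNReal.ofReal (dyad i ^ (-(n * γ / p * (1 - 1 / σ)))) * NY +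
            ENNReal.ofReal (dyad i ^ (-θ) * b (dyad i))⁻¹ * B) := by gcongr
        _ ≤ _ := mul_le_mul' le_rfl hle
        _ ≤ _ := by
            rw [← mul_assoc (C₁ : ℝ≥0∞) C₃, ← ENNReal.coe_mul]
            gcongr
            exact le_add_self

end Main

end HajlaszBesov

theorem mainTheorem4 {Ω : Type*} [MetricSpace Ω] [MeasurableSpace Ω] [BorelSpace Ω]
    (μ : Measure Ω) (k n : ℝ) (hΩ : HajlaszBesov.IsRDSpace μ k n)
    (hnc : HajlaszBesov.NonCollapsing μ)
    (X : (Ω → ℝ≥0∞) → ℝ≥0∞) (hX : HajlaszBesov.IsRINorm μ X)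
    (E : (ℝ → ℝ≥0∞) → ℝ≥0∞) (hE : HajlaszBesov.IsParameter E)
    (b : ℝ → ℝ) (hb : HajlaszBesov.SlowlyVarying b)
    (θ p σ γ α : ℝ) (hθ : 0 < θ) (hp : 1 ≤ p) (hσ : 1 < σ)
    (hβγ : HajlaszBesov.upperExtensionIndex (HajlaszBesov.fundamentalFunction μ X) ≤ γ)
    (hγ : γ ≤ 1)
    (hφ : HajlaszBesov.AlmostDecreasing
      fun t => HajlaszBesov.fundamentalFunction μ X t / t ^ γ)
    (hα : α = θ + n * γ / p * (1 - 1 / σ)) :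
    (HajlaszBesov.besovSpace μ (HajlaszBesov.convexification p X) E α b ⊆
        HajlaszBesov.homBesovSpace μ (HajlaszBesov.convexification (σ * p) X) E θ b ∧
      HajlaszBesov.besovSpace μ (HajlaszBesov.convexification p X) E α b ⊆
        HajlaszBesov.besovSpace μ (HajlaszBesov.convexification (σ * p) X) E θ b) ∧
    ∃ C : ℝ≥0,
      (∀ f : Ω → ℝ, HajlaszBesov.MemL1AddLinfty μ f →
        HajlaszBesov.homBesovNorm μ (HajlaszBesov.convexification (σ * p) X) E θ b f ≤
          C * HajlaszBesov.besovNorm μ (HajlaszBesov.convexification p X) E α b f) ∧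
      (∀ f : Ω → ℝ, HajlaszBesov.MemL1AddLinfty μ f →
        HajlaszBesov.besovNorm μ (HajlaszBesov.convexification (σ * p) X) E θ b f ≤
          C * HajlaszBesov.besovNorm μ (HajlaszBesov.convexification p X) E α b f) ∧
      (∀ f ∈ HajlaszBesov.besovSpace μ (HajlaszBesov.convexification p X) E α b,
        HajlaszBesov.normOf (HajlaszBesov.convexification (p * σ) X) f ≤
          C * (HajlaszBesov.normOf (HajlaszBesov.convexification p X) f ^ (θ / α) *
            HajlaszBesov.besovNorm μ (HajlaszBesov.convexification p X) E α b f ^ (1 - θ / α) *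
            ENNReal.ofReal (1 + 1 / b
              ((HajlaszBesov.normOf (HajlaszBesov.convexification p X) f /
                HajlaszBesov.besovNorm μ (HajlaszBesov.convexification p X) E α b f).toReal
                  ^ (1 / α))))) := by
  have hσp : 0 < σ * p := by positivity
  have hp0 : 0 < p := by linarith
  obtain ⟨C, hC⟩ : ∃ C : ℝ≥0, ∀ f : Ω → ℝ, AEMeasurable f μ →
      HajlaszBesov.homBesovNorm μ (HajlaszBesov.convexification (σ * p) X) E θ b f ≤
        C * HajlaszBesov.besovNorm μ (HajlaszBesov.convexification p X) E α b f ∧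
      HajlaszBesov.besovNorm μ (HajlaszBesov.convexification (σ * p) X) E θ b f ≤
        C * HajlaszBesov.besovNorm μ (HajlaszBesov.convexification p X) E α b f ∧
      (HajlaszBesov.besovNorm μ (HajlaszBesov.convexification p X) E α b f < ∞ →
        HajlaszBesov.normOf (HajlaszBesov.convexification (σ * p) X) f ≤
          C * (HajlaszBesov.normOf (HajlaszBesov.convexification p X) f ^ (θ / α) *
            HajlaszBesov.besovNorm μ (HajlaszBesov.convexification p X) E α b f ^ (1 - θ / α) *
            ENNReal.ofReal (1 + 1 / b
              ((HajlaszBesov.normOf (HajlaszBesov.convexification p X) f /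
                HajlaszBesov.besovNorm μ (HajlaszBesov.convexification p X) E α b f).toReal
                  ^ (1 / α))))) := by
    -- On the empty space the left sides are zero, so C = 0 works.
    rcases isEmpty_or_nonempty Ω with hempty | hne
    · have hN : ∀ f : Ω → ℝ,
          HajlaszBesov.normOf (HajlaszBesov.convexification (σ * p) X) f = 0 := fun f =>
        HajlaszBesov.convexification_of_isEmpty hX hσp _
      have hH : ∀ f : Ω → ℝ, HajlaszBesov.homBesovNorm μ
          (HajlaszBesov.convexification (σ * p) X) E θ b f = 0 :=
        HajlaszBesov.homBesovNorm_of_isEmpty hX hE hσp θ b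
      refine ⟨0, fun f _ => ⟨(hH f).le.trans zero_le, ?_, fun _ => (hN f).le.trans zero_le⟩⟩
      refine (HajlaszBesov.besovNorm_le_homBesovNorm_add hE θ b f).trans ?_
      rw [hH, hN, add_zero]
      exact zero_le
    · exact HajlaszBesov.exists_embedding_constant hΩ hnc hX hE hb hθ hp hσ hφ hα
  have hfin : ∀ f ∈ HajlaszBesov.besovSpace μ (HajlaszBesov.convexification p X) E α b,
      HajlaszBesov.besovNorm μ (HajlaszBesov.convexification p X) E α b f < ∞ := fun f hf =>
    (HajlaszBesov.besovNorm_le_homBesovNorm_add hE α b f).trans_lt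
      (ENNReal.add_lt_top.2 ⟨hf.1.2, hf.2⟩)
  have hsub : HajlaszBesov.besovSpace μ (HajlaszBesov.convexification p X) E α b ⊆
      HajlaszBesov.homBesovSpace μ (HajlaszBesov.convexification (σ * p) X) E θ b := fun f hf =>
    ⟨hf.1.1, (hC f hf.1.1.aemeasurable).1.trans_lt
      (ENNReal.mul_lt_top ENNReal.coe_lt_top (hfin f hf))⟩
  refine ⟨⟨hsub, fun f hf => ⟨hsub hf, ?_⟩⟩, C, fun f hf => (hC f hf.aemeasurable).1,
    fun f hf => (hC f hf.aemeasurable).2.1, fun f hf => ?_⟩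
  · exact le_add_self.trans_lt ((hC f hf.1.1.aemeasurable).2.1.trans_lt
      (ENNReal.mul_lt_top ENNReal.coe_lt_top (hfin f hf)))
  · rw [mul_comm p σ]
    exact (hC f hf.1.1.aemeasurable).2.2 (hfin f hf)
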